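/- **Proposition (Kostka–Foulkes polynomials).** Let $F$ be a field, let $t\in F$ satisfy $t^m\neq 1$ for all $m\ge 1$, and let $z\in F$ (for example $F=\mathbb{C}(t,z)$ with $t,z$ indeterminates). Put $(t)_m=\prod_{s=1}^m(1-t^s)$ and let $\binom{a}{b}_t=\frac{(t)_a}{(t)_b(t)_{a-b}}$ for $0\le b\le a$ and $0$ otherwise. Let $k\ge 0$, $n\ge 1$. Let $\mathcal{A}^+_{k,n}$ be the set of partitions $n\ge\lambda_1\ge\dots\ge\lambda_k\ge 1$ and $\tilde{\mathcal{A}}^+_{k,n}$ the set of partitions $n>\nu_1\ge\dots\ge\nu_k\ge 0$. Conjugate partitions are denoted by a prime, and $m_i(\lambda)$ is the multiplicity of the part $i$ in $\lambda$. *Tableaux.* For a semistandard tableau $T$ of shape $\kappa$ with entries in $\{1,\dots,\ell\}$ let $\emptyset=\kappa^{(0)}\subset\kappa^{(1)}\subset\dots\subset\kappa^{(\ell)}=\kappa$ be the partitions formed by the entries $\le a$, and let $$\psi'_T(t)=\prod_{a=1}^{\ell}\prod_{i\ge1}\binom{\kappa^{(a)}_i-\kappa^{(a)}_{i+1}}{\kappa^{(a)}_i-\kappa^{(a-1)}_i}_t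 ,\qquad P'_\kappa(x_1,\dots,x_\ell;t)=\sum_{|T|=\kappa}\psi'_T(t)\,x^T .$$ *Cylindric functions.* For $\lambda\in\mathcal{A}^+_{k,n}$ and $r\in\mathbb{Z}$ let $\lambda'[r]:\mathbb{Z}\to\mathbb{Z}$ be given by $\lambda'[r]_i=\lambda'_i+r$ for $1\le i\le n$ and $\lambda'[r]_{i+n}=\lambda'[r]_i-k$. For $\lambda,\mu\in\mathcal{A}^+_{k,n}$ and $d\ge 0$ let $\lambda'/d/\mu'=\{(i,j)\in\mathbb{Z}^2:\mu'[0]_i<j\le\lambda'[d]_i\}$. A cylindric tableau $T$ of this shape is a filling with $T(i+n,j-k)=T(i,j)$ which is weakly increasing along rows (in $j$) and strictly increasing down columns (in $i$); if $\mu'[0]\le\lambda'[d]$ fails, there are none. If its entries lie in $\{1,\dots,\ell\}$, let $L^{(a)}_i=\mu'[0]_i+\#\{j:T(i,j)\le a\}$, let $$\Psi'_T(t)=\prod_{a=1}^{\ell}\prod_{i=1}^{n}\binom{L^{(a)}_i-L^{(a)}_{i+1}}{L^{(a)}_i-L^{(a-1)}_i}_t ,\qquad P'_{\lambda'/d/\mu'}(x_1,\dots,x_\ell;t)=\sum_T\Psi'_T(t)\,x^T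 ,$$ where $x^T$ records the entries in the rows $1\le i\le n$. *Operators.* Let $\mathcal{F}^{\otimes n}$ be the $F$-vector space with basis $|m_1,\dots,m_n\rangle$, $m_i\in\mathbb{Z}_{\ge0}$, let $\beta_i$ lower $m_i$ by one (giving $0$ if $m_i=0$), and let $\beta_i^*$ raise $m_i$ by one and multiply by $1-t^{m_i+1}$. Put $a_i=\beta^*_{i+1}\beta_i$ for $1\le i\le n-1$ and $$\boldsymbol{g}'_r=\sum_{\lambda\vdash r}\frac{1}{(t)_\lambda}\sum_{c}(z\beta_1^*)^{c_n}a_1^{c_1}\cdots a_{n-1}^{c_{n-1}}\beta_n^{c_n},\qquad (t)_\lambda=\prod_i(t)_{\lambda_i},$$ where $c$ runs over the distinct permutations of $(\lambda_1,\dots,\lambda_n)$ (there are none if $\lambda$ has more than $n$ parts), and $\boldsymbol{g}'_r=0$ for $r<0$. For a partition $\kappa$ of length $\ell$ put $\boldsymbol{g}'_\kappa=\boldsymbol{g}'_{\kappa_1}\cdots\boldsymbol{g}'_{\kappa_\ell}$ and $$\boldsymbol{S}'_\kappa=\det(\boldsymbol{g}'_{\kappa_i-i+j})_{1\le i,j\le\ell}=\sum_{w\in\mathfrak{S}_\ell}\varepsilon(w)\,\boldsymbol{g}'_{\kappa_\ell-\ell+w_\ell}\cdots\boldsymbol{g}'_{\kappa_1-1+w_1}.$$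 Write $|\lambda\rangle=|m_1(\lambda),\dots,m_n(\lambda)\rangle$ and let $\langle\lambda|$ be the dual basis. *Kostka numbers and polynomials.* $K_{\mu\theta}$ is the number of semistandard tableaux of shape $\mu$ and weight $\theta$. The Kostka–Foulkes polynomials $K_{\nu\mu}(t)\in\mathbb{Z}[t]$ are defined by $s_\nu=\sum_{\mu}K_{\nu\mu}(t)P_\mu(x;t)$, where $s_\nu$ are the Schur and $P_\mu(x;t)$ the Hall–Littlewood functions; $K_{\nu\mu}(t)=0$ if $|\nu|\ne|\mu|$. *Statement.* Let $\lambda\in\mathcal{A}^+_{k,n}$, let $\tilde\lambda$ be $\lambda$ with all parts equal to $n$ removed, and let $d=k-m_n(\lambda)$. Let $n^k=(n,\dots,n)\in\mathcal{A}^+_{k,n}$, with conjugate $k^n$. 1. For $1\le\ell\le n-1$: $\;P'_{\lambda'/d/k^n}(x_1,\dots,x_\ell;t)=P'_{\tilde\lambda'}(x_1,\dots,x_\ell;t)$. 2. For every $\nu\in\tilde{\mathcal{A}}^+_{k,n}$, with $\ell=\nu_1$ the length of $\nu'$ and all tableaux below having entries in $\{1,\dots,\ell\}$, $$\langle\lambda|\boldsymbol{g}'_{\nu'}|n^k\rangle=z^d\sum_{\mu}K_{\mu\tilde\lambda}(t)K_{\mu'\nu'},\qquad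 \sum_{\mu}K_{\mu\tilde\lambda}(t)K_{\mu'\nu'}=\sum_{|T|=\tilde\lambda',\ \mathrm{wt}(T)=\nu'}\psi'_T(t),$$ where $\mu$ runs over the partitions of $|\tilde\lambda|$, and $$\langle\lambda|\boldsymbol{S}'_{\nu'}|n^k\rangle=z^d K_{\nu\tilde\lambda}(t),\qquad K_{\nu\tilde\lambda}(t)=\sum_{w\in\mathfrak{S}_\ell}\varepsilon(w)\sum_{|T|=\tilde\lambda',\ \mathrm{wt}(T)=\nu'(w)}\psi'_T(t),$$ where $\nu'(w)=(\nu'_1-1+w_1,\dots,\nu'_\ell-\ell+w_\ell)$. (For $z=1$ the matrix elements are equal to these expressions.) -/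

import Mathlib

namespace CylMac

noncomputable section

/-! ### Partitions

Partitions are Young diagrams; rows and columns are numbered from `0`, so that
`lam.rowLen i` is the part `λ_{i+1}` and `lam.colLen j` is the conjugate part `λ'_{j+1}`. -/

/-- `m_i(λ)`, the multiplicity of the part `i` in the partition `λ`. -/
def mult (lam : YoungDiagram) (i : ℕ) : ℕ := lam.rowLens.count i

/-- The partition obtained from `λ` by deleting all parts equal to `n`. -/
def removeParts (n : ℕ) (lam : YoungDiagram) : YoungDiagram :=
  YoungDiagram.ofRowLens (lam.rowLens.filter (fun p => p ≠ n))
    (lam.rowLens_sorted.pairwise.filter _).sortedGE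

/-- The partition `n^k` with `k` parts, all equal to `n`. -/
def rectangle (n k : ℕ) : YoungDiagram :=
  YoungDiagram.ofRowLens (List.replicate k n)
    (List.pairwise_replicate (R := (· ≥ ·)).2 (Or.inr (le_refl n))).sortedGE

/-- The partitions `n ≥ λ_1 ≥ ⋯ ≥ λ_k ≥ 1` with exactly `k` (nonzero) parts, all at most `n`. -/
def alcove (k n : ℕ) : Set YoungDiagram := {lam | lam.colLen 0 = k ∧ lam.rowLen 0 ≤ n}

/-- The partitions `n > ν_1 ≥ ⋯ ≥ ν_k ≥ 0` with at most `k` parts, all smaller than `n`. -/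
def redAlcove (k n : ℕ) : Set YoungDiagram := {nu | nu.colLen 0 ≤ k ∧ nu.rowLen 0 < n}

/-! ### q-binomial coefficients -/

/-- `(t)_m = (1 - t)(1 - t^2) ⋯ (1 - t^m)`. -/
def qPoch {F : Type*} [Field F] (t : F) (m : ℕ) : F := ∏ s ∈ Finset.range m, (1 - t ^ (s + 1))

/-- The `t`-binomial coefficient `(t)_a / ((t)_b (t)_{a-b})`, zero unless `0 ≤ b ≤ a`. -/
def qBinom {F : Type*} [Field F] (t : F) (a b : ℤ) : F :=
  if 0 ≤ b ∧ b ≤ a then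
    qPoch t a.toNat / (qPoch t b.toNat * qPoch t (a - b).toNat)
  else 0

/-! ### Tableaux -/

/-- Semistandard tableaux of shape `λ` with entries `0, …, N-1`
(standing for the letters `1, …, N`). -/
def Tab (lam : YoungDiagram) (N : ℕ) : Type :=
  {T : SemistandardYoungTableau lam // ∀ i j, (i, j) ∈ lam → T i j < N}

instance (lam : YoungDiagram) (N : ℕ) : Finite (Tab lam N) := by
  refine Finite.of_injective
    (β := lam.cells → Fin N) (fun T c => ⟨T.1 c.1.1 c.1.2, T.2 _ _ c.2⟩) ?_
  intro T S h
  apply Subtype.ext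
  ext i j
  by_cases hc : (i, j) ∈ lam
  · simpa using congrFun h ⟨(i, j), hc⟩
  · rw [T.1.zeros hc, S.1.zeros hc]

instance (lam : YoungDiagram) (N : ℕ) : Fintype (Tab lam N) := Fintype.ofFinite _

/-- The weight of a tableau: `wt(T)_a` is the number of entries equal to `a`. -/
def Tab.wt {lam : YoungDiagram} {N : ℕ} (T : Tab lam N) (a : Fin N) : ℕ :=
  (lam.cells.filter (fun c => T.1 c.1 c.2 = a)).card

/-- The cells with entries smaller than `a` form a partition `λ^{(a)}`;
this is the length of its row `i`. -/
def Tab.rowLT {lam : YoungDiagram} {N : ℕ} (T : Tab lam N) (a i : ℕ) : ℕ :=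
  ((lam.row i).filter (fun c => T.1 c.1 c.2 < a)).card

/-- The length of column `j` of the partition `λ^{(a)}` formed by the entries smaller than `a`. -/
def Tab.colLT {lam : YoungDiagram} {N : ℕ} (T : Tab lam N) (a j : ℕ) : ℕ :=
  ((lam.col j).filter (fun c => T.1 c.1 c.2 < a)).card

/-- The exponent vector of the monomial `x^T`. -/
def Tab.expo {lam : YoungDiagram} {N : ℕ} (T : Tab lam N) : Fin N →₀ ℕ :=
  Finsupp.equivFunOnFinite.symm T.wt

/-! ### The functions `P'` -/

/-- `ψ'_T(t)`: the product over the horizontal strips `λ^{(a+1)}/λ^{(a)}` of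
`∏_i [λ^{(a+1)}_i - λ^{(a+1)}_{i+1} ; λ^{(a+1)}_i - λ^{(a)}_i]_t`. -/
def Tab.psi' {F : Type*} [Field F] (t : F) {lam : YoungDiagram} {N : ℕ} (T : Tab lam N) : F :=
  ∏ a ∈ Finset.range N, ∏ i ∈ Finset.range (lam.colLen 0),
    qBinom t ((T.rowLT (a + 1) i : ℤ) - T.rowLT (a + 1) (i + 1))
      ((T.rowLT (a + 1) i : ℤ) - T.rowLT a i)

/-- The Macdonald function `P'_λ(x_1, …, x_N; t) = P_λ(x; q = t, t = 0)`, as a weighted sum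
over tableaux. -/
def macP' {F : Type*} [Field F] (t : F) (N : ℕ) (lam : YoungDiagram) : MvPolynomial (Fin N) F :=
  ∑ T : Tab lam N, MvPolynomial.monomial T.expo (T.psi' t)

open Classical in
/-- The sum of `ψ'_T(t)` over the tableaux `T` of shape `λ` and weight `θ`. It is zero if `θ` has
a negative component. -/
def psi'Sum {F : Type*} [Field F] (t : F) (lam : YoungDiagram) {N : ℕ} (θ : Fin N → ℤ) : F :=
  ∑ T ∈ (Finset.univ : Finset (Tab lam N)).filter (fun T => ∀ a, (T.wt a : ℤ) = θ a), T.psi' t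

open Classical in
/-- The Kostka number `K_{λθ}`: the number of tableaux of shape `λ` and weight `θ`. -/
def kostka (lam : YoungDiagram) {N : ℕ} (θ : Fin N → ℤ) : ℕ :=
  ((Finset.univ : Finset (Tab lam N)).filter (fun T => ∀ a, (T.wt a : ℤ) = θ a)).card

/-! ### Conjugate cylindric loops, diagrams and tableaux -/

/-- The conjugate cylindric loop `λ'[r]`: `λ'[r]_i = λ'_i + r` in the fundamental region
(here `0 ≤ i < n`), continued by `λ'[r]_{i + n} = λ'[r]_i - k`. -/
def conjLoop (k n : ℕ) (lam : YoungDiagram) (r : ℤ) (i : ℤ) : ℤ :=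
  (lam.colLen (i % (n : ℤ)).toNat : ℤ) - (i / (n : ℤ)) * k + r

/-- The conjugate cylindric skew diagram `λ'/d/μ'`, the cells between the loops `μ'[0]` and
`λ'[d]`. -/
def cylDiagram (k n : ℕ) (lam : YoungDiagram) (d : ℕ) (mu : YoungDiagram) : Set (ℤ × ℤ) :=
  {c | conjLoop k n mu 0 c.1 ≤ c.2 ∧ c.2 < conjLoop k n lam d c.1}

/-- Cylindric tableaux of shape `λ'/d/μ'` with entries `0, …, N-1`. By convention there are none
unless the loop `μ'[0]` lies inside the loop `λ'[d]`, and entries outside of the diagram are `0`. -/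
structure CylTab (k n : ℕ) (lam : YoungDiagram) (d : ℕ) (mu : YoungDiagram) (N : ℕ) where
  entry : ℤ → ℤ → ℕ
  nested : ∀ i, conjLoop k n mu 0 i ≤ conjLoop k n lam d i
  bounded : ∀ i j, (i, j) ∈ cylDiagram k n lam d mu → entry i j < N
  zeros : ∀ i j, (i, j) ∉ cylDiagram k n lam d mu → entry i j = 0
  periodic : ∀ i j, entry (i + n) (j - k) = entry i j
  col_strict : ∀ i j, (i, j) ∈ cylDiagram k n lam d mu → (i + 1, j) ∈ cylDiagram k n lam d mu →
    entry i j < entry (i + 1) j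
  row_weak : ∀ i j, (i, j) ∈ cylDiagram k n lam d mu → (i, j + 1) ∈ cylDiagram k n lam d mu →
    entry i j ≤ entry i (j + 1)

theorem CylTab.periodic_int {k n : ℕ} {lam : YoungDiagram} {d : ℕ} {mu : YoungDiagram} {N : ℕ}
    (T : CylTab k n lam d mu N) (q i j : ℤ) : T.entry (i + q * n) (j - q * k) = T.entry i j := by
  induction q using Int.induction_on with
  | zero => simp
  | succ m ih =>
    rw [← ih, ← T.periodic (i + m * n) (j - m * k)]
    congr 1 <;> ring
  | pred m ih =>
    rw [← ih, ← T.periodic (i + (-m - 1) * n) (j - (-m - 1) * k)]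
    congr 1 <;> ring

instance (k n : ℕ) [NeZero n] (lam : YoungDiagram) (d : ℕ) (mu : YoungDiagram) (N : ℕ) :
    Finite (CylTab k n lam d mu N) := by
  refine Finite.of_injective
    (β := ∀ i : Finset.Ico (0 : ℤ) n,
      Finset.Ico (conjLoop k n mu 0 i) (conjLoop k n lam d i) → Fin N)
    (fun T i j => ⟨T.entry i j, T.bounded _ _ (Finset.mem_Ico.1 j.2)⟩) ?_
  intro T S h
  have key : T.entry = S.entry := by
    funext i j
    have hn : (0 : ℤ) < n := by exact_mod_cast Nat.pos_of_ne_zero (NeZero.ne n)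
    have e1 := T.periodic_int (i / n) (i % n) (j + (i / n) * k)
    have e2 := S.periodic_int (i / n) (i % n) (j + (i / n) * k)
    rw [Int.emod_add_ediv_mul, add_sub_cancel_right] at e1 e2
    rw [e1, e2]
    by_cases hc : (i % n, j + (i / n) * k) ∈ cylDiagram k n lam d mu
    · have hi : i % n ∈ Finset.Ico (0 : ℤ) n :=
        Finset.mem_Ico.2 ⟨Int.emod_nonneg _ hn.ne', Int.emod_lt_of_pos _ hn⟩
      simpa using congrFun (congrFun h ⟨_, hi⟩) ⟨_, Finset.mem_Ico.2 hc⟩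
    · rw [T.zeros _ _ hc, S.zeros _ _ hc]
  cases T; cases S; simp only at key; subst key; rfl

instance (k n : ℕ) [NeZero n] (lam : YoungDiagram) (d : ℕ) (mu : YoungDiagram) (N : ℕ) :
    Fintype (CylTab k n lam d mu N) := Fintype.ofFinite _

/-- The weight of a cylindric tableau: the number of entries `a` in the fundamental region. -/
def CylTab.wt {k n : ℕ} {lam : YoungDiagram} {d : ℕ} {mu : YoungDiagram} {N : ℕ}
    (T : CylTab k n lam d mu N) (a : Fin N) : ℕ :=
  ∑ i ∈ Finset.range n,
    ((Finset.Ico (conjLoop k n mu 0 i) (conjLoop k n lam d i)).filter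
      (fun j => T.entry i j = a)).card

/-- The loop bounding the entries of `T` which are smaller than `a`: `μ'[0]` together with all
those cells. -/
def CylTab.loopLT {k n : ℕ} {lam : YoungDiagram} {d : ℕ} {mu : YoungDiagram} {N : ℕ}
    (T : CylTab k n lam d mu N) (a : ℕ) (i : ℤ) : ℤ :=
  conjLoop k n mu 0 i +
    ((Finset.Ico (conjLoop k n mu 0 i) (conjLoop k n lam d i)).filter
      (fun j => T.entry i j < a)).card

/-- The weight `Ψ'(t)` of the cylindric horizontal strip between the loops `M` (inner) and `L`
(outer): `∏_{i=1}^n [L_i - L_{i+1} ; L_i - M_i]_t`. If `L = λ'[d]` and `M = μ'[0]` then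
`L_i - L_{i+1} = λ'_i - λ'_{i+1}` is the multiplicity `m_i(λ)`. -/
def cylPsi' {F : Type*} [Field F] (t : F) (n : ℕ) (L M : ℤ → ℤ) : F :=
  ∏ i ∈ Finset.range n, qBinom t (L i - L (i + 1)) (L i - M i)

/-- `Ψ'_T(t)`, the product of the weights of the cylindric horizontal strips of `T`. -/
def CylTab.Psi' {F : Type*} [Field F] (t : F) {k n : ℕ} {lam : YoungDiagram} {d : ℕ}
    {mu : YoungDiagram} {N : ℕ} (T : CylTab k n lam d mu N) : F :=
  ∏ a ∈ Finset.range N, cylPsi' t n (T.loopLT (a + 1)) (T.loopLT a)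

/-- The cylindric Macdonald function `P'_{λ'/d/μ'}(x_1, …, x_N; t)`; the arguments are the
partitions `λ` and `μ`, not their conjugates. -/
def cylMacP' {F : Type*} [Field F] (t : F) (k n : ℕ) [NeZero n] (N : ℕ)
    (lam : YoungDiagram) (d : ℕ) (mu : YoungDiagram) : MvPolynomial (Fin N) F :=
  ∑ T : CylTab k n lam d mu N,
    MvPolynomial.monomial (Finsupp.equivFunOnFinite.symm T.wt) (T.Psi' t)

/-! ### Schur functions, Hall-Littlewood functions and Kostka-Foulkes polynomials -/

/-- `ψ_T(t)`: the product over the horizontal strips `λ^{(a+1)}/λ^{(a)}` of the factors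
`1 - t^{m_j(λ^{(a)})}`, over all `j` such that the strip has no cell in column `j` but has
one in column `j + 1`. -/
def Tab.psi {R : Type*} [CommRing R] (t : R) {lam : YoungDiagram} {N : ℕ} (T : Tab lam N) : R :=
  ∏ a ∈ Finset.range N,
    ∏ j ∈ (Finset.range (lam.rowLen 0)).filter (fun j =>
        T.colLT (a + 1) j = T.colLT a j ∧ T.colLT (a + 1) (j + 1) = T.colLT a (j + 1) + 1),
      (1 - t ^ (T.colLT a j - T.colLT a (j + 1)))

/-- The Hall-Littlewood function `P_λ(x_1, …, x_N; t)`. -/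
def hallLittlewoodP {R : Type*} [CommRing R] (t : R) (N : ℕ) (lam : YoungDiagram) :
    MvPolynomial (Fin N) R :=
  ∑ T : Tab lam N, MvPolynomial.monomial T.expo (T.psi t)

/-- The Schur function `s_λ(x_1, …, x_N)`. -/
def schur (R : Type*) [CommRing R] (N : ℕ) (lam : YoungDiagram) : MvPolynomial (Fin N) R :=
  ∑ T : Tab lam N, MvPolynomial.monomial T.expo 1

/-- The partitions of `m`. -/
abbrev Part (m : ℕ) : Type := {mu : YoungDiagram // mu.card = m}

theorem colLen_zero_le_card (mu : YoungDiagram) : mu.colLen 0 ≤ mu.card := by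
  rw [YoungDiagram.colLen_eq_card]
  exact Finset.card_le_card (Finset.filter_subset _ _)

theorem rowLen_zero_le_card (mu : YoungDiagram) : mu.rowLen 0 ≤ mu.card := by
  rw [YoungDiagram.rowLen_eq_card]
  exact Finset.card_le_card (Finset.filter_subset _ _)

instance (m : ℕ) : Finite (Part m) := by
  refine Finite.of_injective (β := (Finset.range m ×ˢ Finset.range m).powerset)
    (fun mu => ⟨mu.1.cells, Finset.mem_powerset.2 ?_⟩) ?_
  · rintro ⟨i, j⟩ hc
    have h1 := (YoungDiagram.mem_iff_lt_colLen.1 hc).trans_le (mu.1.colLen_anti 0 j (Nat.zero_le _))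
    have h2 := (YoungDiagram.mem_iff_lt_rowLen.1 hc).trans_le (mu.1.rowLen_anti 0 i (Nat.zero_le _))
    have h3 := colLen_zero_le_card mu.1
    have h4 := rowLen_zero_le_card mu.1
    have h5 := mu.2
    simp only [Finset.mem_product, Finset.mem_range]
    omega
  · intro a b h
    apply Subtype.ext
    apply YoungDiagram.ext
    simpa using h

instance (m : ℕ) : Fintype (Part m) := Fintype.ofFinite _

/-- The exponent vector `(μ_1, …, μ_m)`. -/
def partExpo (m : ℕ) (mu : YoungDiagram) : Fin m →₀ ℕ :=
  Finsupp.equivFunOnFinite.symm (fun i => mu.rowLen i)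

/-- `M(s, m)`: the coefficients of the Schur functions with respect to the monomial
symmetric functions. -/
def schurToMonomial (m : ℕ) : Matrix (Part m) (Part m) (Polynomial ℤ) :=
  fun lam mu => MvPolynomial.coeff (partExpo m mu) (schur (Polynomial ℤ) m lam)

/-- `M(P, m)`: the coefficients of the Hall-Littlewood functions with respect to the monomial
symmetric functions. -/
def hallLittlewoodToMonomial (m : ℕ) : Matrix (Part m) (Part m) (Polynomial ℤ) :=
  fun lam mu => MvPolynomial.coeff (partExpo m mu) (hallLittlewoodP (Polynomial.X : Polynomial ℤ) m lam)

open Classical in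
/-- `K(t) = M(s, P)`, the transition matrix from the Schur functions to the Hall-Littlewood
functions, `s_λ = ∑_μ K_{λμ}(t) P_μ(t)`, in degree `m`. The matrix `M(P, m)` is invertible over
`ℤ[t]`, see `det_hallLittlewoodToMonomial`. -/
def kostkaFoulkesMatrix (m : ℕ) : Matrix (Part m) (Part m) (Polynomial ℤ) :=
  schurToMonomial m * (hallLittlewoodToMonomial m)⁻¹

/-- The Kostka-Foulkes polynomial `K_{λμ}(t) ∈ ℤ[t]`, zero unless `|λ| = |μ|`. -/
def kostkaFoulkes (lam mu : YoungDiagram) : Polynomial ℤ :=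
  if h : lam.card = mu.card then kostkaFoulkesMatrix mu.card ⟨lam, h⟩ ⟨mu, rfl⟩ else 0

theorem partExpo_coeff {R : Type*} [CommRing R] {N : ℕ} {lam : YoungDiagram} (θ : Fin N →₀ ℕ)
    (f : Tab lam N → R)
    (h : ∀ T : Tab lam N, T.expo ≠ θ) :
    MvPolynomial.coeff θ (∑ T : Tab lam N, MvPolynomial.monomial T.expo (f T)) = 0 := by
  rw [MvPolynomial.coeff_sum]
  refine Finset.sum_eq_zero fun T _ => ?_
  rw [MvPolynomial.coeff_monomial, if_neg (h T)]

theorem Tab.le_entry {lam : YoungDiagram} {N : ℕ} (T : Tab lam N) {i j : ℕ} (h : (i, j) ∈ lam) :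
    i ≤ T.1 i j := by
  induction i with
  | zero => exact Nat.zero_le _
  | succ i ih =>
    have : T.1 i j < T.1 (i + 1) j := T.1.col_strict (Nat.lt_succ_self i) h
    have := ih (lam.up_left_mem (Nat.le_succ i) le_rfl h)
    omega

theorem card_rows_lt (lam : YoungDiagram) (r : ℕ) :
    (lam.cells.filter (fun c => c.1 < r)).card = ∑ i ∈ Finset.range r, lam.rowLen i := by
  rw [Finset.card_eq_sum_card_fiberwise (f := Prod.fst) (t := Finset.range r)
    (fun c hc => by simpa using (Finset.mem_filter.1 hc).2)]
  refine Finset.sum_congr rfl fun i hi => ?_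
  rw [YoungDiagram.rowLen_eq_card, YoungDiagram.row, Finset.filter_filter]
  congr 1
  refine Finset.filter_congr fun c _ => ⟨fun h => h.2, fun h => ⟨?_, h⟩⟩
  rw [h]; exact Finset.mem_range.1 hi

theorem Tab.card_entries_lt {lam mu : YoungDiagram} {m : ℕ} (T : Tab lam m)
    (h : T.expo = partExpo m mu) {r : ℕ} (hr : r ≤ m) :
    (lam.cells.filter (fun c => T.1 c.1 c.2 < r)).card = ∑ i ∈ Finset.range r, mu.rowLen i := by
  rw [Finset.card_eq_sum_card_fiberwise (f := fun c => T.1 c.1 c.2) (t := Finset.range r)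
    (fun c hc => by simpa using (Finset.mem_filter.1 hc).2)]
  refine Finset.sum_congr rfl fun i hi => ?_
  have hi' := Finset.mem_range.1 hi
  have := DFunLike.congr_fun h (⟨i, hi'.trans_le hr⟩ : Fin m)
  simp only [Tab.expo, partExpo, Finsupp.equivFunOnFinite_symm_apply_apply, Tab.wt] at this
  rw [← this, Finset.filter_filter]
  congr 1
  refine Finset.filter_congr fun c _ => ⟨fun h => h.2, fun h => ⟨?_, h⟩⟩
  rw [h]; exact hi'

theorem Tab.entries_lt_subset {lam : YoungDiagram} {m : ℕ} (T : Tab lam m) (r : ℕ) :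
    lam.cells.filter (fun c => T.1 c.1 c.2 < r) ⊆ lam.cells.filter (fun c => c.1 < r) := by
  intro c hc
  rw [Finset.mem_filter] at hc ⊢
  exact ⟨hc.1, (T.le_entry hc.1).trans_lt hc.2⟩

/-- The partial sums of the parts of a partition of `m`, in lexicographic order. -/
def partialSums (m : ℕ) (mu : Part m) : Lex (Fin m → ℕ) :=
  toLex (fun r => ∑ i ∈ Finset.range (r + 1), mu.1.rowLen i)

theorem Tab.partialSums_le {m : ℕ} {lam mu : Part m} (T : Tab lam.1 m)
    (h : T.expo = partExpo m mu.1) : partialSums m mu ≤ partialSums m lam := by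
  refine Pi.toLex_monotone fun r => ?_
  rw [← T.card_entries_lt h r.2, ← card_rows_lt]
  exact Finset.card_le_card (T.entries_lt_subset _)

theorem partialSums_injective (m : ℕ) : Function.Injective (partialSums m) := by
  intro lam mu h
  have hs : ∀ r ≤ m, ∑ i ∈ Finset.range r, lam.1.rowLen i = ∑ i ∈ Finset.range r, mu.1.rowLen i := by
    intro r hr
    cases r with
    | zero => simp
    | succ r => exact congrFun (toLex.injective h) ⟨r, hr⟩
  have hrow : ∀ i, lam.1.rowLen i = mu.1.rowLen i := by
    intro i
    by_cases hi : i < m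
    · have h1 := hs (i + 1) hi
      have h2 := hs i hi.le
      rw [Finset.sum_range_succ, Finset.sum_range_succ] at h1
      omega
    · have hz : ∀ nu : Part m, nu.1.rowLen i = 0 := by
        intro nu
        by_contra hne
        have h1 := YoungDiagram.mem_iff_lt_colLen.1
          (YoungDiagram.mem_iff_lt_rowLen.2 (Nat.pos_of_ne_zero hne))
        have h2 := colLen_zero_le_card nu.1
        have h3 := nu.2
        omega
      rw [hz, hz]
  apply Subtype.ext
  apply YoungDiagram.ext
  ext ⟨i, j⟩
  rw [YoungDiagram.mem_cells, YoungDiagram.mem_cells, YoungDiagram.mem_iff_lt_rowLen,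
    YoungDiagram.mem_iff_lt_rowLen, hrow]

theorem Tab.eq_row {m : ℕ} {lam : YoungDiagram} (T : Tab lam m) (h : T.expo = partExpo m lam)
    {i j : ℕ} (hc : (i, j) ∈ lam) : T.1 i j = i := by
  refine le_antisymm ?_ (T.le_entry hc)
  have hlt : i < m := (T.le_entry hc).trans_lt (T.2 i j hc)
  have heq := Finset.eq_of_subset_of_card_le (T.entries_lt_subset (i + 1))
    (by rw [T.card_entries_lt h hlt, card_rows_lt])
  have : (i, j) ∈ lam.cells.filter (fun c => c.1 < i + 1) :=
    Finset.mem_filter.2 ⟨hc, Nat.lt_succ_self i⟩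
  rw [← heq, Finset.mem_filter] at this
  exact Nat.lt_succ_iff.1 this.2

theorem hallLittlewoodToMonomial_diag (m : ℕ) (lam : Part m) :
    hallLittlewoodToMonomial m lam lam = 1 := by
  let T₀ : Tab lam.1 m := ⟨SemistandardYoungTableau.highestWeight lam.1, fun i j hc => by
    rw [SemistandardYoungTableau.highestWeight_apply, if_pos hc]
    have h1 := (YoungDiagram.mem_iff_lt_colLen.1 hc).trans_le (lam.1.colLen_anti 0 j (Nat.zero_le _))
    have h2 := colLen_zero_le_card lam.1
    have h3 := lam.2
    omega⟩
  have hT₀ : ∀ i j, (i, j) ∈ lam.1 → T₀.1 i j = i := fun i j hc => by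
    simp only [T₀, SemistandardYoungTableau.highestWeight_apply, if_pos hc]
  have hwt : T₀.expo = partExpo m lam.1 := by
    ext a
    simp only [Tab.expo, partExpo, Finsupp.equivFunOnFinite_symm_apply_apply, Tab.wt]
    rw [YoungDiagram.rowLen_eq_card, YoungDiagram.row]
    congr 1
    exact Finset.filter_congr fun c hc => by rw [hT₀ c.1 c.2 hc]
  have hcol : ∀ a j, T₀.colLT a j = min a (lam.1.colLen j) := by
    intro a j
    have : (lam.1.col j).filter (fun c => T₀.1 c.1 c.2 < a)
        = Finset.range (min a (lam.1.colLen j)) ×ˢ {j} := by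
      ext ⟨i, j'⟩
      simp only [Finset.mem_filter, YoungDiagram.mem_col_iff, Finset.mem_product, Finset.mem_range,
        Finset.mem_singleton, lt_min_iff]
      constructor
      · rintro ⟨⟨hc, rfl⟩, h⟩
        rw [hT₀ _ _ hc] at h
        exact ⟨⟨h, YoungDiagram.mem_iff_lt_colLen.1 hc⟩, rfl⟩
      · rintro ⟨⟨h1, h2⟩, rfl⟩
        have hc := YoungDiagram.mem_iff_lt_colLen.2 h2
        exact ⟨⟨hc, rfl⟩, by rw [hT₀ _ _ hc]; exact h1⟩
    rw [Tab.colLT, this]; simp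
  have hpsi : T₀.psi (Polynomial.X : Polynomial ℤ) = 1 := by
    refine Finset.prod_eq_one fun a _ => ?_
    rw [Finset.filter_false_of_mem, Finset.prod_empty]
    intro j _
    rw [hcol, hcol, hcol, hcol]
    have := lam.1.colLen_anti j (j + 1) (Nat.le_succ j)
    omega
  have huniq : ∀ T : Tab lam.1 m, T.expo = partExpo m lam.1 → T = T₀ := by
    intro T h
    apply Subtype.ext
    ext i j
    by_cases hc : (i, j) ∈ lam.1
    · rw [T.eq_row h hc, hT₀ i j hc]
    · rw [T.1.zeros hc, T₀.1.zeros hc]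
  rw [hallLittlewoodToMonomial, hallLittlewoodP, MvPolynomial.coeff_sum, Finset.sum_eq_single T₀]
  · rw [MvPolynomial.coeff_monomial, if_pos hwt, hpsi]
  · intro T _ hne
    rw [MvPolynomial.coeff_monomial, if_neg fun h => hne (huniq T h)]
  · simp

open Classical in
/-- `M(P, m)` is unitriangular. -/
theorem det_hallLittlewoodToMonomial (m : ℕ) : (hallLittlewoodToMonomial m).det = 1 := by
  let ord : LinearOrder (Part m) := LinearOrder.lift' (partialSums m) (partialSums_injective m)
  have htri : @Matrix.IsLowerTriangular _ _ _ ord.toLT (hallLittlewoodToMonomial m) := by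
    intro lam mu hlt
    refine partExpo_coeff _ _ fun T hT => ?_
    have h1 : partialSums m lam < partialSums m mu := hlt
    exact absurd (T.partialSums_le (mu := mu) hT) (not_le.2 h1)
  convert Matrix.det_of_isLowerTriangular _ htri using 1
  rw [Finset.prod_eq_one fun lam _ => hallLittlewoodToMonomial_diag m lam]

open Classical in
/-- `K(t)` is indeed the transition matrix `M(s, P)`. -/
theorem kostkaFoulkesMatrix_mul (m : ℕ) :
    kostkaFoulkesMatrix m * hallLittlewoodToMonomial m = schurToMonomial m := by
  rw [kostkaFoulkesMatrix, Matrix.mul_assoc, Matrix.nonsing_inv_mul, Matrix.mul_one]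
  rw [det_hallLittlewoodToMonomial]; exact isUnit_one

/-! ### q-bosons -/

/-- The Fock space `𝓕^{⊗ n}`: the vector space with basis `|m_1, …, m_n⟩`, `m_i ≥ 0`. -/
abbrev Fock (F : Type*) [Field F] (n : ℕ) : Type _ := (Fin n → ℕ) →₀ F

/-- `β_i |m⟩ = |…, m_i - 1, …⟩`, which is zero if `m_i = 0`. -/
def annihilate {F : Type*} [Field F] {n : ℕ} (i : Fin n) : Module.End F (Fock F n) :=
  Finsupp.linearCombination F (fun m : Fin n → ℕ =>
    if m i = 0 then 0 else Finsupp.single (Function.update m i (m i - 1)) (1 : F))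

/-- `β*_i |m⟩ = (1 - t^{m_i + 1}) |…, m_i + 1, …⟩`. -/
def create {F : Type*} [Field F] (t : F) {n : ℕ} (i : Fin n) : Module.End F (Fock F n) :=
  Finsupp.linearCombination F (fun m : Fin n → ℕ =>
    Finsupp.single (Function.update m i (m i + 1)) (1 - t ^ (m i + 1)))

/-- The word `(z β*_1)^{c_n} a_1^{c_1} ⋯ a_{n-1}^{c_{n-1}} β_n^{c_n}` with `a_i = β*_{i+1} β_i`. -/
def word {F : Type*} [Field F] (t z : F) (n : ℕ) [NeZero n] (c : Fin n → ℕ) :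
    Module.End F (Fock F n) :=
  (z • create t (0 : Fin n)) ^ c (Fin.ofNat n (n - 1)) *
    ((List.finRange n).map (fun i : Fin n =>
      if (i : ℕ) + 1 < n then (create t (i + 1) * annihilate i) ^ c i else 1)).prod *
    annihilate (Fin.ofNat n (n - 1)) ^ c (Fin.ofNat n (n - 1))

/-- The noncommutative monomial symmetric function `𝐦_λ`: the sum of the words of all distinct
permutations `c` of `(λ_1, …, λ_n)`. -/
def ncMonomial {F : Type*} [Field F] (t z : F) (n : ℕ) [NeZero n] {r : ℕ} (p : r.Partition) :
    Module.End F (Fock F n) :=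
  ∑ c ∈ (Finset.piAntidiag (Finset.univ : Finset (Fin n)) r).filter
      (fun c => (Finset.univ.val.map c).filter (fun x => x ≠ 0) = p.parts),
    word t z n c

/-- `𝐠'_r = ∑_{λ ⊢ r} 𝐦_λ / (t)_λ`. -/
def gPrime {F : Type*} [Field F] (t z : F) (n : ℕ) [NeZero n] (r : ℕ) :
    Module.End F (Fock F n) :=
  ∑ p : r.Partition, ((p.parts.map (qPoch t)).prod)⁻¹ • ncMonomial t z n p

/-- `𝐠'_r` for an integer `r`, zero if `r < 0`. -/
def gPrimeInt {F : Type*} [Field F] (t z : F) (n : ℕ) [NeZero n] (r : ℤ) :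
    Module.End F (Fock F n) :=
  if 0 ≤ r then gPrime t z n r.toNat else 0

/-- `𝐠'_λ = 𝐠'_{λ_1} 𝐠'_{λ_2} ⋯`. -/
def gPrimeProd {F : Type*} [Field F] (t z : F) (n : ℕ) [NeZero n] (lam : YoungDiagram) :
    Module.End F (Fock F n) :=
  (lam.rowLens.map (gPrime t z n)).prod

/-- `λ(w) = (λ_1 - 1 + w_1, …, λ_ℓ - ℓ + w_ℓ)` for `w ∈ 𝔖_ℓ`, `ℓ = ℓ(λ)`. -/
def shifted (lam : YoungDiagram) (w : Equiv.Perm (Fin (lam.colLen 0)))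
    (i : Fin (lam.colLen 0)) : ℤ :=
  (lam.rowLen i : ℤ) - (i : ℕ) + (w i : ℕ)

/-- `𝐒'_λ = det (𝐠'_{λ_i - i + j})_{1 ≤ i, j ≤ ℓ(λ)}`, that is
`∑_w ε(w) 𝐠'_{λ_ℓ - ℓ + w_ℓ} ⋯ 𝐠'_{λ_1 - 1 + w_1}`. -/
def SPrime {F : Type*} [Field F] (t z : F) (n : ℕ) [NeZero n] (lam : YoungDiagram) :
    Module.End F (Fock F n) :=
  ∑ w : Equiv.Perm (Fin (lam.colLen 0)), ((Equiv.Perm.sign w : ℤˣ) : ℤ) •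
    (List.ofFn (fun i => gPrimeInt t z n (shifted lam w i))).reverse.prod

/-- The occupation numbers `(m_1(λ), …, m_n(λ))`. -/
def occ (n : ℕ) (lam : YoungDiagram) : Fin n → ℕ := fun i => mult lam (i + 1)

/-- The matrix element `⟨λ|A|μ⟩`. -/
def matElt {F : Type*} [Field F] {n : ℕ} (lam : YoungDiagram) (A : Module.End F (Fock F n))
    (mu : YoungDiagram) : F :=
  A (Finsupp.single (occ n mu) 1) (occ n lam)

end

end CylMac

open CylMac

namespace CylMac

noncomputable section

/-! ### Young diagrams, horizontal strips -/

/-! Write λ̃ for `removeParts n lam`. For every column j < n one has λ'_j + d = λ̃'_j + k, so the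
loop λ'[d] lies over the flat loop of k^n exactly by the rows of λ̃'. Since λ̃ has no part n, the
last row of each period is empty and the periods do not interact. Thus a cylindric tableau of shape
λ'/d/k^n is an ordinary tableau of shape λ̃' repeated periodically, and the two weights agree
(`cylMacP'_rectangle`).

For the matrix elements, a state with k particles is encoded by a partition κ with fewer than n
rows: the differences of consecutive rows are the occupation numbers of the sites other than the
last, which holds the remaining k - κ_1 particles. The state of n^k is κ = ∅ and that of λ is κ =
λ̃', whose first row is d. In these terms `gPrime` adds a horizontal strip with weight ψ' and one
factor z for each cell in the first row (`gPrime_occState`). As long as fewer than n operators act,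
the number of rows stays below n, and a product of operators yields z^d times the sum of ψ'_T over
tableaux of shape λ̃' and prescribed weight (`matElt_reverse_prod`).

It remains to expand P' in Schur functions. The dual Cauchy identity ∑ P_λ(x;t) P'_{λ'}(y;t) = ∏ (1
+ x_i y_j) (`sum_hlChain_mul_macChain`) follows by adding one variable at a time from its skew form
in a single pair x, y (`skew_dual_cauchy`). There both sides are sums over binary words indexed by
columns, and a 2×2 matrix intertwines the two transfer products (`transfer_relation`). The product
side does not involve t; comparing with t = 0, where P and P' both become Schur functions, and
cancelling the unitriangular matrix M(P, m), gives P'_{λ'} = ∑_μ K_{μλ}(t) s_{μ'}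
(`psi'Sum_transpose`). The symmetry of the product in y makes P' symmetric, so the order of the
factors in `gPrimeProd` is irrelevant.

Finally, the bialternant formula shows that the signed sum over the shifted weights ν(w) inverts the
Kostka matrix (`sum_sign_mul_kostka`). Applied to the expansion of P', it isolates a single
K_{νλ̃}(t), which is the matrix element of `SPrime`. -/

theorem rowLen_ext {mu nu : YoungDiagram} (h : ∀ i, mu.rowLen i = nu.rowLen i) : mu = nu := by
  apply YoungDiagram.ext
  ext ⟨i, j⟩
  rw [YoungDiagram.mem_cells, YoungDiagram.mem_cells, YoungDiagram.mem_iff_lt_rowLen,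
    YoungDiagram.mem_iff_lt_rowLen, h]

theorem le_iff_rowLen {mu nu : YoungDiagram} : mu ≤ nu ↔ ∀ i, mu.rowLen i ≤ nu.rowLen i := by
  constructor
  · intro h i
    by_contra hlt
    have h1 : (i, nu.rowLen i) ∈ mu := YoungDiagram.mem_iff_lt_rowLen.2 (not_le.1 hlt)
    exact lt_irrefl _ (YoungDiagram.mem_iff_lt_rowLen.1 (h h1))
  · rintro h ⟨i, j⟩ hc
    exact YoungDiagram.mem_iff_lt_rowLen.2 ((YoungDiagram.mem_iff_lt_rowLen.1 hc).trans_le (h i))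

theorem le_iff_colLen {mu nu : YoungDiagram} : mu ≤ nu ↔ ∀ j, mu.colLen j ≤ nu.colLen j := by
  rw [← YoungDiagram.transpose_le_iff, le_iff_rowLen]
  simp only [YoungDiagram.rowLen_transpose]

theorem colLen_ext {mu nu : YoungDiagram} (h : ∀ j, mu.colLen j = nu.colLen j) : mu = nu := by
  rw [← YoungDiagram.transpose_eq_iff]
  exact rowLen_ext fun i => by simpa using h i

theorem rowLen_eq_zero_iff {mu : YoungDiagram} {i : ℕ} : mu.rowLen i = 0 ↔ mu.colLen 0 ≤ i := by
  have h1 := YoungDiagram.mem_iff_lt_rowLen (μ := mu) (i := i) (j := 0)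
  have h2 := YoungDiagram.mem_iff_lt_colLen (μ := mu) (i := i) (j := 0)
  rw [h1] at h2
  omega

theorem colLen_eq_zero_iff {mu : YoungDiagram} {j : ℕ} : mu.colLen j = 0 ↔ mu.rowLen 0 ≤ j := by
  simpa using rowLen_eq_zero_iff (mu := mu.transpose) (i := j)

theorem colLen_zero_mono {mu nu : YoungDiagram} (h : mu ≤ nu) : mu.colLen 0 ≤ nu.colLen 0 :=
  le_iff_colLen.1 h 0

theorem rowLen_zero_mono {mu nu : YoungDiagram} (h : mu ≤ nu) : mu.rowLen 0 ≤ nu.rowLen 0 :=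
  le_iff_rowLen.1 h 0

theorem card_mono {mu nu : YoungDiagram} (h : mu ≤ nu) : mu.card ≤ nu.card :=
  Finset.card_le_card (YoungDiagram.cells_subset_iff.2 h)

theorem card_transpose (mu : YoungDiagram) : mu.transpose.card = mu.card := by
  refine (Finset.card_bij (fun c _ => c.swap) ?_ ?_ ?_).symm
  · intro c hc
    simpa using hc
  · intro a _ b _ h
    exact Prod.swap_injective h
  · intro c hc
    exact ⟨c.swap, by simpa using hc, by simp⟩

theorem card_eq_sum_rowLen {mu : YoungDiagram} {B : ℕ} (hB : mu.colLen 0 ≤ B) :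
    mu.card = ∑ i ∈ Finset.range B, mu.rowLen i := by
  rw [← card_rows_lt, Finset.filter_true_of_mem]
  rintro ⟨i, j⟩ hc
  have h1 : (i, j) ∈ mu := hc
  exact ((YoungDiagram.mem_iff_lt_colLen.1 h1).trans_le
    (mu.colLen_anti 0 j (Nat.zero_le _))).trans_le hB

theorem card_eq_sum_colLen {mu : YoungDiagram} {B : ℕ} (hB : mu.rowLen 0 ≤ B) :
    mu.card = ∑ j ∈ Finset.range B, mu.colLen j := by
  rw [← card_transpose, card_eq_sum_rowLen (B := B) (by simpa using hB)]
  simp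

theorem eq_bot_of_rowLen {mu : YoungDiagram} (h : mu.rowLen 0 = 0) : mu = ⊥ := by
  apply YoungDiagram.ext
  ext ⟨i, j⟩
  have := mu.rowLen_anti 0 i (Nat.zero_le _)
  rw [YoungDiagram.mem_cells, YoungDiagram.mem_iff_lt_rowLen]
  simp
  omega

@[simp] theorem rowLen_bot (i : ℕ) : (⊥ : YoungDiagram).rowLen i = 0 := by
  by_contra h
  exact YoungDiagram.notMem_bot (i, 0) (YoungDiagram.mem_iff_lt_rowLen.2 (Nat.pos_of_ne_zero h))

@[simp] theorem colLen_bot (i : ℕ) : (⊥ : YoungDiagram).colLen i = 0 := by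
  by_contra h
  exact YoungDiagram.notMem_bot (0, i) (YoungDiagram.mem_iff_lt_colLen.2 (Nat.pos_of_ne_zero h))

theorem transpose_bot : (⊥ : YoungDiagram).transpose = ⊥ := colLen_ext fun j => by simp

theorem eq_bot_of_colLen {mu : YoungDiagram} (h : mu.colLen 0 = 0) : mu = ⊥ :=
  eq_bot_of_rowLen (rowLen_eq_zero_iff.2 h.le)

/-- The Young diagram with prescribed row lengths. -/
def ofRowFun (f : ℕ → ℕ) (hf : Antitone f) (B : ℕ) (_hB : f B = 0) : YoungDiagram where
  cells := (Finset.range B ×ˢ Finset.range (f 0)).filter fun c => c.2 < f c.1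
  isLowerSet := by
    rintro ⟨i, j⟩ ⟨i', j'⟩ ⟨hi, hj⟩ hc
    simp only [Finset.coe_filter, Finset.mem_product, Finset.mem_range, Set.mem_ofPred_eq] at hc ⊢
    have := hf hi
    simp only at hi hj this
    omega

@[simp] theorem rowLen_ofRowFun (f : ℕ → ℕ) (hf : Antitone f) (B : ℕ) (hB : f B = 0) (i : ℕ) :
    (ofRowFun f hf B hB).rowLen i = f i := by
  have key : ∀ j, (i, j) ∈ ofRowFun f hf B hB ↔ j < f i := by
    intro j
    have h1 : (i, j) ∈ ofRowFun f hf B hB ↔ (i < B ∧ j < f 0) ∧ j < f i := by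
      rw [← YoungDiagram.mem_cells]; simp [ofRowFun]
    rw [h1]
    refine ⟨fun h => h.2, fun h => ⟨⟨?_, h.trans_le (hf (Nat.zero_le i))⟩, h⟩⟩
    by_contra hlt
    have := hf (not_lt.1 hlt)
    omega
  have h1 := key (f i)
  have h2 := key ((ofRowFun f hf B hB).rowLen i)
  rw [YoungDiagram.mem_iff_lt_rowLen] at h1 h2
  omega

theorem exists_rowLen_eq (f : ℕ → ℕ) (hf : Antitone f) (B : ℕ) (hB : f B = 0) :
    ∃ mu : YoungDiagram, ∀ i, mu.rowLen i = f i := ⟨_, rowLen_ofRowFun f hf B hB⟩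

theorem exists_colLen_eq (f : ℕ → ℕ) (hf : Antitone f) (B : ℕ) (hB : f B = 0) :
    ∃ mu : YoungDiagram, ∀ j, mu.colLen j = f j :=
  ⟨(ofRowFun f hf B hB).transpose, by simp⟩

/-- `κ/μ` is a horizontal strip. -/
def HorizStrip (kap mu : YoungDiagram) : Prop :=
  mu ≤ kap ∧ ∀ i, kap.rowLen (i + 1) ≤ mu.rowLen i

/-- Interlacing of rows means at most one new cell per column. Both forms are needed: ψ' and the
operators are written in rows, ψ and the transfer argument in columns. -/
theorem horizStrip_iff_colLen {kap mu : YoungDiagram} :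
    HorizStrip kap mu ↔
      ∀ j, mu.colLen j ≤ kap.colLen j ∧ kap.colLen j ≤ mu.colLen j + 1 := by
  rw [HorizStrip, le_iff_colLen, forall_and]
  refine and_congr_right fun _ => ⟨fun h j => ?_, fun h i => ?_⟩
  · by_contra hlt
    have h1 : (mu.colLen j + 1, j) ∈ kap := YoungDiagram.mem_iff_lt_colLen.2 (not_le.1 hlt)
    have h2 := (YoungDiagram.mem_iff_lt_rowLen.1 h1).trans_le (h _)
    have h3 := YoungDiagram.mem_iff_lt_colLen.1 (YoungDiagram.mem_iff_lt_rowLen.2 h2)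
    exact lt_irrefl _ h3
  · by_contra hlt
    have h1 : (i + 1, mu.rowLen i) ∈ kap := YoungDiagram.mem_iff_lt_rowLen.2 (not_le.1 hlt)
    have h2 := (YoungDiagram.mem_iff_lt_colLen.1 h1).trans_le (h _)
    have h3 : (i, mu.rowLen i) ∈ mu := YoungDiagram.mem_iff_lt_colLen.2 (by omega)
    exact lt_irrefl _ (YoungDiagram.mem_iff_lt_rowLen.1 h3)

theorem finite_subdiagrams (kap : YoungDiagram) : {mu : YoungDiagram | mu ≤ kap}.Finite := by
  refine Set.Finite.of_finite_image
    (f := YoungDiagram.cells) (Set.Finite.subset (kap.cells.powerset.finite_toSet) ?_) ?_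
  · rintro _ ⟨mu, hmu, rfl⟩
    simpa using YoungDiagram.cells_subset_iff.2 hmu
  · intro a _ b _ h
    exact YoungDiagram.ext h

/-- The partitions `μ` such that `κ/μ` is a horizontal strip. -/
def horizSub (kap : YoungDiagram) : Finset YoungDiagram :=
  ((finite_subdiagrams kap).subset (fun _ h => h.1 : {mu | HorizStrip kap mu} ⊆ _)).toFinset

@[simp] theorem mem_horizSub {kap mu : YoungDiagram} : mu ∈ horizSub kap ↔ HorizStrip kap mu := by
  simp [horizSub]

theorem exists_rectangle (a b : ℕ) :
    ∃ mu : YoungDiagram, ∀ i, mu.rowLen i = if i < a then b else 0 :=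
  exists_rowLen_eq (fun i => if i < a then b else 0)
    (fun i j h => by dsimp only; split_ifs <;> omega) a (by simp)

/-- The partitions with at most `a` rows and `b` columns. -/
def box (a b : ℕ) : Finset YoungDiagram :=
  (finite_subdiagrams (exists_rectangle a b).choose).toFinset

@[simp] theorem mem_box {a b : ℕ} {mu : YoungDiagram} :
    mu ∈ box a b ↔ mu.colLen 0 ≤ a ∧ mu.rowLen 0 ≤ b := by
  rw [box, Set.Finite.mem_toFinset, Set.mem_ofPred_eq, le_iff_rowLen]
  simp only [(exists_rectangle a b).choose_spec, ← rowLen_eq_zero_iff]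
  constructor
  · intro h
    refine ⟨by simpa using h a, ?_⟩
    have := h 0
    split_ifs at this <;> omega
  · rintro ⟨h1, h2⟩ i
    have h3 := mu.rowLen_anti 0 i (Nat.zero_le _)
    split_ifs with h
    · omega
    · have := mu.rowLen_anti a i (not_lt.1 h)
      omega

/-! ### Sums over chains of horizontal strips -/

open Classical in
/-- The sum of `∏_a w a κ^{(a+1)} κ^{(a)}` over all chains
`∅ = κ^{(0)} ⊂ κ^{(1)} ⊂ ⋯ ⊂ κ^{(N)} = κ` of horizontal strips. -/
def chainSum {R : Type*} [CommSemiring R] (w : ℕ → YoungDiagram → YoungDiagram → R) :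
    ℕ → YoungDiagram → R
  | 0, kap => if kap = ⊥ then 1 else 0
  | N + 1, kap => ∑ mu ∈ horizSub kap, w N kap mu * chainSum w N mu

/-- A horizontal strip adds at most one row, so N strips starting from ∅ cannot produce more than N
rows. This vanishing is what lets the later sums be confined to finite boxes. -/
theorem chainSum_eq_zero {R : Type*} [CommSemiring R] (w : ℕ → YoungDiagram → YoungDiagram → R)
    {N : ℕ} {kap : YoungDiagram} (h : N < kap.colLen 0) : chainSum w N kap = 0 := by
  induction N generalizing kap with
  | zero =>
    rw [chainSum, if_neg]
    rintro rfl
    simp at h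
  | succ N ih =>
    rw [chainSum]
    refine Finset.sum_eq_zero fun mu hmu => ?_
    rw [ih, mul_zero]
    have := (horizStrip_iff_colLen.1 (mem_horizSub.1 hmu) 0).2
    omega

/-- The diagram formed by the entries smaller than `a`. -/
def Tab.sub {lam : YoungDiagram} {N : ℕ} (T : Tab lam N) (a : ℕ) : YoungDiagram where
  cells := lam.cells.filter fun c => T.1 c.1 c.2 < a
  isLowerSet := by
    rintro ⟨i, j⟩ ⟨i', j'⟩ ⟨hi, hj⟩ hc
    simp only [Finset.coe_filter, Set.mem_ofPred_eq, YoungDiagram.mem_cells] at hc ⊢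
    have h1 := lam.up_left_mem hi le_rfl hc.1
    exact ⟨lam.up_left_mem le_rfl hj h1,
      ((T.1.row_weak_of_le hj h1).trans (T.1.col_weak hi hc.1)).trans_lt hc.2⟩

theorem Tab.mem_sub {lam : YoungDiagram} {N : ℕ} {T : Tab lam N} {a i j : ℕ} :
    (i, j) ∈ T.sub a ↔ (i, j) ∈ lam ∧ T.1 i j < a := by
  rw [← YoungDiagram.mem_cells]
  simp [Tab.sub]

theorem Tab.sub_top {lam : YoungDiagram} {N : ℕ} (T : Tab lam N) : T.sub N = lam := by
  apply YoungDiagram.ext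
  ext ⟨i, j⟩
  rw [YoungDiagram.mem_cells, YoungDiagram.mem_cells, Tab.mem_sub]
  exact ⟨fun h => h.1, fun h => ⟨h, T.2 i j h⟩⟩

theorem Tab.sub_mono {lam : YoungDiagram} {N : ℕ} (T : Tab lam N) {a b : ℕ} (h : a ≤ b) :
    T.sub a ≤ T.sub b := by
  rintro ⟨i, j⟩ hc
  have hc' := Tab.mem_sub.1 hc
  exact Tab.mem_sub.2 ⟨hc'.1, hc'.2.trans_le h⟩

theorem Tab.sub_le {lam : YoungDiagram} {N : ℕ} (T : Tab lam N) (a : ℕ) : T.sub a ≤ lam := by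
  rintro ⟨i, j⟩ hc
  exact (Tab.mem_sub.1 hc).1

theorem Tab.rowLT_eq {lam : YoungDiagram} {N : ℕ} (T : Tab lam N) (a i : ℕ) :
    T.rowLT a i = (T.sub a).rowLen i := by
  rw [Tab.rowLT, YoungDiagram.rowLen_eq_card]
  congr 1
  ext ⟨i', j'⟩
  simp only [Finset.mem_filter, YoungDiagram.mem_row_iff, Tab.mem_sub]
  tauto

theorem Tab.colLT_eq {lam : YoungDiagram} {N : ℕ} (T : Tab lam N) (a j : ℕ) :
    T.colLT a j = (T.sub a).colLen j := by
  rw [Tab.colLT, YoungDiagram.colLen_eq_card]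
  congr 1
  ext ⟨i', j'⟩
  simp only [Finset.mem_filter, YoungDiagram.mem_col_iff, Tab.mem_sub]
  tauto

theorem Tab.card_sub_succ {lam : YoungDiagram} {N : ℕ} (T : Tab lam N) (a : Fin N) :
    (T.sub (a + 1)).card = T.wt a + (T.sub a).card := by
  rw [Tab.wt, YoungDiagram.card, YoungDiagram.card, ← Finset.card_union_of_disjoint]
  · congr 1
    ext c
    simp only [Tab.sub, Finset.mem_filter, Finset.mem_union]
    constructor
    · rintro ⟨h1, h2⟩
      rcases Nat.lt_succ_iff_lt_or_eq.1 h2 with h | h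
      · exact Or.inr ⟨h1, h⟩
      · exact Or.inl ⟨h1, h⟩
    · rintro (⟨h1, h2⟩ | ⟨h1, h2⟩)
      · exact ⟨h1, by omega⟩
      · exact ⟨h1, by omega⟩
  · rw [Finset.disjoint_left]
    intro c h1 h2
    simp only [Tab.sub, Finset.mem_filter] at h1 h2
    omega

theorem Tab.wt_eq {lam : YoungDiagram} {N : ℕ} (T : Tab lam N) (a : Fin N) :
    T.wt a = (T.sub (a + 1)).card - (T.sub a).card := by
  rw [T.card_sub_succ]; omega

/-- The tableau obtained by filling a horizontal strip with a new largest letter. -/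
def Tab.extend {lam mu : YoungDiagram} {N : ℕ} (h : HorizStrip lam mu) (T : Tab mu N) :
    Tab lam (N + 1) where
  val :=
    { entry := fun i j => if (i, j) ∈ mu then T.1 i j else if (i, j) ∈ lam then N else 0
      row_weak' := by
        intro i j1 j2 hj hc
        have h0 := lam.up_left_mem le_rfl hj.le hc
        by_cases h2 : (i, j2) ∈ mu
        · rw [if_pos h2, if_pos (mu.up_left_mem le_rfl hj.le h2)]
          exact T.1.row_weak hj h2
        · rw [if_neg h2, if_pos hc]
          split_ifs with h1
          · exact (T.2 _ _ h1).le
          · exact le_rfl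
      col_strict' := by
        intro i1 i2 j hi hc
        have h1 : (i1, j) ∈ mu := by
          have := (horizStrip_iff_colLen.1 h j).2
          have := YoungDiagram.mem_iff_lt_colLen.1 hc
          exact YoungDiagram.mem_iff_lt_colLen.2 (by omega)
        rw [if_pos h1]
        by_cases h2 : (i2, j) ∈ mu
        · rw [if_pos h2]
          exact T.1.col_strict hi h2
        · rw [if_neg h2, if_pos hc]
          exact T.2 _ _ h1
      zeros' := by
        intro i j hc
        rw [if_neg fun hm => hc (h.1 hm), if_neg hc] }
  property := by
    intro i j hc
    change (if (i, j) ∈ mu then T.1 i j else if (i, j) ∈ lam then N else 0) < N + 1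
    split_ifs with h1
    · exact (T.2 _ _ h1).trans (Nat.lt_succ_self N)
    · exact Nat.lt_succ_self N

theorem Tab.extend_apply {lam mu : YoungDiagram} {N : ℕ} (h : HorizStrip lam mu) (T : Tab mu N)
    (i j : ℕ) : (T.extend h).1 i j =
      if (i, j) ∈ mu then T.1 i j else if (i, j) ∈ lam then N else 0 := rfl

theorem Tab.sub_extend {lam mu : YoungDiagram} {N : ℕ} (h : HorizStrip lam mu) (T : Tab mu N)
    {a : ℕ} (ha : a ≤ N) : (T.extend h).sub a = T.sub a := by
  apply YoungDiagram.ext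
  ext ⟨i, j⟩
  rw [YoungDiagram.mem_cells, YoungDiagram.mem_cells, Tab.mem_sub, Tab.mem_sub, Tab.extend_apply]
  by_cases h1 : (i, j) ∈ mu
  · simp [h1, h.1 h1]
  · simp only [h1, if_false, false_and, iff_false, not_and, not_lt]
    intro h2
    simpa [h2] using ha

theorem Tab.horizStrip_sub {lam : YoungDiagram} {N : ℕ} (T : Tab lam N) (a : ℕ) :
    HorizStrip (T.sub (a + 1)) (T.sub a) := by
  rw [horizStrip_iff_colLen]
  intro j
  refine ⟨le_iff_colLen.1 (T.sub_mono (Nat.le_succ a)) j, ?_⟩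
  by_contra hlt
  have h1 : ((T.sub a).colLen j + 1, j) ∈ T.sub (a + 1) :=
    YoungDiagram.mem_iff_lt_colLen.2 (not_le.1 hlt)
  have h2 := Tab.mem_sub.1 h1
  have h3 := T.1.col_strict (Nat.lt_succ_self ((T.sub a).colLen j)) h2.1
  have h4 : ((T.sub a).colLen j, j) ∈ T.sub a := by
    have h5 := h2.2
    simp only [Nat.succ_eq_add_one] at h3
    exact Tab.mem_sub.2 ⟨lam.up_left_mem (Nat.le_succ _) le_rfl h2.1, by omega⟩
  exact lt_irrefl _ (YoungDiagram.mem_iff_lt_colLen.1 h4)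

theorem Tab.horizStrip_top {lam : YoungDiagram} {N : ℕ} (T : Tab lam (N + 1)) :
    HorizStrip lam (T.sub N) := by
  have := T.horizStrip_sub N
  rwa [T.sub_top] at this

/-- The restriction of a tableau to the letters before the largest one. -/
def Tab.restrict {lam : YoungDiagram} {N : ℕ} (T : Tab lam (N + 1)) : Tab (T.sub N) N where
  val :=
    { entry := fun i j => if (i, j) ∈ T.sub N then T.1 i j else 0
      row_weak' := by
        intro i j1 j2 hj hc
        rw [if_pos hc, if_pos ((T.sub N).up_left_mem le_rfl hj.le hc)]
        exact T.1.row_weak hj (T.sub_le N hc)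
      col_strict' := by
        intro i1 i2 j hi hc
        rw [if_pos hc, if_pos ((T.sub N).up_left_mem hi.le le_rfl hc)]
        exact T.1.col_strict hi (T.sub_le N hc)
      zeros' := by
        intro i j hc
        rw [if_neg hc] }
  property := by
    intro i j hc
    change (if (i, j) ∈ T.sub N then T.1 i j else 0) < N
    rw [if_pos hc]
    exact (Tab.mem_sub.1 hc).2

theorem Tab.restrict_apply {lam : YoungDiagram} {N : ℕ} (T : Tab lam (N + 1)) (i j : ℕ) :
    T.restrict.1 i j = if (i, j) ∈ T.sub N then T.1 i j else 0 := rfl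

theorem Tab.extend_restrict {lam : YoungDiagram} {N : ℕ} (T : Tab lam (N + 1)) :
    T.restrict.extend T.horizStrip_top = T := by
  apply Subtype.ext
  ext i j
  rw [Tab.extend_apply]
  by_cases h1 : (i, j) ∈ T.sub N
  · rw [if_pos h1, Tab.restrict_apply, if_pos h1]
  · rw [if_neg h1]
    by_cases h2 : (i, j) ∈ lam
    · rw [if_pos h2]
      have h3 := T.2 i j h2
      have h4 : ¬ T.1 i j < N := fun h => h1 (Tab.mem_sub.2 ⟨h2, h⟩)
      omega
    · rw [if_neg h2, T.1.zeros h2]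

/-- Removing the largest letter leaves a tableau on `T.sub N`, and the removed cells form a
horizontal strip; `Tab.extend` and `Tab.restrict` are mutually inverse. -/
theorem sum_tab_succ {R : Type*} [AddCommMonoid R] {lam : YoungDiagram} {N : ℕ}
    (f : Tab lam (N + 1) → R) :
    ∑ T, f T = ∑ mu : horizSub lam, ∑ T : Tab mu N, f (T.extend (mem_horizSub.1 mu.2)) := by
  rw [← Fintype.sum_sigma' (α := fun mu : horizSub lam => Tab (mu : YoungDiagram) N)
    (fun mu T => f (T.extend (mem_horizSub.1 mu.2)))]
  symm
  refine Fintype.sum_bijective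
    (fun p : (Σ mu : horizSub lam, Tab (mu : YoungDiagram) N) =>
      p.2.extend (mem_horizSub.1 p.1.2)) ?_ _ _ ?_
  · constructor
    · rintro ⟨⟨m1, h1⟩, T1⟩ ⟨⟨m2, h2⟩, T2⟩ h
      have hm : m1 = m2 := by
        have := congrArg (fun T : Tab lam (N + 1) => T.sub N) h
        simp only [Tab.sub_extend _ _ le_rfl] at this
        rwa [T1.sub_top, T2.sub_top] at this
      subst hm
      have hT : T1 = T2 := by
        apply Subtype.ext
        ext i j
        by_cases hc : (i, j) ∈ m1
        · have := congrArg (fun T : Tab lam (N + 1) => T.1 i j) h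
          simpa [Tab.extend_apply, hc] using this
        · rw [T1.1.zeros hc, T2.1.zeros hc]
      rw [hT]
    · intro T
      exact ⟨⟨⟨T.sub N, mem_horizSub.2 T.horizStrip_top⟩, T.restrict⟩, T.extend_restrict⟩
  · intro p
    rfl

/-- All statistics in use (ψ, ψ', monomials, conditions on the weight) factor over the letters. This
turns each sum over tableaux into a recursion in the number of letters. -/
theorem sum_tab_eq_chainSum {R : Type*} [CommSemiring R]
    (w : ℕ → YoungDiagram → YoungDiagram → R) (N : ℕ) (lam : YoungDiagram) :
    ∑ T : Tab lam N, ∏ a ∈ Finset.range N, w a (T.sub (a + 1)) (T.sub a) = chainSum w N lam := by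
  induction N generalizing lam with
  | zero =>
    rw [chainSum]
    split_ifs with h
    · subst h
      have : Unique (Tab ⊥ 0) :=
        { default := ⟨default, fun i j hc => absurd hc (YoungDiagram.notMem_bot _)⟩
          uniq := fun T => by
            apply Subtype.ext
            ext i j
            rw [T.1.zeros (YoungDiagram.notMem_bot _), SemistandardYoungTableau.zeros _
              (YoungDiagram.notMem_bot _)] }
      simp
    · refine Finset.sum_eq_zero fun T _ => ?_
      exfalso
      apply h
      apply YoungDiagram.ext
      ext ⟨i, j⟩
      simp only [YoungDiagram.mem_cells, YoungDiagram.notMem_bot, iff_false]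
      exact fun hc => absurd (T.2 i j hc) (Nat.not_lt_zero _)
  | succ N ih =>
    rw [sum_tab_succ, chainSum, ← Finset.sum_coe_sort (horizSub lam)
      (fun mu => w N lam mu * chainSum w N mu)]
    refine Finset.sum_congr rfl fun mu _ => ?_
    rw [← ih, Finset.mul_sum]
    refine Finset.sum_congr rfl fun T _ => ?_
    rw [Finset.prod_range_succ, mul_comm, Tab.sub_top, Tab.sub_extend _ _ le_rfl, Tab.sub_top]
    congr 1
    refine Finset.prod_congr rfl fun a ha => ?_
    have := Finset.mem_range.1 ha
    rw [Tab.sub_extend _ _ (by omega), Tab.sub_extend _ _ (by omega)]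

/-! ### Identities for t-binomial coefficients -/

section QBinom

variable {F : Type*} [Field F] {t : F}

theorem qPoch_succ (t : F) (m : ℕ) : qPoch t (m + 1) = qPoch t m * (1 - t ^ (m + 1)) :=
  Finset.prod_range_succ _ _

@[simp] theorem qPoch_zero (t : F) : qPoch t 0 = 1 := Finset.prod_range_zero _

theorem qPoch_ne_zero (ht : ∀ m : ℕ, 0 < m → t ^ m ≠ 1) (m : ℕ) : qPoch t m ≠ 0 :=
  Finset.prod_ne_zero_iff.2 fun s _ h => ht (s + 1) (Nat.succ_pos s) (sub_eq_zero.1 h).symm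

theorem qBinom_add (t : F) (c d : ℕ) :
    qBinom t ((c + d : ℕ) : ℤ) (c : ℤ) = qPoch t (c + d) / (qPoch t c * qPoch t d) := by
  rw [qBinom, if_pos (by omega)]
  congr; omega

theorem qBinom_eq_zero {a b : ℤ} (h : b < 0 ∨ a < b) : qBinom t a b = 0 :=
  if_neg (by omega)

theorem qBinom_ne_zero {a b : ℤ} (h : qBinom t a b ≠ 0) : 0 ≤ b ∧ b ≤ a := by
  by_contra hc
  exact h (if_neg hc)

theorem qBinom_zero_right (ht : ∀ m : ℕ, 0 < m → t ^ m ≠ 1) {a : ℤ} (ha : 0 ≤ a) :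
    qBinom t a 0 = 1 := by
  obtain ⟨a, rfl⟩ := Int.eq_ofNat_of_zero_le ha
  have := qBinom_add t 0 a
  rw [Nat.zero_add, Nat.cast_zero] at this
  rw [this, qPoch_zero, one_mul, div_self (qPoch_ne_zero ht a)]

theorem qBinom_self (ht : ∀ m : ℕ, 0 < m → t ^ m ≠ 1) {a : ℤ} (ha : 0 ≤ a) :
    qBinom t a a = 1 := by
  obtain ⟨a, rfl⟩ := Int.eq_ofNat_of_zero_le ha
  have := qBinom_add t a 0
  rw [Nat.add_zero] at this
  rw [this, qPoch_zero, mul_one, div_self (qPoch_ne_zero ht a)]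

/-- Cancellation of factorials when c < m. The truncated exponent m - c does no harm for c ≥ m: the
binomials with upper entry below c vanish, and for c = m the factor 1 - t^0 is zero. This identity,
the next one and the two Pascal rules drive the induction in `transfer_relation`. -/
theorem one_sub_mul_qBinom_pred (ht : ∀ m : ℕ, 0 < m → t ^ m ≠ 1) (m c : ℕ) :
    (1 - t ^ m) * qBinom t ((m : ℤ) - 1) c = (1 - t ^ (m - c)) * qBinom t m c := by
  rcases lt_trichotomy m c with h | rfl | h
  · rw [qBinom_eq_zero (by omega), qBinom_eq_zero (by omega)]; simp
  · rw [qBinom_eq_zero (by omega)]; simp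
  · obtain ⟨d, rfl⟩ := Nat.exists_eq_add_of_lt h
    have h1 := qBinom_add t c d
    have h2 := qBinom_add t c (d + 1)
    rw [show ((c + d + 1 : ℕ) : ℤ) - 1 = ((c + d : ℕ) : ℤ) by push_cast; ring, h1,
      show c + d + 1 = c + (d + 1) by ring, h2, show c + (d + 1) - c = d + 1 by omega,
      ← Nat.add_assoc, qPoch_succ, qPoch_succ]
    have p1 := qPoch_ne_zero ht c
    have p2 := qPoch_ne_zero ht d
    have p3 : 1 - t ^ (d + 1) ≠ 0 := fun h => ht (d + 1) (Nat.succ_pos d) (sub_eq_zero.1 h).symm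
    field_simp

theorem one_sub_mul_qBinom_succ (ht : ∀ m : ℕ, 0 < m → t ^ m ≠ 1) (m c : ℕ) :
    (1 - t ^ (c + 1)) * qBinom t m ((c : ℤ) + 1) = (1 - t ^ (m - c)) * qBinom t m c := by
  rcases lt_trichotomy m c with h | rfl | h
  · rw [qBinom_eq_zero (by omega), qBinom_eq_zero (by omega)]; simp
  · rw [qBinom_eq_zero (by omega)]; simp
  · obtain ⟨d, rfl⟩ := Nat.exists_eq_add_of_lt h
    have h1 := qBinom_add t (c + 1) d
    have h2 := qBinom_add t c (d + 1)
    rw [show ((c : ℤ) + 1) = ((c + 1 : ℕ) : ℤ) by push_cast; ring,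
      show c + d + 1 = c + 1 + d by ring, h1,
      show c + 1 + d = c + (d + 1) by ring, h2, show c + (d + 1) - c = d + 1 by omega,
      qPoch_succ t c, qPoch_succ t d]
    have p1 := qPoch_ne_zero ht c
    have p2 := qPoch_ne_zero ht d
    have p3 : 1 - t ^ (d + 1) ≠ 0 := fun h => ht (d + 1) (Nat.succ_pos d) (sub_eq_zero.1 h).symm
    have p4 : 1 - t ^ (c + 1) ≠ 0 := fun h => ht (c + 1) (Nat.succ_pos c) (sub_eq_zero.1 h).symm
    field_simp

theorem qBinom_succ_succ (ht : ∀ m : ℕ, 0 < m → t ^ m ≠ 1) (m c : ℕ) :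
    qBinom t ((m : ℤ) + 1) ((c : ℤ) + 1) =
      qBinom t m ((c : ℤ) + 1) + t ^ (m - c) * qBinom t m c := by
  rcases lt_trichotomy m c with h | rfl | h
  · rw [qBinom_eq_zero (by omega), qBinom_eq_zero (by omega), qBinom_eq_zero (by omega)]; simp
  · rw [qBinom_self ht (by omega), qBinom_self ht (by omega), qBinom_eq_zero (by omega)]; simp
  · obtain ⟨d, rfl⟩ := Nat.exists_eq_add_of_lt h
    have h1 := qBinom_add t (c + 1) d
    have h2 := qBinom_add t c (d + 1)
    have h3 := qBinom_add t (c + 1) (d + 1)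
    rw [show ((c : ℤ) + 1) = ((c + 1 : ℕ) : ℤ) by push_cast; ring,
      show ((c + d + 1 : ℕ) : ℤ) + 1 = ((c + 1 + (d + 1) : ℕ) : ℤ) by push_cast; ring, h3,
      show c + d + 1 = c + 1 + d by ring, h1,
      show c + 1 + d = c + (d + 1) by ring, h2, show c + (d + 1) - c = d + 1 by omega,
      qPoch_succ t c, qPoch_succ t d, show c + 1 + (d + 1) = c + (d + 1) + 1 by ring,
      qPoch_succ t (c + (d + 1))]
    have p1 := qPoch_ne_zero ht c
    have p2 := qPoch_ne_zero ht d
    have p3 : 1 - t ^ (d + 1) ≠ 0 := fun h => ht (d + 1) (Nat.succ_pos d) (sub_eq_zero.1 h).symm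
    have p4 : 1 - t ^ (c + 1) ≠ 0 := fun h => ht (c + 1) (Nat.succ_pos c) (sub_eq_zero.1 h).symm
    field_simp
    ring

theorem qBinom_succ_succ' (ht : ∀ m : ℕ, 0 < m → t ^ m ≠ 1) (m c : ℕ) :
    qBinom t ((m : ℤ) + 1) ((c : ℤ) + 1) =
      qBinom t m c + t ^ (c + 1) * qBinom t m ((c : ℤ) + 1) := by
  linear_combination qBinom_succ_succ ht m c + one_sub_mul_qBinom_succ ht m c

end QBinom

/-! ### Transfer sums over binary sequences -/

section Transfer

variable {R : Type*} [CommRing R]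

/-- A binary word of length `B`, continued by `false`. -/
def extWord {B : ℕ} (s : Fin B → Bool) (i : ℕ) : Bool := if h : i < B then s ⟨i, h⟩ else false

/-- The product of the local weights `T i (s_i) (s_{i+1})` over all binary words with prescribed
first letter `b` and `B` further letters, continued by `false`. -/
def transfer : ℕ → (ℕ → Bool → Bool → R) → Bool → R
  | 0, T, b => T 0 b false
  | B + 1, T, b => ∑ b', T 0 b b' * transfer B (fun i => T (i + 1)) b'

theorem extWord_cons_zero {B : ℕ} (b : Bool) (s : Fin B → Bool) :
    extWord (Fin.cons b s : Fin (B + 1) → Bool) 0 = b := by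
  simp [extWord]

theorem extWord_cons_succ {B : ℕ} (b : Bool) (s : Fin B → Bool) (i : ℕ) :
    extWord (Fin.cons b s : Fin (B + 1) → Bool) (i + 1) = extWord s i := by
  by_cases h : i < B
  · have h' : (⟨i + 1, Nat.succ_lt_succ h⟩ : Fin (B + 1)) = Fin.succ ⟨i, h⟩ := rfl
    simp only [extWord, Nat.succ_lt_succ_iff, h, dif_pos]
    rw [h', Fin.cons_succ]
  · simp [extWord, h]

theorem extWord_of_le {B : ℕ} (s : Fin B → Bool) {i : ℕ} (h : B ≤ i) : extWord s i = false := by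
  simp [extWord, not_lt.2 h]

theorem sum_word_succ {B : ℕ} (f : (Fin (B + 1) → Bool) → R) :
    ∑ s, f s = ∑ b, ∑ s : Fin B → Bool, f (Fin.cons b s) := by
  rw [← Fintype.sum_prod_type']
  exact (Fintype.sum_equiv (Fin.consEquiv fun _ => Bool) _ _ fun p => rfl).symm

theorem transfer_eq (B : ℕ) (T : ℕ → Bool → Bool → R) (b : Bool) :
    transfer B T b = ∑ s : Fin B → Bool, T 0 b (extWord s 0) *
      ∏ i ∈ Finset.range B, T (i + 1) (extWord s i) (extWord s (i + 1)) := by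
  induction B generalizing T b with
  | zero => simp [transfer, extWord]
  | succ B ih =>
    rw [transfer, sum_word_succ]
    refine Finset.sum_congr rfl fun b' _ => ?_
    rw [ih, Finset.mul_sum]
    refine Finset.sum_congr rfl fun s _ => ?_
    rw [Finset.prod_range_succ']
    simp only [extWord_cons_zero, extWord_cons_succ]
    ring

theorem sum_words_eq_transfer (B : ℕ) (T : ℕ → Bool → Bool → R) :
    ∑ s : Fin (B + 1) → Bool, ∏ i ∈ Finset.range (B + 1), T i (extWord s i) (extWord s (i + 1)) =
      transfer B T false + transfer B T true := by
  rw [sum_word_succ, Fintype.sum_bool, add_comm, transfer_eq, transfer_eq]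
  congr 1 <;>
  · refine Finset.sum_congr rfl fun s _ => ?_
    rw [Finset.prod_range_succ']
    simp only [extWord_cons_zero, extWord_cons_succ]
    ring

variable {F : Type*} [Field F] [Algebra F R]

/-- The local weight of column `j` in the sum over the partitions `κ` with
`κ'_j = l_j + θ_j`, containing `μ` with `μ'_j = u_j`. -/
def upWeight (t : F) (x y : R) (l u : ℕ → ℕ) (j : ℕ) (b b' : Bool) : R :=
  algebraMap F R (qBinom t ((l j + b.toNat : ℤ) - (l (j + 1) + b'.toNat))
      ((l j + b.toNat : ℤ) - u j) *
    (if b = false ∧ b' = true then 1 - t ^ (l j - l (j + 1)) else 1)) *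
  (x ^ b.toNat * y ^ (l j + b.toNat - u j))

/-- The local weight of column `j` in the sum over the partitions `ρ` with
`ρ'_j = u_j - η_j`, contained in `λ` with `λ'_j = l_j`. -/
def downWeight (t : F) (x y : R) (l u : ℕ → ℕ) (j : ℕ) (b b' : Bool) : R :=
  algebraMap F R (qBinom t ((l j : ℤ) - l (j + 1)) ((l j + b.toNat : ℤ) - u j) *
    (if b = false ∧ b' = true then 1 - t ^ (u j - (u (j + 1) - 1)) else 1)) *
  (x ^ b.toNat * y ^ (l j + b.toNat - u j))

theorem upWeight_shift (t : F) (x y : R) (l u : ℕ → ℕ) :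
    (fun i => upWeight t x y l u (i + 1)) =
      upWeight t x y (fun i => l (i + 1)) (fun i => u (i + 1)) := rfl

theorem downWeight_shift (t : F) (x y : R) (l u : ℕ → ℕ) :
    (fun i => downWeight t x y l u (i + 1)) =
      downWeight t x y (fun i => l (i + 1)) (fun i => u (i + 1)) := rfl

/-- An empty column cannot lose a cell: the lower entry l_0 + 1 exceeds the upper entry l_0 - l_1 of
the binomial. Hence the truncated u_{j+1} - 1 in `downWeight` never matters when u_{j+1} = 0. -/
theorem transfer_downWeight_eq_zero (t : F) (x y : R) (l u : ℕ → ℕ) (hu : u 0 = 0) (B : ℕ) :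
    transfer B (downWeight t x y l u) true = 0 := by
  have h : ∀ b', downWeight t x y l u 0 true b' = 0 := by
    intro b'
    rw [downWeight, qBinom_eq_zero (by simp only [Bool.toNat_true]; omega)]
    simp
  cases B with
  | zero => exact h _
  | succ B => simp [transfer, h]

/-- The equality of totals does not propagate from column to column, but a refinement by the first
letter does. With e = l_0 + 1 - u_0, the pair of upward sums is the image of the pair of downward
sums under the matrix with rows (1, 1 - t^e) and (xy, t^e + xy). Both columns of this matrix add up
to 1 + xy. Prepending a column to the words preserves the relation by the contiguity and Pascal
identities for t-binomials. -/
theorem transfer_relation {t : F} (ht : ∀ m : ℕ, 0 < m → t ^ m ≠ 1) (x y : R) (B : ℕ)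
    (l u : ℕ → ℕ) (hl : Antitone l) (hul : ∀ j, u j ≤ l j + 1)
    (hlB : ∀ j, B ≤ j → l j = 0) (huB : ∀ j, B ≤ j → u j = 0) :
    transfer B (upWeight t x y l u) false =
      transfer B (downWeight t x y l u) false +
        (1 - algebraMap F R t ^ (l 0 + 1 - u 0)) * transfer B (downWeight t x y l u) true ∧
    transfer B (upWeight t x y l u) true =
      x * y * transfer B (downWeight t x y l u) false +
        (algebraMap F R t ^ (l 0 + 1 - u 0) + x * y) *
          transfer B (downWeight t x y l u) true := by
  induction B generalizing l u with
  | zero =>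
    have h1 := hlB 0 le_rfl
    have h2 := hlB 1 (Nat.zero_le _)
    have h3 := huB 0 le_rfl
    have e1 := qBinom_zero_right ht (le_refl 0)
    have e2 := qBinom_self ht (zero_le_one' ℤ)
    have e3 : qBinom t 0 1 = 0 := qBinom_eq_zero (by omega)
    constructor <;> simp [transfer, upWeight, downWeight, h1, h2, h3, e1, e2, e3]
  | succ B ih =>
    obtain ⟨r1, r2⟩ := ih (fun i => l (i + 1)) (fun i => u (i + 1))
      (fun i j h => hl (Nat.succ_le_succ h)) (fun j => hul (j + 1))
      (fun j h => hlB _ (Nat.succ_le_succ h)) (fun j h => huB _ (Nat.succ_le_succ h))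
    have hz : u 1 = 0 → transfer B (downWeight t x y (fun i => l (i + 1)) (fun i => u (i + 1)))
        true = 0 := fun h => transfer_downWeight_eq_zero t x y _ _ h B
    simp only [transfer, Fintype.sum_bool, upWeight_shift, downWeight_shift]
    revert r1 r2 hz
    generalize transfer B (upWeight t x y (fun i => l (i + 1)) (fun i => u (i + 1))) true = ft
    generalize transfer B (upWeight t x y (fun i => l (i + 1)) (fun i => u (i + 1))) false = ff
    generalize transfer B (downWeight t x y (fun i => l (i + 1)) (fun i => u (i + 1))) true = gt
    generalize transfer B (downWeight t x y (fun i => l (i + 1)) (fun i => u (i + 1))) false = gf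
    intro r1 r2 hz
    simp only [upWeight, downWeight, Bool.toNat_true, Bool.toNat_false, zero_add,
      Bool.true_eq_false, Bool.false_eq_true, false_and, and_false, and_self, if_true, if_false,
      Nat.cast_zero, Nat.cast_one, add_zero, mul_one, pow_zero, one_mul, pow_one] at *
    have h10 := hl (Nat.zero_le 1)
    have h0 := hul 0
    have h1 := hul 1
    obtain ⟨m, hm⟩ := Nat.exists_eq_add_of_le h10
    obtain ⟨k, hk⟩ := Nat.exists_eq_add_of_le h0
    obtain ⟨k', hk'⟩ := Nat.exists_eq_add_of_le h1
    rw [show l 1 + 1 - u 1 = k' by omega] at r1 r2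
    rw [show l 0 + 1 - u 0 = k by omega, show l 0 - l 1 = m by omega,
      show ((l 0 : ℤ) + 1 - (l 1 + 1)) = m by omega, show ((l 0 : ℤ) + 1 - u 0) = k by omega,
      show ((l 0 : ℤ) + 1 - l 1) = m + 1 by omega, show ((l 0 : ℤ) - l 1) = m by omega,
      show ((l 0 : ℤ) - (l 1 + 1)) = m - 1 by omega, show ((l 0 : ℤ) - u 0) = k - 1 by omega]
    -- Here k = l_0 + 1 - u_0. For k = 0 the first column of μ exceeds that of λ by one, and the
    -- binomials with lower entry -1 drop out.
    cases k with
    | zero =>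
      rw [qBinom_eq_zero (t := t) (b := ((0 : ℕ) : ℤ) - 1) (by omega),
        qBinom_eq_zero (t := t) (b := ((0 : ℕ) : ℤ) - 1) (by omega), Nat.cast_zero,
        qBinom_zero_right ht (by omega), qBinom_zero_right ht (by omega)]
      simp only [map_one, map_zero, zero_mul, pow_zero, r1, r2]
      constructor <;> ring
    | succ c =>
      have i1 := congrArg (algebraMap F R) (one_sub_mul_qBinom_pred ht m c)
      have i2 := congrArg (algebraMap F R) (one_sub_mul_qBinom_succ ht m c)
      have i3 := congrArg (algebraMap F R) (qBinom_succ_succ ht m c)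
      have i4 := congrArg (algebraMap F R) (qBinom_succ_succ' ht m c)
      -- The exponents agree when u_1 > 0 and c ≤ m. In the other cases either the transfer sum `gt`
      -- or the binomial is zero, so truncation is harmless.
      have hE : algebraMap F R t ^ (u 0 - (u 1 - 1)) * algebraMap F R (qBinom t m c) * gt =
          algebraMap F R t ^ (m - c) * algebraMap F R t ^ k' *
            algebraMap F R (qBinom t m c) * gt := by
        by_cases h : u 1 = 0
        · rw [hz h, mul_zero, mul_zero]
        · by_cases hcm : m < c
          · rw [qBinom_eq_zero (by omega)]; simp
          · rw [← pow_add, show u 0 - (u 1 - 1) = m - c + k' by omega]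
      rw [show (((c + 1 : ℕ) : ℤ) - 1) = c by omega, show l 0 - u 0 = c by omega, Nat.cast_add,
        Nat.cast_one]
      simp only [map_mul, map_sub, map_add, map_pow, map_one] at *
      subst r1 r2
      revert i1 i2 i3 i4 hE
      generalize algebraMap F R (qBinom t m c) = b0
      generalize algebraMap F R (qBinom t m (c + 1)) = b1
      generalize algebraMap F R (qBinom t (m + 1) (c + 1)) = b2
      generalize algebraMap F R (qBinom t (m - 1) c) = b3
      generalize algebraMap F R t = s
      intro hE i1 i2 i3 i4
      constructor
      · linear_combination y ^ c * (x * y * gf + (s ^ k' + x * y) * gt) * i1 -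
          x * y ^ (c + 1) * (gt + gf) * i2 + y ^ c * hE
      · linear_combination x * y ^ (c + 1) * ((gf + gt) * i4 - s ^ k' * gt * i3 + hE)

theorem transfer_total {t : F} (ht : ∀ m : ℕ, 0 < m → t ^ m ≠ 1) (x y : R) (B : ℕ)
    (l u : ℕ → ℕ) (hl : Antitone l) (hul : ∀ j, u j ≤ l j + 1)
    (hlB : ∀ j, B ≤ j → l j = 0) (huB : ∀ j, B ≤ j → u j = 0) :
    transfer B (upWeight t x y l u) false + transfer B (upWeight t x y l u) true =
      (1 + x * y) * (transfer B (downWeight t x y l u) false +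
        transfer B (downWeight t x y l u) true) := by
  obtain ⟨h1, h2⟩ := transfer_relation ht x y B l u hl hul hlB huB
  linear_combination h1 + h2

end Transfer

/-! ### Weights of strips -/

/-- `ψ'_{κ/μ}(t)`, in terms of the rows of `κ` and `μ`. -/
def stripPsi' {F : Type*} [Field F] (t : F) (kap mu : YoungDiagram) : F :=
  ∏ i ∈ Finset.range (kap.colLen 0),
    qBinom t ((kap.rowLen i : ℤ) - kap.rowLen (i + 1)) ((kap.rowLen i : ℤ) - mu.rowLen i)

/-- `ψ_{κ/μ}(t)`, in terms of the columns of `κ` and `μ`. -/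
def stripPsi {R : Type*} [CommRing R] (t : R) (kap mu : YoungDiagram) : R :=
  ∏ j ∈ (Finset.range (kap.rowLen 0)).filter (fun j =>
      kap.colLen j = mu.colLen j ∧ kap.colLen (j + 1) = mu.colLen (j + 1) + 1),
    (1 - t ^ (mu.colLen j - mu.colLen (j + 1)))

theorem stripPsi'_eq {F : Type*} [Field F] (t : F) {kap mu : YoungDiagram} (h : mu ≤ kap)
    {C : ℕ} (hC : kap.colLen 0 ≤ C) :
    stripPsi' t kap mu = ∏ i ∈ Finset.range C,
      qBinom t ((kap.rowLen i : ℤ) - kap.rowLen (i + 1))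
        ((kap.rowLen i : ℤ) - mu.rowLen i) := by
  refine Finset.prod_subset (Finset.range_mono hC) fun i _ hi => ?_
  have h1 := rowLen_eq_zero_iff.2 (not_lt.1 fun h => hi (Finset.mem_range.2 h))
  have h2 := kap.rowLen_anti i (i + 1) (Nat.le_succ i)
  have h3 := le_iff_rowLen.1 h i
  rw [show ((kap.rowLen i : ℤ) - kap.rowLen (i + 1)) = 0 by omega,
    show ((kap.rowLen i : ℤ) - mu.rowLen i) = 0 by omega]
  simp [qBinom]

theorem stripPsi_eq {R : Type*} [CommRing R] (t : R) {kap mu : YoungDiagram}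
    {C : ℕ} (hC : kap.rowLen 0 ≤ C) :
    stripPsi t kap mu = ∏ j ∈ Finset.range C,
      if kap.colLen j = mu.colLen j ∧ kap.colLen (j + 1) = mu.colLen (j + 1) + 1 then
        1 - t ^ (mu.colLen j - mu.colLen (j + 1)) else 1 := by
  rw [stripPsi, Finset.prod_filter]
  refine Finset.prod_subset (Finset.range_mono hC) fun j _ hj => ?_
  have h1 := colLen_eq_zero_iff.2 (not_lt.1 fun h => hj (Finset.mem_range.2 h))
  have h2 := kap.colLen_anti j (j + 1) (Nat.le_succ j)
  rw [if_neg (by omega)]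

theorem Tab.psi'_eq {F : Type*} [Field F] (t : F) {lam : YoungDiagram} {N : ℕ} (T : Tab lam N) :
    T.psi' t = ∏ a ∈ Finset.range N, stripPsi' t (T.sub (a + 1)) (T.sub a) := by
  refine Finset.prod_congr rfl fun a _ => ?_
  rw [stripPsi'_eq t (T.sub_mono (Nat.le_succ a)) (colLen_zero_mono (T.sub_le (a + 1)))]
  simp only [Tab.rowLT_eq]

theorem Tab.psi_eq {R : Type*} [CommRing R] (t : R) {lam : YoungDiagram} {N : ℕ}
    (T : Tab lam N) : T.psi t = ∏ a ∈ Finset.range N, stripPsi t (T.sub (a + 1)) (T.sub a) := by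
  refine Finset.prod_congr rfl fun a _ => ?_
  rw [stripPsi_eq t (rowLen_zero_mono (T.sub_le (a + 1))), Finset.prod_filter]
  simp only [Tab.colLT_eq]

/-! ### The skew dual Cauchy identity in one pair of variables -/

section Kernels

variable {F : Type*} [Field F] {R : Type*} [CommRing R] [Algebra F R]

open Classical in
/-- The skew Hall-Littlewood function `P_{κ/μ}(x)` in a single variable. -/
def horizKernel (t : F) (x : R) (kap mu : YoungDiagram) : R :=
  if HorizStrip kap mu then
    algebraMap F R (stripPsi t kap mu) * x ^ (kap.card - mu.card) else 0

open Classical in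
/-- The skew function `P'_{κ'/μ'}(y)` in a single variable. -/
def vertKernel (t : F) (y : R) (kap mu : YoungDiagram) : R :=
  if HorizStrip kap.transpose mu.transpose then
    algebraMap F R (stripPsi' t kap.transpose mu.transpose) * y ^ (kap.card - mu.card) else 0

theorem horizStrip_transpose_iff {kap mu : YoungDiagram} :
    HorizStrip kap.transpose mu.transpose ↔
      ∀ j, mu.colLen j ≤ kap.colLen j ∧ kap.colLen (j + 1) ≤ mu.colLen j := by
  rw [HorizStrip, le_iff_rowLen, forall_and]
  simp only [YoungDiagram.rowLen_transpose]

theorem card_sub_card {kap mu : YoungDiagram} (h : mu ≤ kap) {B : ℕ} (hB : kap.rowLen 0 ≤ B) :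
    kap.card - mu.card = ∑ j ∈ Finset.range B, (kap.colLen j - mu.colLen j) := by
  rw [card_eq_sum_colLen hB, card_eq_sum_colLen ((rowLen_zero_mono h).trans hB),
    Finset.sum_tsub_distrib _ fun j _ => le_iff_colLen.1 h j]

theorem kernel_mul {t : F} {x y : R} {kap lam mu nu : YoungDiagram} (h1 : HorizStrip kap lam)
    (h2 : HorizStrip mu.transpose nu.transpose) {B : ℕ} (hkap : kap.rowLen 0 ≤ B)
    (hmu : mu.rowLen 0 ≤ B) :
    horizKernel t x kap lam * vertKernel t y mu nu = ∏ j ∈ Finset.range B,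
      algebraMap F R (qBinom t ((mu.colLen j : ℤ) - mu.colLen (j + 1))
          ((mu.colLen j : ℤ) - nu.colLen j) *
        (if kap.colLen j = lam.colLen j ∧ kap.colLen (j + 1) = lam.colLen (j + 1) + 1 then
          1 - t ^ (lam.colLen j - lam.colLen (j + 1)) else 1)) *
      (x ^ (kap.colLen j - lam.colLen j) * y ^ (mu.colLen j - nu.colLen j)) := by
  rw [horizKernel, if_pos h1, vertKernel, if_pos h2, stripPsi_eq t hkap,
    stripPsi'_eq t h2.1 (C := B) (by simpa using hmu), card_sub_card h1.1 hkap,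
    card_sub_card (YoungDiagram.transpose_le_iff.1 h2.1) hmu]
  simp only [YoungDiagram.rowLen_transpose]
  rw [Finset.prod_mul_distrib, Finset.prod_mul_distrib, Finset.prod_pow_eq_pow_sum,
    Finset.prod_pow_eq_pow_sum, ← map_prod, Finset.prod_mul_distrib, map_mul]
  ring

/-- The letter at j tells whether κ/λ has a cell in column j. No restriction on the words is needed,
since a t-binomial vanishes whenever the word fails to give a partition κ with κ/μ a vertical strip.
Words have length B + 1 because κ may have one column more than μ. -/
theorem sum_up_eq (t : F) (x y : R) (lam mu : YoungDiagram) {B : ℕ} (hlam : lam.rowLen 0 ≤ B)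
    (hmu : mu.rowLen 0 ≤ B) (S : Finset YoungDiagram)
    (hS : ∀ kap, HorizStrip kap lam → HorizStrip kap.transpose mu.transpose → kap ∈ S) :
    ∑ kap ∈ S, horizKernel t x kap lam * vertKernel t y kap mu =
      ∑ s : Fin (B + 1) → Bool, ∏ i ∈ Finset.range (B + 1),
        upWeight t x y lam.colLen mu.colLen i (extWord s i) (extWord s (i + 1)) := by
  classical
  rw [← Finset.sum_subset (Finset.filter_subset
    (fun kap => HorizStrip kap lam ∧ HorizStrip kap.transpose mu.transpose) S) (by
      intro kap h1 h2
      rw [Finset.mem_filter] at h2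
      by_cases h3 : HorizStrip kap lam
      · rw [vertKernel, if_neg fun h => h2 ⟨h1, h3, h⟩, mul_zero]
      · rw [horizKernel, if_neg h3, zero_mul])]
  have hlam0 : ∀ j, B ≤ j → lam.colLen j = 0 := fun j h => colLen_eq_zero_iff.2 (hlam.trans h)
  have hmu0 : ∀ j, B ≤ j → mu.colLen j = 0 := fun j h => colLen_eq_zero_iff.2 (hmu.trans h)
  have key : ∀ kap, HorizStrip kap lam → HorizStrip kap.transpose mu.transpose → ∀ j,
      kap.colLen j = lam.colLen j +
        (extWord (fun i : Fin (B + 1) => decide (lam.colLen i < kap.colLen i)) j).toNat := by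
    intro kap h1 h2 j
    have h3 := horizStrip_iff_colLen.1 h1 j
    rw [extWord]
    split_ifs with hj
    · by_cases hlt : lam.colLen j < kap.colLen j
      · simp [hlt]; omega
      · simp [hlt]; omega
    · have h4 := (horizStrip_transpose_iff.1 h2 B).2
      have h5 := kap.colLen_anti (B + 1) j (by omega)
      have h6 := hmu0 B le_rfl
      simp only [Bool.toNat_false]
      omega
  refine Finset.sum_of_injOn
    (fun kap (i : Fin (B + 1)) => decide (lam.colLen i < kap.colLen i)) ?_ ?_ ?_ ?_
  · intro k1 h1 k2 h2 h
    simp only [Finset.coe_filter, Set.mem_ofPred_eq] at h1 h2 h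
    apply colLen_ext
    intro j
    rw [key k1 h1.2.1 h1.2.2, key k2 h2.2.1 h2.2.2, h]
  · intro _ _
    simp
  · intro s _ hs
    by_contra hne
    apply hs
    -- A nonzero binomial means κ_{i+1} ≤ μ_i ≤ κ_i for the tentative column lengths κ_i. This gives
    -- both monotonicity and the strip condition.
    have hq : ∀ i, i < B + 1 → _ := fun i hi => qBinom_ne_zero (t := t)
      (a := (lam.colLen i + (extWord s i).toNat : ℤ) -
        (lam.colLen (i + 1) + (extWord s (i + 1)).toNat))
      (b := (lam.colLen i + (extWord s i).toNat : ℤ) - mu.colLen i) fun h0 => by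
        refine hne (Finset.prod_eq_zero (Finset.mem_range.2 hi) ?_)
        rw [upWeight, h0]; simp
    have hz : ∀ i, B + 1 ≤ i → lam.colLen i + (extWord s i).toNat = 0 := fun i hi => by
      rw [hlam0 i (by omega), extWord_of_le s hi]; rfl
    obtain ⟨kap, hk⟩ := exists_colLen_eq (fun i => lam.colLen i + (extWord s i).toNat)
      (antitone_nat_of_succ_le fun i => by
        by_cases hi : i < B + 1
        · have := hq i hi
          omega
        · rw [hz (i + 1) (by omega)]; omega) (B + 1) (hz _ le_rfl)
    have hb : ∀ b : Bool, b.toNat ≤ 1 := Bool.toNat_le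
    have h1 : HorizStrip kap lam := horizStrip_iff_colLen.2 fun j => by
      rw [hk]
      have := hb (extWord s j)
      omega
    have h2 : HorizStrip kap.transpose mu.transpose := horizStrip_transpose_iff.2 fun j => by
      rw [hk, hk]
      by_cases hj : j < B + 1
      · have := hq j hj
        omega
      · rw [hz j (by omega), hz (j + 1) (by omega), hmu0 j (by omega)]
        omega
    refine ⟨kap, by simpa using ⟨hS kap h1 h2, h1, h2⟩, ?_⟩
    funext i
    have h3 : extWord s i = s i := dif_pos i.2
    simp only [hk, h3]
    cases s i <;> simp
  · intro kap hkap
    obtain ⟨-, h1, h2⟩ := Finset.mem_filter.1 hkap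
    have hB : kap.rowLen 0 ≤ B + 1 := by
      have h4 := (horizStrip_transpose_iff.1 h2 B).2
      rw [hmu0 B le_rfl] at h4
      exact colLen_eq_zero_iff.1 (Nat.le_zero.1 h4)
    rw [kernel_mul h1 h2 hB hB]
    refine Finset.prod_congr rfl fun j _ => ?_
    rw [upWeight]
    have k1 := key kap h1 h2 j
    have k2 := key kap h1 h2 (j + 1)
    rw [k1, k2]
    generalize extWord _ j = b
    generalize extWord _ (j + 1) = b'
    have e1 : ∀ A : F, (if lam.colLen j + b.toNat = lam.colLen j ∧
        lam.colLen (j + 1) + b'.toNat = lam.colLen (j + 1) + 1 then A else 1) =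
        if b = false ∧ b' = true then A else 1 := fun A => by
      cases b <;> cases b' <;> simp
    rw [e1, Nat.add_sub_cancel_left]
    push_cast
    rfl

/-- Companion of `sum_up_eq`: the letter at j now tells whether μ/ρ has a cell in column j, and a
nonzero binomial means λ_{j+1} ≤ ρ_j ≤ λ_j for the column lengths. -/
theorem sum_down_eq (t : F) (x y : R) (lam mu : YoungDiagram) {B : ℕ} (hlam : lam.rowLen 0 ≤ B)
    (hmu : mu.rowLen 0 ≤ B) (S : Finset YoungDiagram)
    (hS : ∀ rho, HorizStrip mu rho → HorizStrip lam.transpose rho.transpose → rho ∈ S) :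
    ∑ rho ∈ S, horizKernel t x mu rho * vertKernel t y lam rho =
      ∑ s : Fin (B + 1) → Bool, ∏ i ∈ Finset.range (B + 1),
        downWeight t x y lam.colLen mu.colLen i (extWord s i) (extWord s (i + 1)) := by
  classical
  rw [← Finset.sum_subset (Finset.filter_subset
    (fun rho => HorizStrip mu rho ∧ HorizStrip lam.transpose rho.transpose) S) (by
      intro rho h1 h2
      rw [Finset.mem_filter] at h2
      by_cases h3 : HorizStrip mu rho
      · rw [vertKernel, if_neg fun h => h2 ⟨h1, h3, h⟩, mul_zero]
      · rw [horizKernel, if_neg h3, zero_mul])]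
  have hlam0 : ∀ j, B ≤ j → lam.colLen j = 0 := fun j h => colLen_eq_zero_iff.2 (hlam.trans h)
  have hmu0 : ∀ j, B ≤ j → mu.colLen j = 0 := fun j h => colLen_eq_zero_iff.2 (hmu.trans h)
  have key : ∀ rho, HorizStrip mu rho → ∀ j,
      mu.colLen j = rho.colLen j +
        (extWord (fun i : Fin (B + 1) => decide (rho.colLen i < mu.colLen i)) j).toNat := by
    intro rho h1 j
    have h3 := horizStrip_iff_colLen.1 h1 j
    rw [extWord]
    split_ifs with hj
    · by_cases hlt : rho.colLen j < mu.colLen j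
      · simp [hlt]; omega
      · simp [hlt]; omega
    · have h6 := hmu0 j (by omega)
      simp only [Bool.toNat_false]
      omega
  refine Finset.sum_of_injOn
    (fun rho (i : Fin (B + 1)) => decide (rho.colLen i < mu.colLen i)) ?_ ?_ ?_ ?_
  · intro k1 h1 k2 h2 h
    simp only [Finset.coe_filter, Set.mem_ofPred_eq] at h1 h2 h
    apply colLen_ext
    intro j
    have e1 := key k1 h1.2.1 j
    have e2 := key k2 h2.2.1 j
    rw [h] at e1
    omega
  · intro _ _
    simp
  · intro s _ hs
    by_contra hne
    apply hs
    have hq : ∀ i, i < B + 1 → _ := fun i hi => qBinom_ne_zero (t := t)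
      (a := (lam.colLen i : ℤ) - lam.colLen (i + 1))
      (b := (lam.colLen i + (extWord s i).toNat : ℤ) - mu.colLen i) fun h0 => by
        refine hne (Finset.prod_eq_zero (Finset.mem_range.2 hi) ?_)
        rw [downWeight, h0]; simp
    have hz : ∀ i, B + 1 ≤ i → mu.colLen i - (extWord s i).toNat = 0 := fun i hi => by
      rw [hmu0 i (by omega)]; omega
    -- The subtraction is not truncated for surviving words: a letter `true` over an empty column of
    -- μ would make the binomial vanish.
    obtain ⟨rho, hr⟩ := exists_colLen_eq (fun i => mu.colLen i - (extWord s i).toNat)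
      (antitone_nat_of_succ_le fun i => by
        by_cases hi : i + 1 < B + 1
        · have := hq i (by omega)
          have := hq (i + 1) hi
          omega
        · rw [hz (i + 1) (by omega)]; omega) (B + 1) (hz _ le_rfl)
    have hb : ∀ b : Bool, b.toNat ≤ 1 := Bool.toNat_le
    have h1 : HorizStrip mu rho := horizStrip_iff_colLen.2 fun j => by
      rw [hr]
      have := hb (extWord s j)
      omega
    have h2 : HorizStrip lam.transpose rho.transpose := horizStrip_transpose_iff.2 fun j => by
      rw [hr]
      by_cases hj : j < B + 1
      · have := hq j hj
        omega
      · rw [hz j (by omega), hlam0 (j + 1) (by omega)]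
        omega
    refine ⟨rho, by simpa using ⟨hS rho h1 h2, h1, h2⟩, ?_⟩
    funext i
    have h3 : extWord s i = s i := dif_pos i.2
    have h4 := hq i i.2
    rw [h3] at h4
    simp only [hr, h3]
    cases hsi : s i
    · simp
    · rw [hsi] at h4
      simp only [Bool.toNat_true, decide_eq_true_eq] at h4 ⊢
      omega
  · intro rho hrho
    obtain ⟨-, h1, h2⟩ := Finset.mem_filter.1 hrho
    rw [kernel_mul h1 h2 (hmu.trans (Nat.le_succ B)) (hlam.trans (Nat.le_succ B))]
    refine Finset.prod_congr rfl fun j _ => ?_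
    rw [downWeight]
    have k1 := key rho h1 j
    have k2 := key rho h1 (j + 1)
    rw [k1, k2]
    generalize extWord _ j = b
    generalize extWord _ (j + 1) = b'
    have e1 : (if rho.colLen j + b.toNat = rho.colLen j ∧
        rho.colLen (j + 1) + b'.toNat = rho.colLen (j + 1) + 1 then
          1 - t ^ (rho.colLen j - rho.colLen (j + 1)) else 1) =
        if b = false ∧ b' = true then
          1 - t ^ (rho.colLen j + b.toNat - (rho.colLen (j + 1) + b'.toNat - 1)) else 1 := by
      cases b <;> cases b' <;> simp
    rw [e1, Nat.add_sub_cancel_left, Nat.add_sub_add_right, Nat.cast_add,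
      add_sub_add_right_eq_sub]

/-- The skew dual Cauchy identity in one pair of variables. -/
theorem skew_dual_cauchy {t : F} (ht : ∀ m : ℕ, 0 < m → t ^ m ≠ 1) (x y : R)
    (lam mu : YoungDiagram) (S S' : Finset YoungDiagram)
    (hS : ∀ kap, HorizStrip kap lam → HorizStrip kap.transpose mu.transpose → kap ∈ S)
    (hS' : ∀ rho, HorizStrip mu rho → HorizStrip lam.transpose rho.transpose → rho ∈ S') :
    ∑ kap ∈ S, horizKernel t x kap lam * vertKernel t y kap mu =
      (1 + x * y) * ∑ rho ∈ S', horizKernel t x mu rho * vertKernel t y lam rho := by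
  have hlam : lam.rowLen 0 ≤ max (lam.rowLen 0) (mu.rowLen 0) := le_max_left _ _
  have hmu : mu.rowLen 0 ≤ max (lam.rowLen 0) (mu.rowLen 0) := le_max_right _ _
  revert hlam hmu
  generalize max (lam.rowLen 0) (mu.rowLen 0) = B
  intro hlam hmu
  -- The existence of any κ or any ρ forces this inequality, so when it fails both sides are empty
  -- sums. It is the hypothesis under which the exponent l_0 + 1 - u_0 of the transfer relation is
  -- meaningful.
  by_cases hc : ∀ j, mu.colLen j ≤ lam.colLen j + 1
  · rw [sum_up_eq t x y lam mu hlam hmu S hS, sum_down_eq t x y lam mu hlam hmu S' hS',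
      sum_words_eq_transfer, sum_words_eq_transfer]
    exact transfer_total ht x y B _ _ (fun i j h => lam.colLen_anti i j h) hc
      (fun j h => colLen_eq_zero_iff.2 (hlam.trans h))
      (fun j h => colLen_eq_zero_iff.2 (hmu.trans h))
  · rw [Finset.sum_eq_zero, Finset.sum_eq_zero, mul_zero]
    · intro rho _
      by_contra hne
      have h1 : HorizStrip mu rho := by
        by_contra h; apply hne; rw [horizKernel, if_neg h, zero_mul]
      have h2 : HorizStrip lam.transpose rho.transpose := by
        by_contra h; apply hne; rw [vertKernel, if_neg h, mul_zero]
      refine hc fun j => ?_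
      have := horizStrip_iff_colLen.1 h1 j
      have := horizStrip_transpose_iff.1 h2 j
      omega
    · intro kap _
      by_contra hne
      have h1 : HorizStrip kap lam := by
        by_contra h; apply hne; rw [horizKernel, if_neg h, zero_mul]
      have h2 : HorizStrip kap.transpose mu.transpose := by
        by_contra h; apply hne; rw [vertKernel, if_neg h, mul_zero]
      refine hc fun j => ?_
      have := horizStrip_iff_colLen.1 h1 j
      have := horizStrip_transpose_iff.1 h2 j
      omega

end Kernels

/-! ### The Pieri formula and the dual Cauchy identity -/

section Cauchy

variable {F : Type*} [Field F] {R : Type*} [CommRing R] [Algebra F R]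

/-- The Hall-Littlewood function `P_λ(x_0, …, x_{N-1}; t)`, evaluated in an `F`-algebra. -/
def hlChain (t : F) (x : ℕ → R) (N : ℕ) (lam : YoungDiagram) : R :=
  chainSum (fun a kap mu => algebraMap F R (stripPsi t kap mu) * x a ^ (kap.card - mu.card)) N lam

/-- The function `P'_λ(y_0, …, y_{M-1}; t)`, evaluated in an `F`-algebra. -/
def macChain (t : F) (y : ℕ → R) (M : ℕ) (lam : YoungDiagram) : R :=
  chainSum (fun a kap mu => algebraMap F R (stripPsi' t kap mu) * y a ^ (kap.card - mu.card)) M lam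

/-- The branching rule. Any finite set containing all the strips is allowed, because the kernel
vanishes elsewhere; a common box can then serve for several sums whose order is to be exchanged. -/
theorem hlChain_succ (t : F) (x : ℕ → R) (N : ℕ) (lam : YoungDiagram) (S : Finset YoungDiagram)
    (hS : ∀ mu, HorizStrip lam mu → mu ∈ S) :
    hlChain t x (N + 1) lam = ∑ mu ∈ S, horizKernel t (x N) lam mu * hlChain t x N mu := by
  rw [hlChain, chainSum, ← Finset.sum_subset (fun mu h => hS mu (mem_horizSub.1 h))]
  · refine Finset.sum_congr rfl fun mu h => ?_
    rw [horizKernel, if_pos (mem_horizSub.1 h), hlChain]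
  · intro mu _ h
    rw [horizKernel, if_neg (fun h' => h (mem_horizSub.2 h')), zero_mul]

theorem macChain_succ (t : F) (y : ℕ → R) (M : ℕ) (lam : YoungDiagram) (S : Finset YoungDiagram)
    (hS : ∀ mu, HorizStrip lam.transpose mu.transpose → mu ∈ S) :
    macChain t y (M + 1) lam.transpose =
      ∑ mu ∈ S, vertKernel t (y M) lam mu * macChain t y M mu.transpose := by
  classical
  rw [macChain, chainSum, ← Finset.sum_subset (Finset.filter_subset
    (fun mu => HorizStrip lam.transpose mu.transpose) S)]
  · refine Finset.sum_nbij' YoungDiagram.transpose YoungDiagram.transpose ?_ ?_ ?_ ?_ ?_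
    · intro mu h
      have h' : HorizStrip lam.transpose mu.transpose.transpose := by simpa using h
      exact Finset.mem_filter.2 ⟨hS _ h', h'⟩
    · intro mu h
      exact mem_horizSub.2 (Finset.mem_filter.1 h).2
    · intro mu _
      simp
    · intro mu _
      simp
    · intro mu h
      have h' : HorizStrip lam.transpose mu.transpose.transpose := by simpa using h
      rw [vertKernel, if_pos h', macChain, YoungDiagram.transpose_transpose, card_transpose,
        card_transpose]
  · intro mu h1 h
    rw [vertKernel, if_neg (fun h' => h (Finset.mem_filter.2 ⟨h1, h'⟩)), zero_mul]

theorem horizKernel_ne_zero {t : F} {x : R} {kap mu : YoungDiagram}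
    (h : horizKernel t x kap mu ≠ 0) : HorizStrip kap mu := by
  by_contra hc
  exact h (if_neg hc)

theorem hlChain_eq_zero (t : F) (x : ℕ → R) {N : ℕ} {lam : YoungDiagram} (h : N < lam.colLen 0) :
    hlChain t x N lam = 0 := chainSum_eq_zero _ h

theorem macChain_eq_zero (t : F) (y : ℕ → R) {M : ℕ} {lam : YoungDiagram}
    (h : M < lam.colLen 0) : macChain t y M lam = 0 := chainSum_eq_zero _ h

theorem horizStrip_refl (mu : YoungDiagram) : HorizStrip mu mu :=
  ⟨le_rfl, fun i => mu.rowLen_anti i (i + 1) (Nat.le_succ i)⟩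

open Classical in
theorem hlChain_zero (t : F) (x : ℕ → R) (lam : YoungDiagram) :
    hlChain t x 0 lam = if lam = ⊥ then 1 else 0 := by
  rw [hlChain, chainSum]

/-- The Pieri formula. -/
theorem sum_vertKernel_mul_hlChain {t : F} (ht : ∀ m : ℕ, 0 < m → t ^ m ≠ 1) (x : ℕ → R) (y : R)
    (N a b : ℕ) (mu : YoungDiagram) (hN : N ≤ a) (ha : mu.colLen 0 ≤ a) (hb : mu.rowLen 0 < b) :
    ∑ kap ∈ box a b, vertKernel t y kap mu * hlChain t x N kap =
      (∏ i ∈ Finset.range N, (1 + x i * y)) * hlChain t x N mu := by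
  induction N generalizing mu with
  | zero =>
    rw [Finset.sum_eq_single ⊥]
    · rw [hlChain_zero, hlChain_zero, if_pos rfl, Finset.prod_range_zero, one_mul, mul_one]
      by_cases h : mu = ⊥
      · subst h
        rw [if_pos rfl, vertKernel, if_pos (horizStrip_refl _), stripPsi']
        simp
      · rw [if_neg h, vertKernel, if_neg]
        intro h'
        exact h (le_bot_iff.1 (YoungDiagram.transpose_le_iff.1 h'.1))
    · intro kap _ h
      rw [hlChain_zero, if_neg h, mul_zero]
    · intro h
      exact absurd (mem_box.2 (by simp)) h
  | succ N ih =>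
    -- Branching off x_N makes the inner sum over κ the left side of the skew identity in the
    -- variables x_N and y.
    have e1 : ∀ kap ∈ box a b, vertKernel t y kap mu * hlChain t x (N + 1) kap =
        ∑ lam ∈ box a b, horizKernel t (x N) kap lam * vertKernel t y kap mu *
          hlChain t x N lam := by
      intro kap hkap
      rw [hlChain_succ t x N kap (box a b), Finset.mul_sum]
      · refine Finset.sum_congr rfl fun lam _ => ?_
        ring
      · intro lam h
        have := mem_box.1 hkap
        exact mem_box.2 ⟨(colLen_zero_mono h.1).trans this.1, (rowLen_zero_mono h.1).trans this.2⟩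
    rw [Finset.sum_congr rfl e1, Finset.sum_comm]
    have e2 : ∀ lam ∈ box a b, ∑ kap ∈ box a b, horizKernel t (x N) kap lam *
        vertKernel t y kap mu * hlChain t x N lam =
        ∑ rho ∈ box a b, (1 + x N * y) * (horizKernel t (x N) mu rho *
          (vertKernel t y lam rho * hlChain t x N lam)) := by
      intro lam hlam
      -- Partitions λ with more than N rows contribute nothing. For the others a horizontal strip
      -- over λ has at most N + 1 ≤ a rows, so the box contains every κ required.
      by_cases hc : N < lam.colLen 0
      · rw [hlChain_eq_zero t x hc]
        simp
      · rw [← Finset.sum_mul, skew_dual_cauchy ht (x N) y lam mu (box a b) (box a b),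
          Finset.mul_sum, Finset.sum_mul]
        · refine Finset.sum_congr rfl fun rho _ => ?_
          ring
        · intro kap h1 h2
          have h3 := (horizStrip_iff_colLen.1 h1 0).2
          have h4 : kap.rowLen 0 ≤ mu.rowLen 0 + 1 := by
            simpa using (horizStrip_iff_colLen.1 h2 0).2
          exact mem_box.2 ⟨by omega, by omega⟩
        · intro rho h1 _
          have h3 := colLen_zero_mono h1.1
          have h4 := rowLen_zero_mono h1.1
          exact mem_box.2 ⟨by omega, by omega⟩
    rw [Finset.sum_congr rfl e2, Finset.sum_comm]
    have e3 : ∀ rho ∈ box a b, ∑ lam ∈ box a b, (1 + x N * y) * (horizKernel t (x N) mu rho *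
          (vertKernel t y lam rho * hlChain t x N lam)) =
        (∏ i ∈ Finset.range (N + 1), (1 + x i * y)) *
          (horizKernel t (x N) mu rho * hlChain t x N rho) := by
      intro rho hrho
      rw [← Finset.mul_sum, ← Finset.mul_sum]
      -- The induction hypothesis needs ρ to satisfy the size bounds of μ, which holds as soon as ρ
      -- is contained in μ.
      by_cases h0 : horizKernel t (x N) mu rho = 0
      · rw [h0]; simp
      · have h1 := (horizKernel_ne_zero h0).1
        rw [ih rho (by omega) ((colLen_zero_mono h1).trans ha)
          ((rowLen_zero_mono h1).trans_lt hb), Finset.prod_range_succ]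
        ring
    rw [Finset.sum_congr rfl e3, ← Finset.mul_sum, ← hlChain_succ]
    intro rho h1
    exact mem_box.2 ⟨(colLen_zero_mono h1.1).trans ha, (rowLen_zero_mono h1.1).trans hb.le⟩

/-- The dual Cauchy identity. -/
theorem sum_hlChain_mul_macChain {t : F} (ht : ∀ m : ℕ, 0 < m → t ^ m ≠ 1) (x y : ℕ → R)
    (N M a b : ℕ) (hN : N ≤ a) (hM : M ≤ b) :
    ∑ lam ∈ box a b, hlChain t x N lam * macChain t y M lam.transpose =
      ∏ j ∈ Finset.range M, ∏ i ∈ Finset.range N, (1 + x i * y j) := by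
  classical
  induction M with
  | zero =>
    rw [Finset.sum_eq_single ⊥, Finset.prod_range_zero, macChain, chainSum, if_pos transpose_bot,
      mul_one]
    · clear hN
      induction N with
      | zero => rw [hlChain_zero, if_pos rfl]
      | succ N ih =>
        rw [hlChain_succ t x N ⊥ {⊥} (fun mu h => by simpa using h.1), Finset.sum_singleton, ih,
          horizKernel, if_pos (horizStrip_refl _), stripPsi]
        simp
    · intro lam _ h
      rw [macChain, chainSum, if_neg, mul_zero]
      intro h'
      exact h (by rw [← YoungDiagram.transpose_transpose lam, h', transpose_bot])
    · intro h
      exact absurd (mem_box.2 (by simp)) h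
  | succ M ih =>
    have e1 : ∀ lam ∈ box a b, hlChain t x N lam * macChain t y (M + 1) lam.transpose =
        ∑ mu ∈ box a b, (vertKernel t (y M) lam mu * hlChain t x N lam) *
          macChain t y M mu.transpose := by
      intro lam hlam
      rw [macChain_succ t y M lam (box a b), Finset.mul_sum]
      · refine Finset.sum_congr rfl fun lam _ => ?_
        ring
      · intro mu h
        have := mem_box.1 hlam
        have h' := YoungDiagram.transpose_le_iff.1 h.1
        exact mem_box.2 ⟨(colLen_zero_mono h').trans this.1, (rowLen_zero_mono h').trans this.2⟩
    rw [Finset.sum_congr rfl e1, Finset.sum_comm]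
    have e2 : ∀ mu ∈ box a b, ∑ lam ∈ box a b, (vertKernel t (y M) lam mu * hlChain t x N lam) *
          macChain t y M mu.transpose =
        (∏ i ∈ Finset.range N, (1 + x i * y M)) *
          (hlChain t x N mu * macChain t y M mu.transpose) := by
      intro mu hmu
      -- A partition μ with more than M columns contributes zero; otherwise μ has fewer than b
      -- columns and the Pieri formula applies in this box.
      by_cases hc : M < mu.rowLen 0
      · rw [macChain_eq_zero t y (by simpa using hc)]
        simp
      · rw [← Finset.sum_mul, sum_vertKernel_mul_hlChain ht x (y M) N a b mu hN (mem_box.1 hmu).1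
          (by omega), mul_assoc]
    rw [Finset.sum_congr rfl e2, ← Finset.mul_sum, ih (by omega), Finset.prod_range_succ, mul_comm]

end Cauchy

/-! ### The functions `P` and `P'` as sums over chains -/

/-- A finite sequence of ring elements, continued by zero. -/
def extVar {R : Type*} [Zero R] {N : ℕ} (x : Fin N → R) (a : ℕ) : R :=
  if h : a < N then x ⟨a, h⟩ else 0

theorem aeval_sum_tab {F R : Type*} [CommRing F] [CommRing R] [Algebra F R] {N : ℕ}
    (x : Fin N → R) (w : YoungDiagram → YoungDiagram → F) (lam : YoungDiagram) :
    MvPolynomial.aeval x (∑ T : Tab lam N, MvPolynomial.monomial T.expo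
        (∏ a ∈ Finset.range N, w (T.sub (a + 1)) (T.sub a))) =
      chainSum (fun a kap mu => algebraMap F R (w kap mu) * extVar x a ^ (kap.card - mu.card))
        N lam := by
  rw [← sum_tab_eq_chainSum, map_sum]
  refine Finset.sum_congr rfl fun T _ => ?_
  rw [MvPolynomial.aeval_monomial, Finset.prod_mul_distrib, map_prod]
  congr 1
  rw [Finsupp.prod_fintype _ _ (fun _ => pow_zero _), Finset.prod_range]
  refine Finset.prod_congr rfl fun a _ => ?_
  rw [extVar, dif_pos a.2, Tab.expo, Finsupp.equivFunOnFinite_symm_apply_apply, Tab.wt_eq]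

theorem aeval_hallLittlewoodP {F R : Type*} [Field F] [CommRing R] [Algebra F R] {N : ℕ}
    (t : F) (x : Fin N → R) (lam : YoungDiagram) :
    MvPolynomial.aeval x (hallLittlewoodP t N lam) = hlChain t (extVar x) N lam := by
  rw [hlChain, ← aeval_sum_tab, hallLittlewoodP]
  simp only [Tab.psi_eq]

theorem aeval_macP' {F R : Type*} [Field F] [CommRing R] [Algebra F R] {M : ℕ}
    (t : F) (y : Fin M → R) (lam : YoungDiagram) :
    MvPolynomial.aeval y (macP' t M lam) = macChain t (extVar y) M lam := by
  rw [macChain, ← aeval_sum_tab, macP']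
  simp only [Tab.psi'_eq]

/-- The product `∏_{i,j} (1 + x_i y_j)`. -/
def dualKernel (F : Type*) [Field F] (N M : ℕ) :
    MvPolynomial (Fin N) (MvPolynomial (Fin M) F) :=
  ∏ j : Fin M, ∏ i : Fin N, (1 + MvPolynomial.X i * MvPolynomial.C (MvPolynomial.X j))

/-! ### Coefficients of the dual Cauchy identity -/

theorem coeff_aeval_X {F A : Type*} [Field F] [CommRing A] [Algebra F A] {N : ℕ}
    (p : MvPolynomial (Fin N) F) (r : Fin N →₀ ℕ) :
    MvPolynomial.coeff r (MvPolynomial.aeval (R := F)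
      (MvPolynomial.X : Fin N → MvPolynomial (Fin N) A) p) =
      algebraMap F A (MvPolynomial.coeff r p) := by
  have h : MvPolynomial.aeval (R := F) (MvPolynomial.X : Fin N → MvPolynomial (Fin N) A) p =
      MvPolynomial.map (algebraMap F A) p := by
    induction p using MvPolynomial.induction_on with
    | C a => rw [MvPolynomial.aeval_C, MvPolynomial.map_C]; rfl
    | add p q hp hq => rw [map_add, map_add, hp, hq]
    | mul_X p i hp => rw [map_mul, map_mul, hp, MvPolynomial.aeval_X, MvPolynomial.map_X]
  rw [h, MvPolynomial.coeff_map]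

theorem aeval_C_X {F : Type*} [Field F] {N M : ℕ} (p : MvPolynomial (Fin M) F) :
    MvPolynomial.aeval (R := F) (fun j => MvPolynomial.C (MvPolynomial.X j) :
      Fin M → MvPolynomial (Fin N) (MvPolynomial (Fin M) F)) p = MvPolynomial.C p := by
  have h := MvPolynomial.aeval_algebraMap_apply (R := F)
    (MvPolynomial (Fin N) (MvPolynomial (Fin M) F))
    (MvPolynomial.X : Fin M → MvPolynomial (Fin M) F) p
  rw [MvPolynomial.aeval_X_left_apply] at h
  exact h

/-- The dual Cauchy identity is evaluated in F[y][x], and the coefficients of a monomial in x and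
then of one in y are read off. -/
theorem sum_coeff_mul_coeff {F : Type*} [Field F] {t : F} (ht : ∀ m : ℕ, 0 < m → t ^ m ≠ 1)
    {N M a b : ℕ} (hN : N ≤ a) (hM : M ≤ b) (r : Fin N →₀ ℕ) (s : Fin M →₀ ℕ) :
    ∑ lam ∈ box a b, MvPolynomial.coeff r (hallLittlewoodP t N lam) *
        MvPolynomial.coeff s (macP' t M lam.transpose) =
      MvPolynomial.coeff s (MvPolynomial.coeff r (dualKernel F N M)) := by
  have h := sum_hlChain_mul_macChain ht
    (extVar (MvPolynomial.X : Fin N → MvPolynomial (Fin N) (MvPolynomial (Fin M) F)))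
    (extVar (fun j => MvPolynomial.C (MvPolynomial.X j))) N M a b hN hM
  have h' : ∏ j ∈ Finset.range M, ∏ i ∈ Finset.range N,
      (1 + extVar (MvPolynomial.X : Fin N → MvPolynomial (Fin N) (MvPolynomial (Fin M) F)) i *
        extVar (fun j => MvPolynomial.C (MvPolynomial.X j)) j) = dualKernel F N M := by
    rw [dualKernel, Finset.prod_range]
    refine Finset.prod_congr rfl fun j _ => ?_
    rw [Finset.prod_range]
    refine Finset.prod_congr rfl fun i _ => ?_
    rw [extVar, extVar, dif_pos i.2, dif_pos j.2]
  rw [← h', ← h, MvPolynomial.coeff_sum, MvPolynomial.coeff_sum]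
  refine Finset.sum_congr rfl fun lam _ => ?_
  rw [← aeval_hallLittlewoodP, ← aeval_macP', aeval_C_X, mul_comm _ (MvPolynomial.C _),
    MvPolynomial.coeff_C_mul, coeff_aeval_X, MvPolynomial.algebraMap_eq,
    mul_comm _ (MvPolynomial.C _), MvPolynomial.coeff_C_mul, mul_comm]

theorem Tab.sum_wt {lam : YoungDiagram} {N : ℕ} (T : Tab lam N) : ∑ a, T.wt a = lam.card := by
  have h : ∀ b, b ≤ N → ∑ a ∈ Finset.range b, ((T.sub (a + 1)).card - (T.sub a).card) =
      (T.sub b).card := by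
    intro b
    induction b with
    | zero =>
      intro _
      simp [Tab.sub, YoungDiagram.card]
    | succ b ih =>
      intro hb
      rw [Finset.sum_range_succ, ih (by omega)]
      have : (T.sub b).card ≤ (T.sub (b + 1)).card := card_mono (T.sub_mono (Nat.le_succ b))
      omega
  have h1 := h N le_rfl
  rw [T.sub_top, Finset.sum_range] at h1
  rw [← h1]
  exact Finset.sum_congr rfl fun a _ => T.wt_eq a

theorem Tab.sum_of_wt_eq {lam : YoungDiagram} {N : ℕ} (T : Tab lam N) {th : Fin N → ℤ}
    (h : ∀ a, (T.wt a : ℤ) = th a) : ∑ a, th a = lam.card := by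
  rw [← T.sum_wt]
  push_cast
  exact (Finset.sum_congr rfl fun a _ => h a).symm

theorem coeff_sum_tab {R : Type*} [CommRing R] {lam : YoungDiagram} {N : ℕ}
    (f : Tab lam N → R) (s : Fin N →₀ ℕ) :
    MvPolynomial.coeff s (∑ T : Tab lam N, MvPolynomial.monomial T.expo (f T)) =
      ∑ T : Tab lam N, if T.expo = s then f T else 0 := by
  rw [MvPolynomial.coeff_sum]
  exact Finset.sum_congr rfl fun T _ => MvPolynomial.coeff_monomial _ _ _

theorem Tab.expo_eq_iff {lam : YoungDiagram} {N : ℕ} (T : Tab lam N) (s : Fin N →₀ ℕ) :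
    T.expo = s ↔ ∀ a, (T.wt a : ℤ) = (s a : ℤ) := by
  rw [Tab.expo, Finsupp.ext_iff]
  simp

theorem psi'Sum_eq_coeff {F : Type*} [Field F] (t : F) (lam : YoungDiagram) {N : ℕ}
    (s : Fin N →₀ ℕ) :
    psi'Sum t lam (fun a => (s a : ℤ)) = MvPolynomial.coeff s (macP' t N lam) := by
  classical
  rw [macP', coeff_sum_tab, psi'Sum, Finset.sum_filter]
  refine Finset.sum_congr rfl fun T _ => ?_
  simp only [Tab.expo_eq_iff]

theorem psi'Sum_eq_zero {F : Type*} [Field F] (t : F) (lam : YoungDiagram) {N : ℕ}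
    (th : Fin N → ℤ) (h : (∃ a, th a < 0) ∨ ∑ a, th a ≠ lam.card) : psi'Sum t lam th = 0 := by
  classical
  rw [psi'Sum, Finset.filter_false_of_mem, Finset.sum_empty]
  intro T _ hT
  rcases h with ⟨a, ha⟩ | h
  · have := hT a
    omega
  · exact h (T.sum_of_wt_eq hT)

/-! ### Specialization at t = 0 -/

theorem zero_pow_ne_one (F : Type*) [Field F] : ∀ m : ℕ, 0 < m → (0 : F) ^ m ≠ 1 := by
  intro m hm
  rw [zero_pow hm.ne']
  exact zero_ne_one

theorem qPoch_zero_left (F : Type*) [Field F] (m : ℕ) : qPoch (0 : F) m = 1 :=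
  Finset.prod_eq_one fun s _ => by simp

theorem Tab.psi'_zero (F : Type*) [Field F] {lam : YoungDiagram} {N : ℕ} (T : Tab lam N) :
    T.psi' (0 : F) = 1 := by
  rw [Tab.psi'_eq]
  refine Finset.prod_eq_one fun a _ => Finset.prod_eq_one fun i _ => ?_
  have h := T.horizStrip_sub a
  have h1 := h.2 i
  have h2 := le_iff_rowLen.1 h.1 i
  rw [qBinom, if_pos (by omega)]
  simp [qPoch_zero_left]

theorem Tab.psi_zero (F : Type*) [Field F] {lam : YoungDiagram} {N : ℕ} (T : Tab lam N) :
    T.psi (0 : F) = 1 := by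
  rw [Tab.psi_eq]
  refine Finset.prod_eq_one fun a _ => Finset.prod_eq_one fun j hj => ?_
  have h1 := (Finset.mem_filter.1 hj).2
  have h2 := (T.sub (a + 1)).colLen_anti j (j + 1) (Nat.le_succ j)
  -- The exponent is positive: column j is unchanged and column j + 1 has grown, so column j was
  -- strictly longer before.
  rw [zero_pow (by omega), sub_zero]

theorem psi'Sum_zero (F : Type*) [Field F] (lam : YoungDiagram) {N : ℕ} (th : Fin N → ℤ) :
    psi'Sum (0 : F) lam th = kostka lam th := by
  classical
  simp only [psi'Sum, kostka, Tab.psi'_zero]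
  simp

theorem hallLittlewoodP_zero (F : Type*) [Field F] (N : ℕ) (lam : YoungDiagram) :
    hallLittlewoodP (0 : F) N lam = schur F N lam := by
  simp only [hallLittlewoodP, schur, Tab.psi_zero]

/-! ### Expansion of `P'` in Kostka-Foulkes polynomials -/

section KostkaFoulkes

variable {F : Type*} [Field F]

/-- The matrix `M(P, m)` at a value `t` of the parameter. -/
def hlMatrix (t : F) (m : ℕ) : Matrix (Part m) (Part m) F :=
  fun lam mu => MvPolynomial.coeff (partExpo m mu) (hallLittlewoodP t m lam)

theorem map_hallLittlewoodToMonomial (t : F) (m : ℕ) :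
    (hallLittlewoodToMonomial m).map (Polynomial.aeval t) = hlMatrix t m := by
  ext lam mu
  rw [Matrix.map_apply, hallLittlewoodToMonomial, hlMatrix, hallLittlewoodP, hallLittlewoodP,
    coeff_sum_tab, coeff_sum_tab, map_sum]
  refine Finset.sum_congr rfl fun T _ => ?_
  rw [apply_ite (Polynomial.aeval t), map_zero]
  congr 1
  simp [Tab.psi, map_prod]

theorem map_schurToMonomial (t : F) (m : ℕ) :
    (schurToMonomial m).map (Polynomial.aeval t) = hlMatrix (0 : F) m := by
  ext lam mu
  rw [Matrix.map_apply, schurToMonomial, hlMatrix, hallLittlewoodP_zero, schur, schur,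
    coeff_sum_tab, coeff_sum_tab, map_sum]
  refine Finset.sum_congr rfl fun T _ => ?_
  rw [apply_ite (Polynomial.aeval t), map_zero, map_one]

open Classical in
theorem det_hlMatrix (t : F) (m : ℕ) : (hlMatrix t m).det = 1 := by
  have h := (RingHom.map_det (Polynomial.aeval t : Polynomial ℤ →ₐ[ℤ] F).toRingHom
    (hallLittlewoodToMonomial m)).symm
  rw [det_hallLittlewoodToMonomial, map_one] at h
  rw [← map_hallLittlewoodToMonomial]
  exact h

theorem kostkaFoulkesMatrix_map_mul (t : F) (m : ℕ) :
    (kostkaFoulkesMatrix m).map (Polynomial.aeval t) * hlMatrix t m = hlMatrix (0 : F) m := by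
  rw [← map_schurToMonomial t, ← map_hallLittlewoodToMonomial, ← kostkaFoulkesMatrix_mul,
    Matrix.map_mul]

theorem vecMul_hlMatrix_injective (t : F) (m : ℕ) {v w : Part m → F}
    (h : Matrix.vecMul v (hlMatrix t m) = Matrix.vecMul w (hlMatrix t m)) : v = w := by
  classical
  have hu : IsUnit (hlMatrix t m).det := by rw [det_hlMatrix]; exact isUnit_one
  have h1 := congrArg (fun u => Matrix.vecMul u (hlMatrix t m)⁻¹) h
  simpa [Matrix.vecMul_vecMul, Matrix.mul_nonsing_inv _ hu] using h1

theorem sum_partExpo {m : ℕ} (mu : Part m) : ∑ i, partExpo m mu.1 i = m := by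
  have h := card_eq_sum_rowLen (mu := mu.1) (B := m) ((colLen_zero_le_card mu.1).trans mu.2.le)
  rw [mu.2, Finset.sum_range] at h
  exact h.symm

/-- The point is that the right-hand side does not depend on t. The identity holds for each
admissible t, in particular for t = 0, and so relates P' to Schur functions. -/
theorem vecMul_hlMatrix {t : F} (ht : ∀ m : ℕ, 0 < m → t ^ m ≠ 1) (m : ℕ) {M : ℕ}
    (s : Fin M →₀ ℕ) (mu : Part m) :
    Matrix.vecMul (fun lam : Part m => psi'Sum t lam.1.transpose (fun a => (s a : ℤ)))
        (hlMatrix t m) mu =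
      MvPolynomial.coeff s (MvPolynomial.coeff (partExpo m mu.1) (dualKernel F m M)) := by
  classical
  -- This box contains all partitions of m and has at least M columns. Its other partitions have the
  -- wrong degree to contribute to a monomial of degree m in x.
  rw [← sum_coeff_mul_coeff ht (le_refl m) (le_max_right m M), Matrix.vecMul, dotProduct]
  simp only [psi'Sum_eq_coeff, hlMatrix]
  symm
  rw [← Finset.sum_subset (Finset.filter_subset (fun lam => lam.card = m) _)]
  · refine Finset.sum_bij' (fun lam h => (⟨lam, (Finset.mem_filter.1 h).2⟩ : Part m))
      (fun lam _ => lam.1) ?_ ?_ ?_ ?_ ?_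
    · intro _ _
      exact Finset.mem_univ _
    · intro lam _
      refine Finset.mem_filter.2 ⟨mem_box.2 ⟨?_, ?_⟩, lam.2⟩
      · exact (colLen_zero_le_card lam.1).trans lam.2.le
      · exact ((rowLen_zero_le_card lam.1).trans lam.2.le).trans (le_max_left _ _)
    · intro _ _
      rfl
    · intro _ _
      rfl
    · intro _ _
      exact mul_comm _ _
  · intro lam h1 h2
    rw [hallLittlewoodP, partExpo_coeff, zero_mul]
    intro T hT
    apply h2
    refine Finset.mem_filter.2 ⟨h1, ?_⟩
    have h3 := sum_partExpo mu
    rw [← hT] at h3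
    rw [← T.sum_wt]
    exact h3

/-- After multiplication by M(P, m) at t both sides become the same coefficient of the dual kernel:
the left one directly, the right one because K(t) M(P, m) = M(s, m), which is M(P, m) at t = 0. The
matrix is invertible and can be cancelled. -/
theorem psi'Sum_eq_vecMul {t : F} (ht : ∀ m : ℕ, 0 < m → t ^ m ≠ 1) (m : ℕ) {M : ℕ}
    (s : Fin M →₀ ℕ) :
    (fun lam : Part m => psi'Sum t lam.1.transpose (fun a => (s a : ℤ))) =
      Matrix.vecMul (fun mu : Part m => (kostka mu.1.transpose (fun a => (s a : ℤ)) : F))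
        ((kostkaFoulkesMatrix m).map (Polynomial.aeval t)) := by
  apply vecMul_hlMatrix_injective t m
  rw [Matrix.vecMul_vecMul, kostkaFoulkesMatrix_map_mul]
  funext mu
  rw [vecMul_hlMatrix ht, ← vecMul_hlMatrix (zero_pow_ne_one F)]
  simp only [psi'Sum_zero]

theorem kostka_eq_zero (lam : YoungDiagram) {N : ℕ}
    (th : Fin N → ℤ) (h : (∃ a, th a < 0) ∨ ∑ a, th a ≠ lam.card) : kostka lam th = 0 := by
  have := psi'Sum_eq_zero (0 : ℚ) lam th h
  rw [psi'Sum_zero] at this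
  exact_mod_cast this

/-- The expansion `P'_{λ'} = ∑_μ K_{μλ}(t) s_{μ'}`, coefficientwise. -/
theorem psi'Sum_transpose {t : F} (ht : ∀ m : ℕ, 0 < m → t ^ m ≠ 1) (lam : YoungDiagram) {M : ℕ}
    (th : Fin M → ℤ) :
    psi'Sum t lam.transpose th = ∑ mu : Part lam.card,
      Polynomial.aeval t (kostkaFoulkes mu.1 lam) * (kostka mu.1.transpose th : F) := by
  -- Jacobi-Trudi weights may have negative entries. Such weights, and those of the wrong total,
  -- make both sides zero; all others are genuine exponent vectors.
  by_cases h : (∃ a, th a < 0) ∨ ∑ a, th a ≠ lam.card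
  · rw [psi'Sum_eq_zero t _ th (by rwa [card_transpose])]
    refine (Finset.sum_eq_zero fun mu _ => ?_).symm
    rw [kostka_eq_zero _ th (by rwa [card_transpose, mu.2]), Nat.cast_zero, mul_zero]
  · push Not at h
    obtain ⟨s, hs⟩ : ∃ s : Fin M →₀ ℕ, th = fun a => (s a : ℤ) :=
      ⟨Finsupp.equivFunOnFinite.symm fun a => (th a).toNat, by
        funext a
        simpa using h.1 a⟩
    rw [hs]
    have h1 := congrFun (psi'Sum_eq_vecMul ht lam.card s) ⟨lam, rfl⟩
    rw [Matrix.vecMul, dotProduct] at h1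
    rw [h1]
    refine Finset.sum_congr rfl fun mu _ => ?_
    rw [Matrix.map_apply, kostkaFoulkes, dif_pos mu.2, mul_comm]

theorem rename_coeff_dualKernel {N M : ℕ} (e : Equiv.Perm (Fin M)) (r : Fin N →₀ ℕ) :
    MvPolynomial.rename e (MvPolynomial.coeff r (dualKernel F N M)) =
      MvPolynomial.coeff r (dualKernel F N M) := by
  have h : MvPolynomial.map (MvPolynomial.rename e : MvPolynomial (Fin M) F →ₐ[F] _).toRingHom
      (dualKernel F N M) = dualKernel F N M := by
    simp only [dualKernel, map_prod, map_add, map_mul, map_one, MvPolynomial.map_X,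
      MvPolynomial.map_C]
    refine (Fintype.prod_equiv e _ _ fun j => ?_)
    simp
  conv_rhs => rw [← h, MvPolynomial.coeff_map]
  rfl

/-- `P'_{λ'}` is a symmetric function. -/
theorem psi'Sum_transpose_perm {t : F} (ht : ∀ m : ℕ, 0 < m → t ^ m ≠ 1) (lam : YoungDiagram)
    {M : ℕ} (e : Equiv.Perm (Fin M)) (s : Fin M → ℕ) :
    psi'Sum t lam.transpose (fun a => (s (e a) : ℤ)) =
      psi'Sum t lam.transpose (fun a => (s a : ℤ)) := by
  -- All partitions of the same size are treated at once, since only the whole vector can be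
  -- compared after multiplication by M(P, m). There the claim is the symmetry of ∏ (1 + x_i y_j) in
  -- the variables y.
  have key : (fun lam' : Part lam.card => psi'Sum t lam'.1.transpose (fun a => (s (e a) : ℤ))) =
      fun lam' : Part lam.card => psi'Sum t lam'.1.transpose (fun a => (s a : ℤ)) := by
    apply vecMul_hlMatrix_injective t
    funext mu
    have h1 := vecMul_hlMatrix ht lam.card (Finsupp.equivFunOnFinite.symm s) mu
    have h2 := vecMul_hlMatrix ht lam.card (Finsupp.equivFunOnFinite.symm (s ∘ e)) mu
    simp only [Finsupp.equivFunOnFinite_symm_apply_apply, Function.comp_apply] at h1 h2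
    rw [h1, h2, ← rename_coeff_dualKernel e.symm]
    have h3 : Finsupp.equivFunOnFinite.symm (s ∘ e) =
        Finsupp.mapDomain e.symm (Finsupp.equivFunOnFinite.symm s) := by
      ext a
      rw [← Finsupp.equivMapDomain_eq_mapDomain]
      simp
    rw [h3, MvPolynomial.coeff_rename_mapDomain _ e.symm.injective]
    simp only [rename_coeff_dualKernel]
  exact congrFun key ⟨lam, rfl⟩

end KostkaFoulkes

/-! ### The bialternant formula -/

section Bialternant

variable {R : Type*} [CommRing R]

/-- The alternant `det (x_i ^ {p_j})`. -/
def alternant (x : ℕ → R) (N : ℕ) (p : Fin N → ℕ) : R :=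
  (Matrix.of fun i j : Fin N => x i ^ p j).det

theorem det_sum_columns {N : ℕ} (x : ℕ → R) (y : R) (S : Fin N → Finset ℕ)
    (e : Fin N → ℕ → ℕ) :
    (Matrix.of fun i j : Fin N => ∑ q ∈ S j, x i ^ q * y ^ e j q).det =
      ∑ q ∈ Fintype.piFinset S, y ^ (∑ j, e j (q j)) * alternant x N q := by
  rw [← Matrix.det_transpose]
  have h := (Matrix.detRowAlternating (R := R) (n := Fin N)).toMultilinearMap.map_sum_finset
    (fun j q => fun i : Fin N => x i ^ q * y ^ e j q) S
  have h' : (Matrix.of fun i j : Fin N => ∑ q ∈ S j, x i ^ q * y ^ e j q).transpose =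
      fun j => ∑ q ∈ S j, fun i : Fin N => x i ^ q * y ^ e j q := by
    ext j i
    simp [Finset.sum_apply]
  rw [h']
  refine h.trans (Finset.sum_congr rfl fun q _ => ?_)
  rw [alternant, ← Matrix.det_transpose, ← Finset.prod_pow_eq_pow_sum, ← Matrix.det_mul_column]
  change Matrix.det _ = _
  congr 1
  ext j i
  simp [mul_comm]

/-- Subtract from each column the multiple x_N^{p_{j+1} - p_j} of its predecessor. The last row
becomes (x_N^{p_0}, 0, …, 0), and every other new entry is x_i - x_N times a geometric sum over p_j
≤ q < p_{j+1}. Multilinearity in the columns then yields the alternants of all exponent vectors q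
interlacing p. -/
theorem alternant_succ (x : ℕ → R) (N : ℕ) (p : Fin (N + 1) → ℕ) (hp : Monotone p) :
    alternant x (N + 1) p = (∏ i : Fin N, (x N - x i)) *
      ∑ q ∈ Fintype.piFinset (fun j : Fin N => Finset.Ico (p j.castSucc) (p j.succ)),
        x N ^ (p 0 + ∑ j : Fin N, (p j.succ - 1 - q j)) * alternant x N q := by
  have hle : ∀ j : Fin N, p j.castSucc ≤ p j.succ := fun j => hp (Fin.castSucc_lt_succ).le
  let B : Matrix (Fin (N + 1)) (Fin (N + 1)) R := Matrix.of fun i j =>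
    Fin.cases (x i ^ p 0)
      (fun j => x i ^ p j.succ - x N ^ (p j.succ - p j.castSucc) * x i ^ p j.castSucc) j
  have h1 : alternant x (N + 1) p = B.det := by
    refine Matrix.det_eq_of_forall_col_eq_smul_add_pred
      (fun j : Fin N => x N ^ (p j.succ - p j.castSucc)) ?_ ?_
    · intro i
      simp [B]
    · intro i j
      simp [B]
  rw [h1, Matrix.det_succ_row B (Fin.last N), Fin.sum_univ_succ, Finset.sum_eq_zero]
  · have h2 : B.submatrix (Fin.last N).succAbove (Fin.succAbove 0) =
        Matrix.of fun i j : Fin N => ((-1) * (x N - x i)) * (Matrix.of fun i j : Fin N =>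
          ∑ q ∈ Finset.Ico (p j.castSucc) (p j.succ), x i ^ q * x N ^ (p j.succ - 1 - q)) i j := by
      ext i j
      have h3 := (Commute.all (x i) (x N)).mul_geom_sum₂_Ico (hle j)
      simp only [B, Matrix.submatrix_apply, Matrix.of_apply, Fin.succAbove_last,
        Fin.zero_succAbove, Fin.cases_succ, Fin.val_castSucc]
      linear_combination -h3
    rw [h2, Matrix.det_mul_column, det_sum_columns x (x N) _ (fun j q => p j.succ - 1 - q),
      Finset.prod_mul_distrib, Finset.prod_const, Finset.card_univ, Fintype.card_fin]
    -- One sign comes from the cofactor in the bottom left corner, the other from turning the N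
    -- factors x_i - x_N into x_N - x_i.
    have h4 : ((-1 : R) ^ N) * (-1) ^ N = 1 := by
      rw [← pow_add, ← two_mul, pow_mul]; simp
    have h5 : B (Fin.last N) 0 = x N ^ p 0 := by simp [B]
    rw [h5]
    simp only [Fin.val_last, Fin.val_zero, add_zero, pow_add, mul_assoc, ← Finset.mul_sum]
    linear_combination (x N ^ p 0 * ((∏ i : Fin N, (x N - x i)) *
      ∑ q ∈ Fintype.piFinset (fun j : Fin N => Finset.Ico (p j.castSucc) (p j.succ)),
        x N ^ (∑ j : Fin N, (p j.succ - 1 - q j)) * alternant x N q)) * h4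
  · intro j _
    have h3 : B (Fin.last N) j.succ = 0 := by
      simp only [B, Matrix.of_apply, Fin.cases_succ, Fin.val_last]
      rw [← pow_add, Nat.sub_add_cancel (hle j), sub_self]
    rw [h3]
    simp

/-- The exponents `κ_{N-1-j} + j` of the alternant belonging to the partition `κ`. -/
def altExpo (N : ℕ) (kap : YoungDiagram) (j : Fin N) : ℕ := kap.rowLen (N - 1 - j) + j

theorem altExpo_bot (N : ℕ) (j : Fin N) : altExpo N ⊥ j = j := by simp [altExpo]

theorem altExpo_monotone (N : ℕ) (kap : YoungDiagram) : Monotone (altExpo N kap) := by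
  intro i j h
  have := kap.rowLen_anti (N - 1 - j) (N - 1 - i) (by have : (i : ℕ) ≤ j := h; omega)
  have h' : (i : ℕ) ≤ j := h
  simp only [altExpo]
  omega

/-- The Schur function `s_κ(x_0, …, x_{N-1})`. -/
def schurChain (x : ℕ → R) (N : ℕ) (kap : YoungDiagram) : R :=
  chainSum (fun a kap mu => x a ^ (kap.card - mu.card)) N kap

/-- With i = N - 1 - j, the condition p_j ≤ q_j < p_{j+1} on exponents reads κ_{i+1} ≤ μ_i ≤ κ_i.
Interlacing exponent vectors are thus the partitions μ with at most N rows for which κ/μ is a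
horizontal strip, and the power of x_N counts the cells of the strip. -/
theorem sum_alternant_eq (x : ℕ → R) (N : ℕ) (kap : YoungDiagram) (hk : kap.colLen 0 ≤ N + 1) :
    ∑ mu ∈ (horizSub kap).filter (fun mu => mu.colLen 0 ≤ N),
        x N ^ (kap.card - mu.card) * alternant x N (altExpo N mu) =
      ∑ q ∈ Fintype.piFinset (fun j : Fin N =>
          Finset.Ico (altExpo (N + 1) kap j.castSucc) (altExpo (N + 1) kap j.succ)),
        x N ^ (altExpo (N + 1) kap 0 + ∑ j : Fin N, (altExpo (N + 1) kap j.succ - 1 - q j)) *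
          alternant x N q := by
  have hN : ∀ j : Fin N, N + 1 - 1 - ((j : ℕ) + 1) = N - 1 - j := fun j => by omega
  have hN' : ∀ j : Fin N, N + 1 - 1 - (j : ℕ) = N - 1 - j + 1 := fun j => by omega
  refine Finset.sum_of_injOn (altExpo N) ?_ ?_ ?_ ?_
  · intro m1 h1 m2 h2 h
    simp only [Finset.coe_filter, Set.mem_ofPred_eq] at h1 h2
    refine rowLen_ext fun i => ?_
    by_cases hi : i < N
    · have := congrFun h ⟨N - 1 - i, by omega⟩
      simp only [altExpo] at this
      rw [show N - 1 - (N - 1 - i) = i by omega] at this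
      omega
    · rw [rowLen_eq_zero_iff.2 (h1.2.trans (not_lt.1 hi)),
        rowLen_eq_zero_iff.2 (h2.2.trans (not_lt.1 hi))]
  · intro mu h
    simp only [Finset.coe_filter, Set.mem_ofPred_eq, mem_horizSub] at h
    simp only [Finset.mem_coe, Fintype.mem_piFinset, Finset.mem_Ico]
    intro j
    have e1 := h.1.2 (N - 1 - j)
    have e2 := le_iff_rowLen.1 h.1.1 (N - 1 - j)
    simp only [altExpo, Fin.val_castSucc, Fin.val_succ, hN, hN']
    omega
  · intro q hq hne
    exfalso
    apply hne
    simp only [Fintype.mem_piFinset, Finset.mem_Ico, altExpo, Fin.val_castSucc, Fin.val_succ, hN,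
      hN'] at hq
    have hq' : ∀ i (hi : i < N), kap.rowLen (i + 1) + (N - 1 - i) ≤ q ⟨N - 1 - i, by omega⟩ ∧
        q ⟨N - 1 - i, by omega⟩ < kap.rowLen i + (N - 1 - i + 1) := by
      intro i hi
      have := hq ⟨N - 1 - i, by omega⟩
      rwa [show N - 1 - (N - 1 - i) = i by omega] at this
    have hf : ∀ i, kap.rowLen (i + 1) ≤
        (if h : i < N then q ⟨N - 1 - i, by omega⟩ - (N - 1 - i) else 0) ∧
        (if h : i < N then q ⟨N - 1 - i, by omega⟩ - (N - 1 - i) else 0) ≤ kap.rowLen i := by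
      intro i
      split_ifs with hi
      · have := hq' i hi
        omega
      · rw [rowLen_eq_zero_iff.2 (by omega)]
        omega
    obtain ⟨mu, hmu⟩ := exists_rowLen_eq
      (fun i => if h : i < N then q ⟨N - 1 - i, by omega⟩ - (N - 1 - i) else 0)
      (antitone_nat_of_succ_le fun i => (hf (i + 1)).2.trans (hf i).1) N (by simp)
    refine ⟨mu, ?_, ?_⟩
    · simp only [Finset.coe_filter, Set.mem_ofPred_eq, mem_horizSub, HorizStrip, le_iff_rowLen, hmu]
      refine ⟨⟨fun i => (hf i).2, fun i => (hf i).1⟩, ?_⟩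
      rw [← rowLen_eq_zero_iff, hmu, dif_neg (lt_irrefl N)]
    · funext j
      have h1 := hq j
      simp only [altExpo, hmu]
      rw [dif_pos (by omega)]
      have h2 : (⟨N - 1 - (N - 1 - (j : ℕ)), by omega⟩ : Fin N) = j := by
        ext; simp only; omega
      rw [h2]
      omega
  · intro mu h
    obtain ⟨h1, h2⟩ := Finset.mem_filter.1 h
    rw [mem_horizSub] at h1
    congr 2
    rw [card_eq_sum_rowLen hk, card_eq_sum_rowLen h2, Finset.sum_range_succ]
    have e1 : ∀ j : Fin N, altExpo (N + 1) kap j.succ - 1 - altExpo N mu j =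
        kap.rowLen (N - 1 - j) - mu.rowLen (N - 1 - j) := by
      intro j
      simp only [altExpo, Fin.val_succ, hN]
      omega
    rw [Finset.sum_congr rfl fun j _ => e1 j, ← Finset.sum_range
      (fun j => kap.rowLen (N - 1 - j) - mu.rowLen (N - 1 - j)),
      Finset.sum_range_reflect (fun j => kap.rowLen j - mu.rowLen j),
      Finset.sum_tsub_distrib _ fun j _ => le_iff_rowLen.1 h1.1 j]
    have e2 : ∑ i ∈ Finset.range N, mu.rowLen i ≤ ∑ i ∈ Finset.range N, kap.rowLen i :=
      Finset.sum_le_sum fun i _ => le_iff_rowLen.1 h1.1 i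
    simp only [altExpo, Fin.val_zero]
    rw [show N + 1 - 1 - 0 = N by omega]
    omega

/-- The Vandermonde recursion: only ∅ interlaces ∅, so the sum has a single term. -/
theorem alternant_bot_succ (x : ℕ → R) (N : ℕ) :
    alternant x (N + 1) (altExpo (N + 1) ⊥) =
      (∏ i : Fin N, (x N - x i)) * alternant x N (altExpo N ⊥) := by
  rw [alternant_succ x N _ (altExpo_monotone _ _), ← sum_alternant_eq x N ⊥ (by simp),
    Finset.sum_eq_single ⊥]
  · simp
  · intro mu h hne
    exact absurd (le_bot_iff.1 (mem_horizSub.1 (Finset.mem_filter.1 h).1).1) hne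
  · intro h
    exact absurd (Finset.mem_filter.2 ⟨mem_horizSub.2 (horizStrip_refl _), by simp⟩) h

/-- The bialternant formula for Schur functions. -/
theorem alternant_mul_schurChain (x : ℕ → R) (N : ℕ) (kap : YoungDiagram)
    (hk : kap.colLen 0 ≤ N) :
    alternant x N (altExpo N ⊥) * schurChain x N kap = alternant x N (altExpo N kap) := by
  induction N generalizing kap with
  | zero =>
    rw [eq_bot_of_colLen (Nat.le_zero.1 hk), schurChain, chainSum, if_pos rfl, mul_one]
  | succ N ih =>
    rw [alternant_bot_succ, alternant_succ x N _ (altExpo_monotone _ _),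
      ← sum_alternant_eq x N kap hk, mul_assoc, schurChain, chainSum, Finset.mul_sum]
    congr 1
    rw [← Finset.sum_subset (Finset.filter_subset (fun mu => mu.colLen 0 ≤ N) _)]
    · refine Finset.sum_congr rfl fun mu h => ?_
      rw [← ih mu (Finset.mem_filter.1 h).2, schurChain]
      ring
    · intro mu h1 h2
      rw [chainSum_eq_zero, mul_zero, mul_zero]
      exact not_le.1 fun h => h2 (Finset.mem_filter.2 ⟨h1, h⟩)

/-! ### Coefficient extraction and inversion of the Kostka matrix -/

theorem alternant_X (N : ℕ) (p : Fin N → ℕ) :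
    alternant (extVar (MvPolynomial.X : Fin N → MvPolynomial (Fin N) ℤ)) N p =
      ∑ w : Equiv.Perm (Fin N), MvPolynomial.monomial
        (Finsupp.equivFunOnFinite.symm fun a => p (w a)) ((Equiv.Perm.sign w : ℤˣ) : ℤ) := by
  rw [alternant, Matrix.det_apply]
  refine Fintype.sum_equiv (Equiv.inv _) _ _ fun s => ?_
  rw [MvPolynomial.monomial_eq, Finsupp.prod_fintype _ _ (fun _ => pow_zero _)]
  simp only [Equiv.inv_apply, Equiv.Perm.sign_inv, Finsupp.equivFunOnFinite_symm_apply_apply]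
  rw [Units.smul_def, zsmul_eq_mul]
  congr 1
  refine Fintype.prod_equiv s _ _ fun i => ?_
  simp [extVar]

theorem coeff_schur (N : ℕ) (kap : YoungDiagram) (s : Fin N →₀ ℕ) :
    MvPolynomial.coeff s (schur ℤ N kap) = kostka kap (fun a => (s a : ℤ)) := by
  classical
  rw [schur, coeff_sum_tab, kostka, Finset.card_filter]
  push_cast
  refine Finset.sum_congr rfl fun T _ => ?_
  simp only [Tab.expo_eq_iff]

theorem schurChain_X (N : ℕ) (kap : YoungDiagram) :
    schurChain (extVar (MvPolynomial.X : Fin N → MvPolynomial (Fin N) ℤ)) N kap =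
      schur ℤ N kap := by
  have h := aeval_sum_tab (F := ℤ) (MvPolynomial.X : Fin N → MvPolynomial (Fin N) ℤ)
    (fun _ _ => 1) kap
  simp only [Finset.prod_const_one, map_one, one_mul, MvPolynomial.aeval_X_left_apply] at h
  exact h.symm

theorem coeff_monomial_mul_schur (N : ℕ) (kap : YoungDiagram) (e f : Fin N →₀ ℕ) (c : ℤ) :
    MvPolynomial.coeff e (MvPolynomial.monomial f c * schur ℤ N kap) =
      c * kostka kap (fun a => (e a : ℤ) - f a) := by
  rw [MvPolynomial.coeff_monomial_mul']
  split_ifs with h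
  · rw [coeff_schur]
    congr 3
    funext a
    have := h a
    rw [Finsupp.tsub_apply]
    omega
  · rw [kostka_eq_zero, Nat.cast_zero, mul_zero]
    left
    rw [Finsupp.le_def] at h
    push Not at h
    obtain ⟨a, ha⟩ := h
    exact ⟨a, by omega⟩

open Classical in
/-- The inverse Kostka matrix in Jacobi-Trudi form. -/
theorem sum_sign_mul_kostka (kap nu : YoungDiagram) :
    ∑ w : Equiv.Perm (Fin (nu.colLen 0)), ((Equiv.Perm.sign w : ℤˣ) : ℤ) *
        (kostka kap (shifted nu w) : ℤ) = if kap = nu then 1 else 0 := by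
  by_cases hk : nu.colLen 0 < kap.colLen 0
  · rw [if_neg (by rintro rfl; exact lt_irrefl _ hk)]
    refine Finset.sum_eq_zero fun w _ => ?_
    have : kostka kap (shifted nu w) = 0 := by
      rw [kostka, Finset.card_eq_zero, Finset.filter_eq_empty_iff]
      intro T
      exfalso
      have h1 : (kap.colLen 0 - 1, 0) ∈ kap := YoungDiagram.mem_iff_lt_colLen.2 (by omega)
      have h2 := T.le_entry h1
      have h3 := T.2 _ _ h1
      omega
    rw [this]; simp
  · set N := nu.colLen 0 with hN
    -- Compare the coefficients of x^{ν+δ} in a_δ s_κ = a_{κ+δ}, with δ = (N-1, …, 0).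
    have h := congrArg (MvPolynomial.coeff (Finsupp.equivFunOnFinite.symm
      fun a : Fin N => nu.rowLen a + (N - 1 - a))) (alternant_mul_schurChain
        (extVar (MvPolynomial.X : Fin N → MvPolynomial (Fin N) ℤ)) N kap (not_lt.1 hk))
    rw [schurChain_X, alternant_X, alternant_X, Finset.sum_mul, MvPolynomial.coeff_sum,
      MvPolynomial.coeff_sum] at h
    simp only [coeff_monomial_mul_schur, Finsupp.equivFunOnFinite_symm_apply_apply,
      MvPolynomial.coeff_monomial, EmbeddingLike.apply_eq_iff_eq, altExpo_bot] at h
    -- The exponents in `altExpo` increase while those of ν + δ decrease. Composing with the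
    -- reversal turns ν_a + (N-1-a) minus the exponent from a_δ into ν_a - a + w_a, at the cost of a
    -- common sign that is cancelled at the end.
    replace h := (Equiv.sum_comp (Equiv.mulLeft (Fin.revPerm : Equiv.Perm (Fin N))) _).trans
      (h.trans (Equiv.sum_comp (Equiv.mulLeft (Fin.revPerm : Equiv.Perm (Fin N))) _).symm)
    simp only [Equiv.coe_mulLeft, Equiv.Perm.sign_mul, Units.val_mul, Equiv.Perm.coe_mul,
      Function.comp_apply, Fin.revPerm_apply, Fin.val_rev, altExpo] at h
    have e1 : ∀ w : Equiv.Perm (Fin N), (fun a : Fin N =>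
        ((nu.rowLen a + (N - 1 - a) : ℕ) : ℤ) - ((N - (w a + 1) : ℕ) : ℤ)) = shifted nu w := by
      intro w
      funext a
      have := (w a).2
      have := a.2
      simp only [shifted]
      omega
    simp only [e1] at h
    have e2 : ∀ w : Equiv.Perm (Fin N), ((fun a : Fin N => kap.rowLen (N - 1 - (N - (w a + 1))) +
        (N - (w a + 1))) = fun a : Fin N => nu.rowLen a + (N - 1 - a)) ↔ (w = 1 ∧ kap = nu) := by
      intro w
      have e3 : ∀ a : Fin N, N - 1 - (N - (w a + 1)) = (w a : ℕ) := fun a => by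
        have := (w a).2
        omega
      simp only [e3]
      constructor
      · intro hw
        have hw' := fun a => congrFun hw a
        -- The sequences κ + δ and ν + δ are both strictly decreasing, so a permutation carrying one
        -- to the other cannot reverse any pair.
        have hmono : StrictMono w := by
          intro a b hab
          by_contra hle
          have hle' : (w b : ℕ) ≤ w a := not_lt.1 hle
          have hab' : (a : ℕ) < b := hab
          have k1 := hw' a
          have k2 := hw' b
          have k3 := nu.rowLen_anti a b hab'.le
          have k4 := kap.rowLen_anti (w b) (w a) hle'
          have := (w a).2
          have := b.2
          omega
        have hw1 : w = 1 := by
          apply Equiv.ext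
          intro a
          have := (StrictMono.range_inj hmono strictMono_id).1 (by simp)
          simpa using congrFun this a
        subst hw1
        refine ⟨rfl, rowLen_ext fun i => ?_⟩
        by_cases hi : i < N
        · have := hw' ⟨i, hi⟩
          simp only [Equiv.Perm.coe_one, id] at this
          omega
        · rw [rowLen_eq_zero_iff.2 ((not_lt.1 hk).trans (not_lt.1 hi)),
            rowLen_eq_zero_iff.2 (not_lt.1 hi)]
      · rintro ⟨rfl, rfl⟩
        funext a
        simp only [Equiv.Perm.coe_one, id]
        omega
    simp only [e2] at h
    have hs : ((Equiv.Perm.sign (Fin.revPerm : Equiv.Perm (Fin N)) : ℤˣ) : ℤ) ≠ 0 :=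
      Units.ne_zero _
    apply mul_left_cancel₀ hs
    rw [Finset.mul_sum]
    simp only [← mul_assoc]
    rw [h, Finset.sum_eq_single 1]
    · simp
    · intro w _ hw
      rw [if_neg fun h => hw h.1]
    · simp

end Bialternant

/-! ### The action of the operators `𝐠'_r` -/

section Operators

variable {F : Type*} [Field F] {n : ℕ}

theorem annihilate_single (i : Fin n) (m : Fin n → ℕ) :
    annihilate i (Finsupp.single m (1 : F)) =
      if m i = 0 then 0 else Finsupp.single (Function.update m i (m i - 1)) 1 := by
  rw [annihilate, Finsupp.linearCombination_single, one_smul]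

theorem create_single (t : F) (i : Fin n) (m : Fin n → ℕ) :
    create t i (Finsupp.single m (1 : F)) =
      (1 - t ^ (m i + 1)) • Finsupp.single (Function.update m i (m i + 1)) 1 := by
  rw [create, Finsupp.linearCombination_single, one_smul, Finsupp.smul_single, smul_eq_mul, mul_one]

theorem annihilate_pow_single (i : Fin n) (m : Fin n → ℕ) (c : ℕ) :
    (annihilate i ^ c) (Finsupp.single m (1 : F)) =
      if c ≤ m i then Finsupp.single (Function.update m i (m i - c)) 1 else 0 := by
  induction c with
  | zero => simp
  | succ c ih =>
    rw [pow_succ', Module.End.mul_apply, ih]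
    by_cases h : c ≤ m i
    · rw [if_pos h, annihilate_single, Function.update_self, Function.update_idem, Nat.sub_sub]
      by_cases h' : c + 1 ≤ m i
      · rw [if_neg (by omega), if_pos h']
      · rw [if_pos (by omega), if_neg h']
    · rw [if_neg h, if_neg (by omega), map_zero]

theorem smul_create_pow_single {t : F} (ht : ∀ m : ℕ, 0 < m → t ^ m ≠ 1) (z : F) (i : Fin n)
    (m : Fin n → ℕ) (c : ℕ) :
    ((z • create t i) ^ c) (Finsupp.single m (1 : F)) =
      (z ^ c * (qPoch t (m i + c) / qPoch t (m i))) •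
        Finsupp.single (Function.update m i (m i + c)) 1 := by
  induction c with
  | zero => simp [div_self (qPoch_ne_zero ht _)]
  | succ c ih =>
    rw [pow_succ', Module.End.mul_apply, ih, map_smul, LinearMap.smul_apply, create_single,
      Function.update_self, Function.update_idem, smul_smul, smul_smul, ← Nat.add_assoc, qPoch_succ]
    congr 1
    ring

theorem hop_pow_single {t : F} (ht : ∀ m : ℕ, 0 < m → t ^ m ≠ 1) {i j : Fin n} (hij : i ≠ j)
    (m : Fin n → ℕ) (c : ℕ) :
    ((create t j * annihilate i : Module.End F (Fock F n)) ^ c) (Finsupp.single m (1 : F)) =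
      if c ≤ m i then (qPoch t (m j + c) / qPoch t (m j)) •
        Finsupp.single (Function.update (Function.update m i (m i - c)) j (m j + c)) (1 : F)
        else 0 := by
  induction c with
  | zero => simp [div_self (qPoch_ne_zero ht _)]
  | succ c ih =>
    rw [pow_succ', Module.End.mul_apply, ih]
    by_cases h : c ≤ m i
    · rw [if_pos h, map_smul, Module.End.mul_apply, annihilate_single,
        Function.update_of_ne hij, Function.update_self]
      by_cases h' : c + 1 ≤ m i
      · rw [if_neg (by omega), if_pos h', create_single, Function.update_of_ne hij.symm,
            Function.update_self, smul_smul, ← Nat.add_assoc, qPoch_succ]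
        refine congrArg₂ (· • ·) (by ring) (congrArg (fun s => Finsupp.single s (1 : F)) ?_)
        funext x
        simp only [Function.update_apply]
        split_ifs <;> omega
      · rw [if_pos (by omega), if_neg h', map_zero, smul_zero]
    · rw [if_neg h, if_neg (by omega), map_zero]

/-- The occupation numbers after the hops from the sites `i ≥ j`. -/
def hopState (m c : Fin n → ℕ) (j : ℕ) (i : Fin n) : ℕ :=
  (if (i : ℕ) < j ∧ (i : ℕ) + 1 < n then m i else m i - c i) +
    if j < (i : ℕ) then extVar c (i - 1) else 0

theorem extVar_coe {R : Type*} [Zero R] (x : Fin n → R) (i : Fin n) : extVar x i = x i := by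
  simp [extVar]

/-- The rightmost hops act first, so a site sends its particles on before it receives any. Hence c_i
is bounded by the original m_i, and the creation factors start from m_i - c_i. The induction runs
from the last site down to j. -/
theorem hops_single [NeZero n] {t : F} (ht : ∀ m : ℕ, 0 < m → t ^ m ≠ 1) (m c : Fin n → ℕ)
    (s j : ℕ) (hj : j + s + 1 = n) :
    (((List.finRange n).drop j).map (fun i : Fin n =>
      if (i : ℕ) + 1 < n then (create t (i + 1) * annihilate i : Module.End F (Fock F n)) ^ c i
        else 1)).prod (Finsupp.single (hopState m c (n - 1)) (1 : F)) =
      if ∀ i : Fin n, j ≤ i → (i : ℕ) + 1 < n → c i ≤ m i then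
        (∏ i ∈ Finset.Ico (j + 1) n, (qPoch t (extVar m i - extVar c i + extVar c (i - 1)) /
          qPoch t (extVar m i - extVar c i))) • Finsupp.single (hopState m c j) (1 : F) else 0 := by
  have hd : (List.finRange n).drop j = ⟨j, by omega⟩ :: (List.finRange n).drop (j + 1) := by
    rw [List.drop_eq_getElem_cons (by simp; omega)]
    simp
  induction s generalizing j with
  | zero =>
    rw [hd, List.drop_eq_nil_of_le (by simp; omega), if_pos (fun i h1 h2 => by omega)]
    simp [show ¬ j + 1 < n by omega, show n - 1 = j by omega, show n ≤ j + 1 by omega]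
  | succ s ih =>
    have hjn : j + 1 < n := by omega
    rw [hd, List.map_cons, List.prod_cons, Module.End.mul_apply, ih (j + 1) (by omega) (by
      rw [List.drop_eq_getElem_cons (by simp; omega)]
      simp)]
    have hv : ((⟨j, by omega⟩ + 1 : Fin n) : ℕ) = j + 1 := by
      rw [Fin.val_add_one_of_lt']
      exact hjn
    have hj1 : (⟨j, by omega⟩ + 1 : Fin n) = ⟨j + 1, hjn⟩ := Fin.ext hv
    by_cases h1 : ∀ i : Fin n, j + 1 ≤ i → (i : ℕ) + 1 < n → c i ≤ m i
    · rw [if_pos h1, map_smul, if_pos hjn, hop_pow_single ht (by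
        intro h
        have := congrArg Fin.val h
        rw [hv] at this
        simp only at this
        omega)]
      have e0 : hopState m c (j + 1) ⟨j, by omega⟩ = m ⟨j, by omega⟩ := by
        simp [hopState, hjn]
      rw [e0]
      by_cases h2 : c ⟨j, by omega⟩ ≤ m ⟨j, by omega⟩
      · rw [if_pos h2, if_pos (fun i hi hin => by
          rcases Nat.eq_or_lt_of_le hi with h | h
          · have : i = ⟨j, by omega⟩ := Fin.ext h.symm
            rw [this]; exact h2
          · exact h1 i h hin), smul_smul]
        have e1 : hopState m c (j + 1) (⟨j, by omega⟩ + 1) =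
            m ⟨j + 1, hjn⟩ - c ⟨j + 1, hjn⟩ := by
          rw [hj1]
          simp [hopState]
        rw [e1, Finset.prod_eq_prod_Ico_succ_bot hjn, mul_comm]
        congr 2
        · simp [extVar, hjn, show j < n by omega]
        · funext i
          rw [hj1]
          by_cases hi1 : i = ⟨j + 1, hjn⟩
          · subst hi1
            simp [hopState, extVar, show j < n by omega]
          · rw [Function.update_of_ne hi1]
            have hi1' : (i : ℕ) ≠ j + 1 := fun h => hi1 (Fin.ext h)
            by_cases hi0 : i = ⟨j, by omega⟩
            · subst hi0
              simp [hopState]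
            · rw [Function.update_of_ne hi0]
              have hi0' : (i : ℕ) ≠ j := fun h => hi0 (Fin.ext h)
              simp only [hopState]
              congr 1
              · congr 1
                simp only [eq_iff_iff]
                omega
              · congr 1
                simp only [eq_iff_iff]
                omega
      · rw [if_neg h2, if_neg (fun h => h2 (h _ le_rfl hjn)), smul_zero]
    · rw [if_neg h1, map_zero, if_neg fun h => h1 fun i hi => h i (by omega)]

/-- The number of particles hopping to site `i`. -/
def hopsTo (c : Fin n → ℕ) (i : ℕ) : ℕ := if i = 0 then extVar c (n - 1) else extVar c (i - 1)

theorem word_single [NeZero n] {t : F} (ht : ∀ m : ℕ, 0 < m → t ^ m ≠ 1) (z : F)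
    (m c : Fin n → ℕ) :
    word t z n c (Finsupp.single m (1 : F)) =
      if ∀ i, c i ≤ m i then
        (z ^ extVar c (n - 1) * ∏ i ∈ Finset.range n,
          (qPoch t (extVar m i - extVar c i + hopsTo c i) / qPoch t (extVar m i - extVar c i))) •
        Finsupp.single (fun i => m i - c i + hopsTo c i) 1 else 0 := by
  have hn : 0 < n := Nat.pos_of_ne_zero (NeZero.ne n)
  have hl : Fin.ofNat n (n - 1) = ⟨n - 1, by omega⟩ := by
    ext
    simp only [Fin.val_ofNat]
    exact Nat.mod_eq_of_lt (by omega)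
  have hE : extVar c (n - 1) = c ⟨n - 1, by omega⟩ := dif_pos _
  rw [word, Module.End.mul_apply, Module.End.mul_apply, annihilate_pow_single, hl]
  by_cases h0 : c ⟨n - 1, by omega⟩ ≤ m ⟨n - 1, by omega⟩
  · rw [if_pos h0]
    have e1 : Function.update m ⟨n - 1, by omega⟩
        (m ⟨n - 1, by omega⟩ - c ⟨n - 1, by omega⟩) = hopState m c (n - 1) := by
      funext i
      by_cases hi : i = ⟨n - 1, by omega⟩
      · subst hi
        simp [hopState]
      · rw [Function.update_of_ne hi]
        have hi' : (i : ℕ) ≠ n - 1 := fun h => hi (Fin.ext h)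
        have := i.2
        simp only [hopState]
        rw [if_pos (by omega), if_neg (by omega), add_zero]
    have e2 := hops_single ht m c (n - 1) 0 (by omega)
    rw [List.drop_zero] at e2
    rw [e1, e2]
    by_cases h1 : ∀ i : Fin n, 0 ≤ (i : ℕ) → (i : ℕ) + 1 < n → c i ≤ m i
    · rw [if_pos h1, map_smul, smul_create_pow_single ht, smul_smul, if_pos (fun i => by
        by_cases hi : (i : ℕ) + 1 < n
        · exact h1 i (Nat.zero_le _) hi
        · have : i = ⟨n - 1, by omega⟩ := by ext; simp only; omega
          rw [this]; exact h0)]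
      have e3 : hopState m c 0 0 = m 0 - c 0 := by simp [hopState]
      rw [e3]
      have e4 : extVar m 0 = m 0 := dif_pos hn
      have e5 : extVar c 0 = c 0 := dif_pos hn
      refine congrArg₂ (· • ·) ?_ (congrArg (fun s => Finsupp.single s (1 : F)) ?_)
      · rw [Finset.range_eq_Ico, Finset.prod_eq_prod_Ico_succ_bot hn, e4, e5, hopsTo, if_pos rfl,
          hE]
        rw [Finset.prod_congr (s₁ := Finset.Ico (0 + 1) n) rfl (g := fun i =>
          qPoch t (extVar m i - extVar c i + hopsTo c i) / qPoch t (extVar m i - extVar c i))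
          (fun i hi => by rw [hopsTo, if_neg (by have := (Finset.mem_Ico.1 hi).1; omega)])]
        ring
      · funext i
        by_cases hi : i = 0
        · subst hi
          rw [Function.update_self]
          simp [hopsTo, hE]
        · rw [Function.update_of_ne hi]
          have hi' : (i : ℕ) ≠ 0 := fun h => hi (Fin.ext (by simpa using h))
          simp [hopState, hopsTo, hi', Nat.pos_of_ne_zero hi']
    · rw [if_neg h1, map_zero, if_neg fun h => h1 fun i _ _ => h i]
  · rw [if_neg h0, map_zero, map_zero, if_neg fun h => h0 (h _)]

/-- Every composition c of r into n parts is a rearrangement of exactly one partition, and its zero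
entries are harmless because (t)_0 = 1. -/
theorem gPrime_eq_sum [NeZero n] (t z : F) (r : ℕ) :
    gPrime t z n r = ∑ c ∈ Finset.piAntidiag (Finset.univ : Finset (Fin n)) r,
      (∏ i, qPoch t (c i))⁻¹ • word t z n c := by
  rw [gPrime]
  simp only [ncMonomial, Finset.sum_filter, Finset.smul_sum]
  rw [Finset.sum_comm]
  refine Finset.sum_congr rfl fun c hc => ?_
  have hsum : (Finset.univ.val.map c).sum = r := (Finset.mem_piAntidiag.1 hc).1
  rw [Finset.sum_eq_single (Nat.Partition.ofSums r (Finset.univ.val.map c) hsum)]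
  · rw [if_pos (by rfl)]
    congr 2
    have h : ∀ s : Multiset ℕ, ((s.filter (fun x => x ≠ 0)).map (qPoch t)).prod =
        (s.map (qPoch t)).prod := by
      intro s
      induction s using Multiset.induction_on with
      | empty => rfl
      | cons a s ih =>
        rw [Multiset.filter_cons, Multiset.map_add, Multiset.prod_add, ih, Multiset.map_cons,
          Multiset.prod_cons]
        by_cases ha : a = 0 <;> simp [ha]
    have h' := h (Finset.univ.val.map c)
    rw [Multiset.map_map] at h'
    exact h'
  · intro p _ hp
    rw [if_neg, smul_zero]
    intro h
    exact hp (Nat.Partition.ext h.symm)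
  · simp

theorem prod_hopsTo [NeZero n] (c : Fin n → ℕ) (f : ℕ → F) :
    ∏ i, f (c i) = ∏ i ∈ Finset.range n, f (hopsTo c i) := by
  cases n with
  | zero => exact absurd rfl (NeZero.ne 0)
  | succ n =>
    have h1 : ∏ i, f (c i) = ∏ i ∈ Finset.range (n + 1), f (extVar c i) := by
      rw [Finset.prod_range]
      simp only [extVar_coe]
    rw [h1, Finset.prod_range_succ, Finset.prod_range_succ']
    simp [hopsTo]

theorem gPrime_single [NeZero n] {t : F} (ht : ∀ m : ℕ, 0 < m → t ^ m ≠ 1) (z : F) (r : ℕ)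
    (m : Fin n → ℕ) :
    gPrime t z n r (Finsupp.single m (1 : F)) =
      ∑ c ∈ (Finset.piAntidiag (Finset.univ : Finset (Fin n)) r).filter (fun c => ∀ i, c i ≤ m i),
        (z ^ extVar c (n - 1) * ∏ i ∈ Finset.range n,
          qBinom t ((extVar m i - extVar c i + hopsTo c i : ℕ) : ℤ) (hopsTo c i)) •
        Finsupp.single (fun i => m i - c i + hopsTo c i) 1 := by
  rw [gPrime_eq_sum, LinearMap.sum_apply, Finset.sum_filter]
  refine Finset.sum_congr rfl fun c _ => ?_
  rw [LinearMap.smul_apply, word_single ht]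
  split_ifs with h
  -- The factors 1/(t)_{c_i} are shifted cyclically, from the site that is left to the site that is
  -- entered. There they complete the quotient of factorials to a t-binomial.
  · rw [smul_smul, prod_hopsTo c (qPoch t), ← Finset.prod_inv_distrib, mul_left_comm,
      ← Finset.prod_mul_distrib]
    congr 2
    refine Finset.prod_congr rfl fun i _ => ?_
    have h1 := qBinom_add t (hopsTo c i) (extVar m i - extVar c i)
    rw [add_comm (hopsTo c i)] at h1
    rw [h1]
    have p1 := qPoch_ne_zero ht (hopsTo c i)
    have p2 := qPoch_ne_zero ht (extVar m i - extVar c i)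
    field_simp
  · rw [smul_zero]

end Operators

/-! ### Products of the operators `𝐠'_r` acting on `|n^k⟩` -/

section Chains

variable {F : Type*} [Field F] {n : ℕ}

/-- The occupation numbers with `κ_i` particles to the right of site `i`, not counting the last
site, and `k` particles in total. -/
def occState (n k : ℕ) (kap : YoungDiagram) (i : Fin n) : ℕ :=
  if (i : ℕ) + 1 < n then kap.rowLen i - kap.rowLen (i + 1) else k - kap.rowLen 0

/-- The rows are recovered from the bottom up, as successive sums of occupation numbers, starting
from κ_{n-1} = 0. This is where fewer than n rows are needed. -/
theorem occState_injective {k : ℕ} {kap mu : YoungDiagram} (h1 : kap.colLen 0 < n)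
    (h2 : mu.colLen 0 < n) (h : occState n k kap = occState n k mu) : kap = mu := by
  have hz : ∀ i, n ≤ i + 1 → kap.rowLen i = mu.rowLen i := fun i hi => by
    rw [rowLen_eq_zero_iff.2 (by omega), rowLen_eq_zero_iff.2 (by omega)]
  have key : ∀ s i, n ≤ i + 1 + s → kap.rowLen i = mu.rowLen i := by
    intro s
    induction s with
    | zero => exact hz
    | succ s ih =>
      intro i hi
      by_cases hin : i + 1 < n
      · have e := congrFun h ⟨i, by omega⟩
        simp only [occState, if_pos hin] at e
        have e1 := ih (i + 1) (by omega)
        have e2 := kap.rowLen_anti i (i + 1) (Nat.le_succ i)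
        have e3 := mu.rowLen_anti i (i + 1) (Nat.le_succ i)
        omega
      · exact hz i (by omega)
  exact rowLen_ext fun i => key n i (by omega)

/-- The numbers of hopping particles that enlarge `μ` to `κ`. -/
def stripHops (n : ℕ) (kap mu : YoungDiagram) (i : Fin n) : ℕ :=
  if (i : ℕ) + 1 < n then kap.rowLen (i + 1) - mu.rowLen (i + 1) else kap.rowLen 0 - mu.rowLen 0

theorem hopsTo_stripHops {kap mu : YoungDiagram} (hn : 0 < n) {i : ℕ}
    (hi : i < n) : hopsTo (stripHops n kap mu) i = kap.rowLen i - mu.rowLen i := by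
  rw [hopsTo]
  split_ifs with h
  · subst h
    rw [extVar, dif_pos (by omega), stripHops, if_neg (by simp only; omega)]
  · rw [extVar, dif_pos (by omega), stripHops, if_pos (by simp only; omega)]
    simp only
    rw [show i - 1 + 1 = i by omega]

theorem sum_hopsTo [NeZero n] (c : Fin n → ℕ) :
    ∑ i, c i = ∑ i ∈ Finset.range n, hopsTo c i := by
  cases n with
  | zero => exact absurd rfl (NeZero.ne 0)
  | succ n =>
    have h1 : ∑ i, c i = ∑ i ∈ Finset.range (n + 1), extVar c i := by
      rw [Finset.sum_range]
      simp only [extVar_coe]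
    rw [h1, Finset.sum_range_succ, Finset.sum_range_succ']
    simp [hopsTo]

theorem hopsTo_injective [NeZero n] {c c' : Fin n → ℕ} (h : ∀ i < n, hopsTo c i = hopsTo c' i) :
    c = c' := by
  have hn : 0 < n := Nat.pos_of_ne_zero (NeZero.ne n)
  funext i
  by_cases hi : (i : ℕ) + 1 < n
  · have := h (i + 1) hi
    simpa [hopsTo, extVar_coe] using this
  · have h0 := h 0 hn
    simp only [hopsTo, if_true] at h0
    have e : n - 1 = (i : ℕ) := by omega
    rw [e] at h0
    simpa [extVar_coe] using h0

-- With `hopsTo c i` = κ_i - μ_i, the condition that a site has enough particles becomes κ_{i+1} ≤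
-- μ_i, and at the last site κ_0 ≤ k. So admissible hops are horizontal strips, and hops through the
-- boundary, each weighted by z, are cells in the first row. The bound a < n keeps the new partition
-- below n rows.
open Classical in
theorem gPrime_occState [NeZero n] {t : F} (ht : ∀ m : ℕ, 0 < m → t ^ m ≠ 1) (z : F) (r k a : ℕ)
    (mu : YoungDiagram) (ha : mu.colLen 0 < a) (han : a < n) (hk : mu.rowLen 0 ≤ k) :
    gPrime t z n r (Finsupp.single (occState n k mu) (1 : F)) =
      ∑ kap ∈ (box a k).filter (fun kap => HorizStrip kap mu ∧ kap.card = mu.card + r),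
        (z ^ (kap.rowLen 0 - mu.rowLen 0) * stripPsi' t kap mu) •
          Finsupp.single (occState n k kap) 1 := by
  have hn : 0 < n := by omega
  have hmz : ∀ i, a ≤ i + 1 → mu.rowLen i = 0 := fun i hi => rowLen_eq_zero_iff.2 (by omega)
  rw [gPrime_single ht]
  symm
  refine Finset.sum_of_injOn (fun kap => stripHops n kap mu) ?_ ?_ ?_ ?_
  · intro k1 h1 k2 h2 h
    simp only [Finset.coe_filter, Set.mem_ofPred_eq, mem_box] at h1 h2
    refine rowLen_ext fun i => ?_
    by_cases hi : i < n
    · have e := congrArg (fun c => hopsTo c i) h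
      simp only [hopsTo_stripHops hn hi] at e
      have := le_iff_rowLen.1 h1.2.1.1 i
      have := le_iff_rowLen.1 h2.2.1.1 i
      omega
    · rw [rowLen_eq_zero_iff.2 (by omega), rowLen_eq_zero_iff.2 (by omega)]
  · intro kap h
    simp only [Finset.coe_filter, Set.mem_ofPred_eq, mem_box] at h
    obtain ⟨⟨h1, h2⟩, h3, h4⟩ := h
    simp only [Finset.coe_filter, Set.mem_ofPred_eq, Finset.mem_piAntidiag]
    refine ⟨⟨?_, by simp⟩, ?_⟩
    · rw [sum_hopsTo, Finset.sum_congr rfl fun i hi =>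
        hopsTo_stripHops hn (Finset.mem_range.1 hi),
        Finset.sum_tsub_distrib _ fun i _ => le_iff_rowLen.1 h3.1 i,
        ← card_eq_sum_rowLen (by omega), ← card_eq_sum_rowLen (by omega)]
      omega
    · intro i
      simp only [stripHops, occState]
      split_ifs with hi
      · have := h3.2 i
        omega
      · omega
  · intro c hc hne
    exfalso
    apply hne
    simp only [Finset.mem_filter, Finset.mem_piAntidiag] at hc
    obtain ⟨⟨hsum, -⟩, hcm⟩ := hc
    have hh : ∀ i, i + 1 < n → hopsTo c (i + 1) + mu.rowLen (i + 1) ≤ mu.rowLen i := by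
      intro i hi
      have e := hcm ⟨i, by omega⟩
      simp only [occState, if_pos hi] at e
      have e2 := mu.rowLen_anti i (i + 1) (Nat.le_succ i)
      rw [hopsTo, if_neg (Nat.succ_ne_zero i), Nat.add_sub_cancel, extVar, dif_pos (by omega)]
      omega
    have hh0 : hopsTo c 0 + mu.rowLen 0 ≤ k := by
      have e := hcm ⟨n - 1, by omega⟩
      rw [occState, if_neg (by simp only; omega)] at e
      rw [hopsTo, if_pos rfl, extVar, dif_pos (by omega)]
      omega
    have hza : ∀ i, a ≤ i → i < n → hopsTo c i = 0 := by
      intro i hi hin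
      have := hh (i - 1) (by omega)
      rw [show i - 1 + 1 = i by omega, hmz (i - 1) (by omega)] at this
      omega
    obtain ⟨kap, hkap⟩ := exists_rowLen_eq
      (fun i => mu.rowLen i + if i < n then hopsTo c i else 0)
      (antitone_nat_of_succ_le fun i => by
        by_cases hi : i + 1 < n
        · have := hh i hi
          rw [if_pos hi]
          omega
        · have := mu.rowLen_anti i (i + 1) (Nat.le_succ i)
          rw [if_neg hi]
          omega) a (by rw [hmz a (by omega), if_pos han, hza a le_rfl han])
    have h3 : HorizStrip kap mu := by
      refine ⟨le_iff_rowLen.2 fun i => ?_, fun i => ?_⟩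
      · rw [hkap]
        omega
      · rw [hkap]
        by_cases hi : i + 1 < n
        · have := hh i hi
          rw [if_pos hi]
          omega
        · have := mu.rowLen_anti i (i + 1) (Nat.le_succ i)
          rw [if_neg hi]
          omega
    have h1 : kap.colLen 0 ≤ a := by
      rw [← rowLen_eq_zero_iff, hkap, hmz a (by omega), if_pos han, hza a le_rfl han]
    have h2 : kap.rowLen 0 ≤ k := by
      rw [hkap, if_pos hn]
      omega
    have hstrip : stripHops n kap mu = c := by
      apply hopsTo_injective
      intro i hi
      rw [hopsTo_stripHops hn hi, hkap, if_pos hi]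
      omega
    refine ⟨kap, ?_, hstrip⟩
    simp only [Finset.coe_filter, Set.mem_ofPred_eq, mem_box]
    refine ⟨⟨h1, h2⟩, h3, ?_⟩
    rw [card_eq_sum_rowLen (B := n) (mu := kap) (by omega),
      card_eq_sum_rowLen (B := n) (mu := mu) (by omega), ← hsum, sum_hopsTo,
      ← Finset.sum_add_distrib]
    refine Finset.sum_congr rfl fun i hi => ?_
    rw [hkap, if_pos (Finset.mem_range.1 hi)]
  · intro kap h
    simp only [Finset.mem_filter, mem_box] at h
    obtain ⟨⟨h1, h2⟩, h3, h4⟩ := h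
    have hrow := le_iff_rowLen.1 h3.1
    have hst : ∀ i : Fin n, occState n k mu i - stripHops n kap mu i +
        (kap.rowLen i - mu.rowLen i) = occState n k kap i := by
      intro i
      have e1 := hrow i
      have e2 := hrow (i + 1)
      have e3 := h3.2 i
      have e4 := kap.rowLen_anti i (i + 1) (Nat.le_succ i)
      simp only [occState, stripHops]
      split_ifs with hi
      · omega
      · have e5 := hrow 0
        have e6 : kap.rowLen i = 0 := rowLen_eq_zero_iff.2 (by omega)
        omega
    have hlast : extVar (stripHops n kap mu) (n - 1) = kap.rowLen 0 - mu.rowLen 0 := by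
      rw [← hopsTo_stripHops hn hn, hopsTo, if_pos rfl]
    refine congrArg₂ (· • ·) ?_ (congrArg (fun s => Finsupp.single s (1 : F)) ?_)
    · rw [hlast, stripPsi'_eq t h3.1 (C := n) (by omega)]
      congr 1
      refine Finset.prod_congr rfl fun i hi => ?_
      have hi' := Finset.mem_range.1 hi
      rw [hopsTo_stripHops hn hi']
      have e := hst ⟨i, hi'⟩
      simp only at e
      have e0 : extVar (occState n k mu) i = occState n k mu ⟨i, hi'⟩ := dif_pos hi'
      have e0' : extVar (stripHops n kap mu) i = stripHops n kap mu ⟨i, hi'⟩ := dif_pos hi'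
      rw [e0, e0', e, Nat.cast_sub (hrow i), occState]
      have e4 := kap.rowLen_anti i (i + 1) (Nat.le_succ i)
      -- At the last site the upper entries differ, being k - κ_0 for the operator and 0 for the
      -- strip. No particle arrives there, so both binomials are 1.
      by_cases hin : i + 1 < n
      · rw [if_pos hin, Nat.cast_sub e4]
      · have e6 : kap.rowLen i = 0 := rowLen_eq_zero_iff.2 (by omega)
        have e7 := hrow i
        have e8 : mu.rowLen i = 0 := by omega
        have e9 : kap.rowLen (i + 1) = 0 := by omega
        rw [if_neg hin, e6, e8, e9]
        rw [Nat.cast_zero, sub_zero, qBinom_zero_right ht le_rfl,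
          qBinom_zero_right ht (by omega)]
    · funext i
      rw [hopsTo_stripHops hn i.2, hst]

open Classical in
/-- The weights of the chains with prescribed numbers of added cells. -/
def weightedPsi' (t : F) (th : ℕ → ℤ) (a : ℕ) (kap mu : YoungDiagram) : F :=
  if (kap.card : ℤ) = mu.card + th a then stripPsi' t kap mu else 0

open Classical in
theorem gPrimeInt_occState [NeZero n] {t : F} (ht : ∀ m : ℕ, 0 < m → t ^ m ≠ 1) (z : F)
    (th : ℕ → ℤ) (k N : ℕ) (mu : YoungDiagram) (ha : mu.colLen 0 ≤ N) (han : N + 1 < n)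
    (hk : mu.rowLen 0 ≤ k) :
    gPrimeInt t z n (th N) (Finsupp.single (occState n k mu) (1 : F)) =
      ∑ kap ∈ box (N + 1) k, (if HorizStrip kap mu then
        z ^ (kap.rowLen 0 - mu.rowLen 0) * weightedPsi' t th N kap mu else 0) •
          Finsupp.single (occState n k kap) 1 := by
  rw [gPrimeInt]
  split_ifs with h
  · rw [gPrime_occState ht z _ k (N + 1) mu (by omega) han hk, Finset.sum_filter]
    refine Finset.sum_congr rfl fun kap _ => ?_
    by_cases h1 : HorizStrip kap mu
    · rw [if_pos h1, weightedPsi']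
      by_cases h2 : kap.card = mu.card + (th N).toNat
      · rw [if_pos ⟨h1, h2⟩, if_pos (by rw [h2]; push_cast; omega)]
      · rw [if_neg fun h' => h2 h'.2, if_neg (by omega), mul_zero, zero_smul]
    · rw [if_neg fun h' => h1 h'.1, if_neg h1, zero_smul]
  · rw [LinearMap.zero_apply]
    refine (Finset.sum_eq_zero fun kap _ => ?_).symm
    by_cases h1 : HorizStrip kap mu
    · have := card_mono h1.1
      rw [if_pos h1, weightedPsi', if_neg (by omega), mul_zero, zero_smul]
    · rw [if_neg h1, zero_smul]

/-- The product `𝐠'_{θ_{N-1}} ⋯ 𝐠'_{θ_0}`. -/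
def gPrimeChain (t z : F) (n : ℕ) [NeZero n] (th : ℕ → ℤ) : ℕ → Module.End F (Fock F n)
  | 0 => 1
  | N + 1 => gPrimeInt t z n (th N) * gPrimeChain t z n th N

theorem gPrimeChain_eq_prod [NeZero n] (t z : F) (th : ℕ → ℤ) (N : ℕ) :
    gPrimeChain t z n th N =
      (List.ofFn (fun i : Fin N => gPrimeInt t z n (th i))).reverse.prod := by
  induction N with
  | zero => simp [gPrimeChain]
  | succ N ih =>
    rw [gPrimeChain, ih, List.ofFn_succ']
    simp

/-- Each operator adds at most one row, so N < n operators never leave the range in which states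
correspond to partitions. The powers of z telescope to the length of the first row. -/
theorem gPrimeChain_apply [NeZero n] {t : F} (ht : ∀ m : ℕ, 0 < m → t ^ m ≠ 1) (z : F)
    (th : ℕ → ℤ) (k N : ℕ) (hN : N < n) :
    gPrimeChain t z n th N (Finsupp.single (occState n k ⊥) (1 : F)) =
      ∑ kap ∈ box N k, (z ^ kap.rowLen 0 * chainSum (weightedPsi' t th) N kap) •
        Finsupp.single (occState n k kap) 1 := by
  classical
  induction N with
  | zero =>
    rw [gPrimeChain, Finset.sum_eq_single ⊥]
    · rw [chainSum, if_pos rfl]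
      simp
    · intro kap hkap hne
      exact absurd (eq_bot_of_colLen (Nat.le_zero.1 (mem_box.1 hkap).1)) hne
    · intro h
      exact absurd (mem_box.2 (by simp)) h
  | succ N ih =>
    rw [gPrimeChain, Module.End.mul_apply, ih (by omega), map_sum]
    have e1 : ∀ mu ∈ box N k, gPrimeInt t z n (th N)
        ((z ^ mu.rowLen 0 * chainSum (weightedPsi' t th) N mu) •
          Finsupp.single (occState n k mu) (1 : F)) =
        ∑ kap ∈ box (N + 1) k, (if HorizStrip kap mu then z ^ kap.rowLen 0 *
          (weightedPsi' t th N kap mu * chainSum (weightedPsi' t th) N mu) else 0) •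
          Finsupp.single (occState n k kap) 1 := by
      intro mu hmu
      rw [map_smul, gPrimeInt_occState ht z th k N mu (mem_box.1 hmu).1 hN (mem_box.1 hmu).2,
        Finset.smul_sum]
      refine Finset.sum_congr rfl fun kap _ => ?_
      rw [smul_smul]
      congr 1
      split_ifs with h
      · have e := rowLen_zero_mono h.1
        rw [show kap.rowLen 0 = mu.rowLen 0 + (kap.rowLen 0 - mu.rowLen 0) by omega, pow_add,
          show mu.rowLen 0 + (kap.rowLen 0 - mu.rowLen 0) - mu.rowLen 0 =
            kap.rowLen 0 - mu.rowLen 0 by omega]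
        ring
      · rw [mul_zero]
    rw [Finset.sum_congr rfl e1, Finset.sum_comm]
    refine Finset.sum_congr rfl fun kap hkap => ?_
    rw [← Finset.sum_smul, chainSum, Finset.mul_sum]
    congr 1
    rw [← Finset.sum_filter]
    refine Finset.sum_subset ?_ ?_
    · intro mu h
      exact mem_horizSub.2 (Finset.mem_filter.1 h).2
    · intro mu h1 h2
      have h1' := mem_horizSub.1 h1
      -- A strip of κ missing from the box of N rows starts at a partition with more than N rows,
      -- which no chain of length N reaches.
      rw [chainSum_eq_zero, mul_zero, mul_zero]
      by_contra hle
      exact h2 (Finset.mem_filter.2 ⟨mem_box.2 ⟨not_lt.1 hle,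
        (rowLen_zero_mono h1'.1).trans (mem_box.1 hkap).2⟩, h1'⟩)

theorem psi'Sum_eq_chainSum (t : F) (lam : YoungDiagram) {N : ℕ} (th : Fin N → ℤ) :
    psi'Sum t lam th = chainSum (weightedPsi' t (extVar th)) N lam := by
  classical
  rw [← sum_tab_eq_chainSum, psi'Sum, Finset.sum_filter]
  refine Finset.sum_congr rfl fun T _ => ?_
  have h : ∀ a : Fin N, (T.wt a : ℤ) = th a ↔
      ((T.sub (a + 1)).card : ℤ) = (T.sub a).card + extVar th a := by
    intro a
    rw [T.card_sub_succ, extVar_coe]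
    push_cast
    constructor <;> intro h <;> linarith
  simp only [weightedPsi']
  split_ifs with h1
  · rw [Tab.psi'_eq]
    refine Finset.prod_congr rfl fun a ha => ?_
    rw [if_pos ((h ⟨a, Finset.mem_range.1 ha⟩).1 (h1 _))]
  · push Not at h1
    obtain ⟨a, ha⟩ := h1
    exact (Finset.prod_eq_zero (Finset.mem_range.2 a.2) (if_neg fun h' => ha ((h a).2 h'))).symm

theorem gPrimeChain_coeff [NeZero n] {t : F} (ht : ∀ m : ℕ, 0 < m → t ^ m ≠ 1) (z : F)
    {k N : ℕ} (th : Fin N → ℤ) (hN : N < n) (kap : YoungDiagram) (h1 : kap.colLen 0 < n)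
    (h2 : kap.rowLen 0 ≤ k) :
    gPrimeChain t z n (extVar th) N (Finsupp.single (occState n k ⊥) (1 : F))
      (occState n k kap) = z ^ kap.rowLen 0 * psi'Sum t kap th := by
  classical
  rw [gPrimeChain_apply ht z _ k N hN, Finsupp.finsetSum_apply, psi'Sum_eq_chainSum,
    Finset.sum_eq_single kap]
  · simp
  · intro mu hmu hne
    rw [Finsupp.smul_apply, Finsupp.single_eq_of_ne, smul_zero]
    intro h
    exact hne (occState_injective ((mem_box.1 hmu).1.trans_lt hN) h1 h.symm)
  · intro h
    rw [chainSum_eq_zero, mul_zero, zero_smul, Finsupp.zero_apply]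
    by_contra hle
    exact h (mem_box.2 ⟨not_lt.1 hle, h2⟩)

end Chains

/-! ### Multiplicities of parts -/

theorem card_filter_cellsOfRowLens (w : List ℕ) (j : ℕ) :
    ((YoungDiagram.cellsOfRowLens w).filter (fun c => c.2 = j)).card =
      w.countP (fun p => decide (j < p)) := by
  induction w with
  | nil => simp [YoungDiagram.cellsOfRowLens]
  | cons a w ih =>
    rw [YoungDiagram.cellsOfRowLens, Finset.filter_union, Finset.card_union_of_disjoint]
    · rw [Finset.filter_map, Finset.card_map, List.countP_cons, ← ih, add_comm]
      congr 1
      by_cases h : j < a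
      · have : (({0} : Finset ℕ) ×ˢ Finset.range a).filter (fun c => c.2 = j) = {(0, j)} := by
          ext ⟨x, y⟩
          simp only [Finset.mem_filter, Finset.mem_product, Finset.mem_singleton,
            Finset.mem_range, Prod.mk.injEq]
          constructor
          · rintro ⟨⟨h1, -⟩, h2⟩
            exact ⟨h1, h2⟩
          · rintro ⟨h1, h2⟩
            exact ⟨⟨h1, h2 ▸ h⟩, h2⟩
        rw [this]
        simp [h]
      · have : (({0} : Finset ℕ) ×ˢ Finset.range a).filter (fun c => c.2 = j) = ∅ := by
          ext ⟨x, y⟩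
          simp only [Finset.mem_filter, Finset.mem_product, Finset.mem_singleton,
            Finset.mem_range, Finset.notMem_empty, iff_false]
          rintro ⟨⟨-, h1⟩, h2⟩
          omega
        rw [this]
        simp [h]
    · rw [Finset.disjoint_left]
      rintro ⟨x, y⟩ h1 h2
      simp at h1 h2
      omega

theorem colLen_ofRowLens (w : List ℕ) (hw : w.SortedGE) (j : ℕ) :
    (YoungDiagram.ofRowLens w hw).colLen j = w.countP (fun p => decide (j < p)) := by
  rw [YoungDiagram.colLen_eq_card]
  exact card_filter_cellsOfRowLens w j

theorem colLen_eq_countP (lam : YoungDiagram) (j : ℕ) :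
    lam.colLen j = lam.rowLens.countP (fun p => decide (j < p)) := by
  conv_lhs => rw [← YoungDiagram.ofRowLens_to_rowLens_eq_self (μ := lam)]
  exact colLen_ofRowLens _ _ j

theorem colLen_eq_add_mult (lam : YoungDiagram) (j : ℕ) :
    lam.colLen j = lam.colLen (j + 1) + mult lam (j + 1) := by
  rw [colLen_eq_countP, colLen_eq_countP, mult]
  generalize lam.rowLens = w
  induction w with
  | nil => simp
  | cons a w ih =>
    rw [List.countP_cons, List.countP_cons, List.count_cons, ih]
    simp only [decide_eq_true_eq, beq_iff_eq]
    split_ifs <;> omega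

theorem colLen_removeParts (lam : YoungDiagram) {n j : ℕ} (h : j < n) :
    (removeParts n lam).colLen j + mult lam n = lam.colLen j := by
  rw [removeParts, colLen_ofRowLens, colLen_eq_countP, mult, List.countP_filter]
  generalize lam.rowLens = w
  induction w with
  | nil => simp
  | cons a w ih =>
    rw [List.countP_cons, List.countP_cons, List.count_cons, ← ih]
    simp only [decide_eq_true_eq, beq_iff_eq, Bool.and_eq_true]
    split_ifs <;> omega

theorem colLen_rectangle (n k j : ℕ) : (rectangle n k).colLen j = if j < n then k else 0 := by
  rw [rectangle, colLen_ofRowLens, List.countP_replicate]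
  simp

/-- Deleting the parts n shortens each of the first n columns by m_n(λ) = k - d. Both the cylindric
picture and the occupation numbers of λ rest on this relation. -/
theorem colLen_add_eq {k n d : ℕ} {lam : YoungDiagram} (hd : d + mult lam n = k)
    {j : ℕ} (hj : j < n) :
    lam.colLen j + d = (removeParts n lam).colLen j + k := by
  have := colLen_removeParts lam hj
  omega

theorem ediv_emod_natCast {n i : ℕ} (h : i < n) :
    (i : ℤ) / (n : ℤ) = 0 ∧ (i : ℤ) % (n : ℤ) = i :=
  ⟨Int.ediv_eq_zero_of_lt (by omega) (by omega), Int.emod_eq_of_lt (by omega) (by omega)⟩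

theorem CylTab.ext_entry {k n d N : ℕ} {lam mu : YoungDiagram} {T S : CylTab k n lam d mu N}
    (h : T.entry = S.entry) : T = S := by
  cases T; cases S; simp only at h; subst h; rfl

section Alcove

variable {k n : ℕ} [NeZero n] {lam : YoungDiagram} {d : ℕ}

theorem rowLen_removeParts_lt (hlam : lam ∈ alcove k n) : (removeParts n lam).rowLen 0 < n := by
  have hn : 0 < n := Nat.pos_of_ne_zero (NeZero.ne n)
  have h1 := colLen_removeParts lam (show n - 1 < n by omega)
  have h2 := colLen_eq_add_mult lam (n - 1)
  have h3 : lam.colLen n = 0 := colLen_eq_zero_iff.2 hlam.2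
  rw [show n - 1 + 1 = n by omega, h3] at h2
  have h4 : (removeParts n lam).colLen (n - 1) = 0 := by omega
  have := colLen_eq_zero_iff.1 h4
  omega

theorem colLen_removeParts_zero (hlam : lam ∈ alcove k n) (hd : d + mult lam n = k) :
    (removeParts n lam).colLen 0 = d := by
  have h1 := colLen_add_eq hd (Nat.pos_of_ne_zero (NeZero.ne n))
  have h2 : lam.colLen 0 = k := hlam.1
  omega

theorem occ_eq_occState (hlam : lam ∈ alcove k n) (hd : d + mult lam n = k) :
    occ n lam = occState n k (removeParts n lam).transpose := by
  have hn : 0 < n := Nat.pos_of_ne_zero (NeZero.ne n)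
  funext i
  have h1 := colLen_eq_add_mult lam i
  have h2 := colLen_removeParts lam i.2
  simp only [occ, occState, YoungDiagram.rowLen_transpose]
  split_ifs with hi
  · have h3 := colLen_removeParts lam hi
    omega
  · have h3 := colLen_removeParts_zero hlam hd
    have h4 : (i : ℕ) + 1 = n := by omega
    rw [h4]
    omega

theorem occ_rectangle (n k : ℕ) : occ n (rectangle n k) = occState n k ⊥ := by
  funext i
  have h1 := colLen_eq_add_mult (rectangle n k) i
  rw [colLen_rectangle, colLen_rectangle, if_pos i.2] at h1
  simp only [occ, occState, rowLen_bot]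
  split_ifs at h1 ⊢ <;> omega

/-! ### Cylindric tableaux of shape `λ'/d/k^n` -/

theorem conjLoop_rectangle (i : ℤ) :
    conjLoop k n (rectangle n k) 0 i = k - (i / (n : ℤ)) * k := by
  have hn : (0 : ℤ) < n := by exact_mod_cast Nat.pos_of_ne_zero (NeZero.ne n)
  have h1 := Int.emod_nonneg i hn.ne'
  have h2 := Int.emod_lt_of_pos i hn
  rw [conjLoop, colLen_rectangle, if_pos (by omega), add_zero]

theorem conjLoop_alcove (hd : d + mult lam n = k) (i : ℤ) :
    conjLoop k n lam d i =
      k - (i / (n : ℤ)) * k + (removeParts n lam).transpose.rowLen (i % (n : ℤ)).toNat := by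
  have hn : (0 : ℤ) < n := by exact_mod_cast Nat.pos_of_ne_zero (NeZero.ne n)
  have h1 := Int.emod_nonneg i hn.ne'
  have h2 := Int.emod_lt_of_pos i hn
  have h3 := colLen_add_eq hd (show (i % (n : ℤ)).toNat < n by omega)
  rw [conjLoop, YoungDiagram.rowLen_transpose]
  generalize (i / (n : ℤ)) * (k : ℤ) = q
  omega

/-- The diagram is a union of copies of λ̃', the copy in period q being translated by (qn, k - qk).
-/
theorem mem_cylDiagram (hd : d + mult lam n = k) {i j : ℤ} :
    (i, j) ∈ cylDiagram k n lam d (rectangle n k) ↔ 0 ≤ j - k + (i / (n : ℤ)) * k ∧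
      ((i % (n : ℤ)).toNat, (j - k + (i / (n : ℤ)) * k).toNat) ∈
        (removeParts n lam).transpose := by
  rw [YoungDiagram.mem_iff_lt_rowLen]
  simp only [cylDiagram, Set.mem_ofPred_eq]
  rw [conjLoop_rectangle, conjLoop_alcove hd]
  generalize (i / (n : ℤ)) * (k : ℤ) = q
  omega

theorem ediv_emod_succ {i : ℤ} (h : i % (n : ℤ) + 1 < n) :
    (i + 1) / (n : ℤ) = i / (n : ℤ) ∧ (i + 1) % (n : ℤ) = i % (n : ℤ) + 1 := by
  have hn : (0 : ℤ) < n := by exact_mod_cast Nat.pos_of_ne_zero (NeZero.ne n)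
  refine (Int.ediv_emod_unique hn).2 ⟨?_, ?_, h⟩
  · have := Int.emod_add_mul_ediv i n
    linarith
  · have := Int.emod_nonneg i hn.ne'
    omega

/-- The cylindric tableau of shape `λ'/d/k^n` obtained by repeating a tableau periodically. -/
def cylOfTab (hlam : lam ∈ alcove k n) (hd : d + mult lam n = k) {N : ℕ}
    (T : Tab (removeParts n lam).transpose N) : CylTab k n lam d (rectangle n k) N where
  entry i j := if 0 ≤ j - k + (i / (n : ℤ)) * k then
    T.1 (i % (n : ℤ)).toNat (j - k + (i / (n : ℤ)) * k).toNat else 0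
  nested i := by
    rw [conjLoop_rectangle, conjLoop_alcove hd]
    omega
  bounded i j h := by
    have h' := (mem_cylDiagram hd).1 h
    rw [if_pos h'.1]
    exact T.2 _ _ h'.2
  zeros i j h := by
    rw [mem_cylDiagram hd] at h
    split_ifs with h1
    · exact T.1.zeros fun h2 => h ⟨h1, h2⟩
    · rfl
  periodic i j := by
    have hn : (n : ℤ) ≠ 0 := by exact_mod_cast NeZero.ne n
    have h1 : (i + n) / (n : ℤ) = i / n + 1 := Int.add_ediv_of_dvd_right (dvd_refl _) |>.trans
      (by rw [Int.ediv_self hn])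
    have h2 : (i + n) % (n : ℤ) = i % n := Int.add_emod_right i n
    rw [h1, h2, show j - k - k + (i / (n : ℤ) + 1) * k = j - k + i / (n : ℤ) * k by ring]
  col_strict i j h1 h2 := by
    have hn : (0 : ℤ) < n := by exact_mod_cast Nat.pos_of_ne_zero (NeZero.ne n)
    have h1' := (mem_cylDiagram hd).1 h1
    have h2' := (mem_cylDiagram hd).1 h2
    have h3 := Int.emod_nonneg i hn.ne'
    -- The last row of a period is empty because λ̃ has all parts below n. Two vertically adjacent
    -- cells therefore always belong to the same period.
    have h4 : i % (n : ℤ) + 1 < n := by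
      by_contra hlt
      have h5 := YoungDiagram.mem_iff_lt_rowLen.1 h1'.2
      have h6 := rowLen_removeParts_lt hlam
      have h7 : (removeParts n lam).transpose.rowLen (i % (n : ℤ)).toNat = 0 :=
        rowLen_eq_zero_iff.2 (by rw [YoungDiagram.colLen_transpose]; omega)
      omega
    obtain ⟨h5, h6⟩ := ediv_emod_succ h4
    rw [if_pos h1'.1, if_pos h2'.1]
    rw [h5, h6] at h2' ⊢
    exact T.1.col_strict (by omega) h2'.2
  row_weak i j h1 h2 := by
    have h1' := (mem_cylDiagram hd).1 h1
    have h2' := (mem_cylDiagram hd).1 h2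
    rw [if_pos h1'.1, if_pos h2'.1]
    exact T.1.row_weak_of_le (by omega) h2'.2

theorem cylOfTab_apply (hlam : lam ∈ alcove k n) (hd : d + mult lam n = k) {N : ℕ}
    (T : Tab (removeParts n lam).transpose N) {i c : ℕ} (hi : i < n) :
    (cylOfTab hlam hd T).entry i (k + c) = T.1 i c := by
  obtain ⟨h1, h2⟩ := ediv_emod_natCast hi
  change (if 0 ≤ (k + c : ℤ) - k + ((i : ℤ) / (n : ℤ)) * k then
    T.1 ((i : ℤ) % (n : ℤ)).toNat ((k + c : ℤ) - k + ((i : ℤ) / (n : ℤ)) * k).toNat else 0) = _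
  rw [h1, h2, show ((k : ℤ) + c - k + 0 * k) = c by ring, if_pos (by omega)]
  simp

theorem fst_lt_of_mem (hlam : lam ∈ alcove k n) {i c : ℕ}
    (h : (i, c) ∈ (removeParts n lam).transpose) : i < n := by
  have h1 := YoungDiagram.mem_iff_lt_colLen.1 h
  have h2 := (removeParts n lam).transpose.colLen_anti 0 c (Nat.zero_le _)
  have h3 := rowLen_removeParts_lt hlam
  have h4 := YoungDiagram.colLen_transpose (removeParts n lam) 0
  omega

/-- The inverse restricts a cylindric tableau to one period. The inequalities between neighbours are
chained to obtain those between arbitrary cells of a row or column, and periodicity recovers the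
remaining entries. -/
theorem cylOfTab_bijective (hlam : lam ∈ alcove k n) (hd : d + mult lam n = k) (N : ℕ) :
    Function.Bijective (cylOfTab hlam hd (N := N)) := by
  constructor
  · intro T S h
    apply Subtype.ext
    ext i c
    by_cases hc : (i, c) ∈ (removeParts n lam).transpose
    · have hi := fst_lt_of_mem hlam hc
      rw [← cylOfTab_apply hlam hd T hi, ← cylOfTab_apply hlam hd S hi, h]
    · rw [T.1.zeros hc, S.1.zeros hc]
  · intro C
    have hmem : ∀ {i c : ℕ}, (i, c) ∈ (removeParts n lam).transpose →
        ((i : ℤ), ((k : ℤ) + c)) ∈ cylDiagram k n lam d (rectangle n k) := by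
      intro i c hc
      obtain ⟨h1, h2⟩ := ediv_emod_natCast (fst_lt_of_mem hlam hc)
      rw [mem_cylDiagram hd, h1, h2, show ((k : ℤ) + c - k + 0 * k) = c by ring]
      exact ⟨by omega, by simpa using hc⟩
    have hrow : ∀ (i s c : ℕ), (i, c + s) ∈ (removeParts n lam).transpose →
        C.entry i (k + c) ≤ C.entry i (k + (c + s : ℕ)) := by
      intro i s
      induction s with
      | zero => intro c _; simp
      | succ s ih =>
        intro c hc
        have hc' : (i, c + s) ∈ (removeParts n lam).transpose :=
          YoungDiagram.up_left_mem _ le_rfl (by omega) hc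
        refine (ih c hc').trans ?_
        have h1 := hmem hc
        rw [show ((k : ℤ) + (c + (s + 1) : ℕ)) = (k : ℤ) + (c + s : ℕ) + 1 by push_cast; ring]
          at h1 ⊢
        exact C.row_weak _ _ (hmem hc') h1
    have hcol : ∀ (c s i : ℕ), (i + s + 1, c) ∈ (removeParts n lam).transpose →
        C.entry i (k + c) < C.entry (i + s + 1 : ℕ) (k + c) := by
      intro c s
      induction s with
      | zero =>
        intro i hc
        have hc' : (i, c) ∈ (removeParts n lam).transpose :=
          YoungDiagram.up_left_mem _ (by omega) le_rfl hc
        have h1 := hmem hc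
        rw [show ((i + 0 + 1 : ℕ) : ℤ) = (i : ℤ) + 1 by push_cast; ring] at h1 ⊢
        exact C.col_strict _ _ (hmem hc') h1
      | succ s ih =>
        intro i hc
        have hc' : (i + s + 1, c) ∈ (removeParts n lam).transpose :=
          YoungDiagram.up_left_mem _ (by omega) le_rfl hc
        refine (ih i hc').trans ?_
        have h1 := hmem hc
        rw [show ((i + (s + 1) + 1 : ℕ) : ℤ) = ((i + s + 1 : ℕ) : ℤ) + 1 by push_cast; ring]
          at h1 ⊢
        exact C.col_strict _ _ (hmem hc') h1
    let T : Tab (removeParts n lam).transpose N :=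
      ⟨{ entry := fun i c => if (i, c) ∈ (removeParts n lam).transpose then
            C.entry i (k + c) else 0
         row_weak' := by
          intro i c1 c2 h hc
          rw [if_pos hc, if_pos (YoungDiagram.up_left_mem _ le_rfl h.le hc)]
          obtain ⟨s, rfl⟩ := Nat.exists_eq_add_of_le h.le
          exact hrow i s c1 hc
         col_strict' := by
          intro i1 i2 c h hc
          rw [if_pos hc, if_pos (YoungDiagram.up_left_mem _ h.le le_rfl hc)]
          obtain ⟨s, rfl⟩ := Nat.exists_eq_add_of_lt h
          exact hcol c s i1 hc
         zeros' := by
          intro i c hc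
          rw [if_neg hc] }, by
        intro i c hc
        change (if (i, c) ∈ (removeParts n lam).transpose then C.entry i (k + c) else 0) < N
        rw [if_pos hc]
        exact C.bounded _ _ (hmem hc)⟩
    have hT : ∀ i c, (i, c) ∈ (removeParts n lam).transpose → T.1 i c = C.entry i (k + c) :=
      fun i c hc => if_pos hc
    refine ⟨T, CylTab.ext_entry ?_⟩
    funext i j
    by_cases hc : (i, j) ∈ cylDiagram k n lam d (rectangle n k)
    · have hn : (0 : ℤ) < n := by exact_mod_cast Nat.pos_of_ne_zero (NeZero.ne n)
      have hc' := (mem_cylDiagram hd).1 hc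
      have e1 := C.periodic_int (i / n) (i % n) (j + (i / n) * k)
      rw [Int.emod_add_ediv_mul, add_sub_cancel_right] at e1
      have e2 : (cylOfTab hlam hd T).entry i j =
          T.1 (i % (n : ℤ)).toNat (j - k + (i / (n : ℤ)) * k).toNat := if_pos hc'.1
      rw [e1, e2, hT _ _ hc'.2, Int.toNat_of_nonneg (Int.emod_nonneg i hn.ne'),
        Int.toNat_of_nonneg hc'.1]
      congr 1
      ring
    · rw [CylTab.zeros _ _ _ hc, CylTab.zeros _ _ _ hc]

theorem card_filter_cylOfTab (hlam : lam ∈ alcove k n) (hd : d + mult lam n = k) {N : ℕ}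
    (T : Tab (removeParts n lam).transpose N) {i : ℕ} (hi : i < n) (P : ℕ → Prop)
    [DecidablePred P] :
    ((Finset.Ico (conjLoop k n (rectangle n k) 0 i) (conjLoop k n lam d i)).filter
      (fun j => P ((cylOfTab hlam hd T).entry i j))).card =
    (((removeParts n lam).transpose.row i).filter (fun c => P (T.1 c.1 c.2))).card := by
  obtain ⟨h1, h2⟩ := ediv_emod_natCast hi
  rw [conjLoop_rectangle, conjLoop_alcove hd, h1, h2, zero_mul, sub_zero, Int.toNat_natCast]
  symm
  refine Finset.card_bij (fun c _ => (k : ℤ) + c.2) ?_ ?_ ?_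
  · rintro ⟨i', c⟩ h
    simp only [Finset.mem_filter, YoungDiagram.mem_row_iff] at h
    obtain ⟨⟨hc, rfl⟩, hP⟩ := h
    have := YoungDiagram.mem_iff_lt_rowLen.1 hc
    rw [Finset.mem_filter, Finset.mem_Ico, cylOfTab_apply hlam hd T hi]
    exact ⟨by omega, hP⟩
  · rintro ⟨i1, c1⟩ h1 ⟨i2, c2⟩ h2 h
    simp only [Finset.mem_filter, YoungDiagram.mem_row_iff] at h1 h2 h
    exact Prod.ext (h1.1.2.trans h2.1.2.symm) (by simp only; omega)
  · intro j hj
    rw [Finset.mem_filter, Finset.mem_Ico] at hj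
    obtain ⟨c, rfl⟩ : ∃ c : ℕ, j = k + c := ⟨(j - k).toNat, by omega⟩
    rw [cylOfTab_apply hlam hd T hi] at hj
    refine ⟨(i, c), ?_, rfl⟩
    rw [Finset.mem_filter, YoungDiagram.mk_mem_row_iff, YoungDiagram.mem_iff_lt_rowLen]
    exact ⟨by omega, hj.2⟩

theorem loopLT_cylOfTab (hlam : lam ∈ alcove k n) (hd : d + mult lam n = k) {N : ℕ}
    (T : Tab (removeParts n lam).transpose N) {i : ℕ} (hi : i < n) (a : ℕ) :
    (cylOfTab hlam hd T).loopLT a i = k + (T.sub a).rowLen i := by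
  rw [CylTab.loopLT, card_filter_cylOfTab hlam hd T hi (fun x => x < a), conjLoop_rectangle,
    (ediv_emod_natCast hi).1, ← T.rowLT_eq, Tab.rowLT, zero_mul, sub_zero]

theorem wt_cylOfTab (hlam : lam ∈ alcove k n) (hd : d + mult lam n = k) {N : ℕ}
    (T : Tab (removeParts n lam).transpose N) : (cylOfTab hlam hd T).wt = T.wt := by
  funext a
  rw [CylTab.wt, Tab.wt, Finset.card_eq_sum_card_fiberwise (f := Prod.fst) (t := Finset.range n)]
  · refine Finset.sum_congr rfl fun i hi => ?_
    rw [card_filter_cylOfTab hlam hd T (Finset.mem_range.1 hi) (fun x => x = a),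
      YoungDiagram.row, Finset.filter_filter, Finset.filter_filter]
    congr 1
    exact Finset.filter_congr fun c _ => and_comm
  · rintro ⟨i, c⟩ hc
    simp only [Finset.coe_filter, Set.mem_ofPred_eq, YoungDiagram.mem_cells] at hc
    simpa using fst_lt_of_mem hlam hc.1

theorem Psi'_cylOfTab {F : Type*} [Field F] {t : F} (ht : ∀ m : ℕ, 0 < m → t ^ m ≠ 1)
    (hlam : lam ∈ alcove k n) (hd : d + mult lam n = k) {N : ℕ}
    (T : Tab (removeParts n lam).transpose N) : (cylOfTab hlam hd T).Psi' t = T.psi' t := by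
  have hn : 0 < n := Nat.pos_of_ne_zero (NeZero.ne n)
  have hcol : ∀ a, (T.sub a).colLen 0 < n := fun a =>
    ((colLen_zero_mono (T.sub_le a)).trans_eq (YoungDiagram.colLen_transpose _ _)).trans_lt
      (rowLen_removeParts_lt hlam)
  rw [Tab.psi'_eq, CylTab.Psi']
  refine Finset.prod_congr rfl fun a _ => ?_
  rw [stripPsi'_eq t (T.sub_mono (Nat.le_succ a)) (hcol (a + 1)).le, cylPsi']
  refine Finset.prod_congr rfl fun i hi => ?_
  have hi' := Finset.mem_range.1 hi
  rw [loopLT_cylOfTab hlam hd T hi', loopLT_cylOfTab hlam hd T hi']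
  by_cases hin : i + 1 < n
  · have := loopLT_cylOfTab hlam hd T hin (a + 1)
    rw [Nat.cast_add, Nat.cast_one] at this
    rw [this]
    congr 1 <;> ring
  · have hz : ∀ b, (T.sub b).rowLen i = 0 := fun b =>
      rowLen_eq_zero_iff.2 (by have := hcol b; omega)
    have hz' : (T.sub (a + 1)).rowLen (i + 1) = 0 :=
      rowLen_eq_zero_iff.2 (by have := hcol (a + 1); omega)
    -- For i = n - 1 the factor involves the first row of the next period. That row ends no further
    -- than d ≤ k, so the upper entry is nonnegative; the lower entry is 0 and the binomial equals
    -- 1.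
    have hbound : (cylOfTab hlam hd T).loopLT (a + 1) ((i : ℤ) + 1) ≤ k := by
      have h1 : ((i : ℤ) + 1) = n := by omega
      have hn' : (n : ℤ) ≠ 0 := by omega
      have h2 := Finset.card_filter_le (Finset.Ico (conjLoop k n (rectangle n k) 0 n)
        (conjLoop k n lam d n)) (fun j => (cylOfTab hlam hd T).entry n j < a + 1)
      rw [h1, CylTab.loopLT]
      rw [Int.card_Ico] at h2
      have h3 := (cylOfTab hlam hd T).nested n
      have h4 : conjLoop k n lam d n ≤ k := by
        rw [conjLoop_alcove hd, Int.ediv_self hn', Int.emod_self, Int.toNat_zero,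
          YoungDiagram.rowLen_transpose, colLen_removeParts_zero hlam hd]
        omega
      omega
    rw [hz, hz, hz']
    simp only [Nat.cast_zero, add_zero, sub_self]
    rw [qBinom_zero_right ht (by omega), qBinom_zero_right ht le_rfl]

/-- For `μ = n^k` the cylindric function is the function `P'` of an ordinary partition. -/
theorem cylMacP'_rectangle {F : Type*} [Field F] {t : F} (ht : ∀ m : ℕ, 0 < m → t ^ m ≠ 1)
    (hlam : lam ∈ alcove k n) (hd : d + mult lam n = k) (N : ℕ) :
    cylMacP' t k n N lam d (rectangle n k) = macP' t N (removeParts n lam).transpose := by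
  rw [cylMacP', macP']
  symm
  refine Fintype.sum_bijective _ (cylOfTab_bijective hlam hd N) _ _ fun T => ?_
  rw [Psi'_cylOfTab ht, wt_cylOfTab, Tab.expo]

end Alcove

/-! ### Matrix elements -/

section MatrixElements

variable {F : Type*} [Field F] {k n : ℕ} [NeZero n] {lam : YoungDiagram} {d : ℕ}

theorem matElt_reverse_prod {t : F} (ht : ∀ m : ℕ, 0 < m → t ^ m ≠ 1) (z : F)
    (hlam : lam ∈ alcove k n) (hd : d + mult lam n = k) {N : ℕ} (hN : N < n) (th : Fin N → ℤ) :
    matElt lam (List.ofFn (fun i => gPrimeInt t z n (th i))).reverse.prod (rectangle n k) =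
      z ^ d * psi'Sum t (removeParts n lam).transpose th := by
  have h1 : (removeParts n lam).transpose.colLen 0 < n := by
    rw [YoungDiagram.colLen_transpose]; exact rowLen_removeParts_lt hlam
  have h2 : (removeParts n lam).transpose.rowLen 0 = d := by
    rw [YoungDiagram.rowLen_transpose]; exact colLen_removeParts_zero hlam hd
  have h3 := gPrimeChain_coeff ht z th hN _ h1 (k := k) (by omega)
  rw [gPrimeChain_eq_prod, h2] at h3
  simp only [extVar_coe] at h3
  rw [matElt, occ_rectangle, occ_eq_occState hlam hd, h3]

/-- In 𝐠'_{κ_1} ⋯ 𝐠'_{κ_ℓ} the last factor acts first, so chains pick up the parts of κ in reversed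
order. The reversal is undone afterwards by the symmetry of P'. -/
theorem gPrimeProd_eq_reverse_prod (t z : F) (lam : YoungDiagram) :
    gPrimeProd t z n lam =
      (List.ofFn (fun i : Fin (lam.colLen 0) =>
        gPrimeInt t z n (lam.rowLen (Fin.revPerm i : Fin (lam.colLen 0)) : ℤ))).reverse.prod := by
  rw [gPrimeProd, YoungDiagram.rowLens, List.map_map]
  congr 1
  refine List.ext_getElem (by simp) fun i h1 h2 => ?_
  simp only [List.length_map, List.length_range] at h1
  simp only [List.getElem_map, List.getElem_range, Function.comp_apply, List.getElem_reverse,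
    List.getElem_ofFn, List.length_ofFn, Fin.revPerm_apply, Fin.val_rev, gPrimeInt,
    Int.natCast_nonneg, if_true, Int.toNat_natCast]
  congr 2
  omega

theorem matElt_gPrimeProd {t : F} (ht : ∀ m : ℕ, 0 < m → t ^ m ≠ 1) (z : F)
    (hlam : lam ∈ alcove k n) (hd : d + mult lam n = k) {kap : YoungDiagram}
    (hN : kap.colLen 0 < n) :
    matElt lam (gPrimeProd t z n kap) (rectangle n k) =
      z ^ d * psi'Sum t (removeParts n lam).transpose
        (fun i : Fin (kap.colLen 0) => (kap.rowLen i : ℤ)) := by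
  rw [gPrimeProd_eq_reverse_prod, matElt_reverse_prod ht z hlam hd hN,
    psi'Sum_transpose_perm ht _ Fin.revPerm (fun i : Fin (kap.colLen 0) => kap.rowLen i)]

theorem matElt_SPrime {t : F} (ht : ∀ m : ℕ, 0 < m → t ^ m ≠ 1) (z : F)
    (hlam : lam ∈ alcove k n) (hd : d + mult lam n = k) {kap : YoungDiagram}
    (hN : kap.colLen 0 < n) :
    matElt lam (SPrime t z n kap) (rectangle n k) =
      z ^ d * ∑ w : Equiv.Perm (Fin (kap.colLen 0)),
        (((Equiv.Perm.sign w : ℤˣ) : ℤ) : F) *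
          psi'Sum t (removeParts n lam).transpose (shifted kap w) := by
  rw [Finset.mul_sum, matElt, SPrime, LinearMap.sum_apply, Finsupp.finsetSum_apply]
  refine Finset.sum_congr rfl fun w _ => ?_
  have h := matElt_reverse_prod ht z hlam hd hN (shifted kap w)
  rw [matElt] at h
  rw [LinearMap.smul_apply, Finsupp.smul_apply, h, zsmul_eq_mul]
  ring

end MatrixElements

/-- Insert P'_{λ'} = ∑_μ K_{μλ}(t) s_{μ'} and exchange the sums. The signed sum of Kostka numbers of
shape μ' over the weights ν'(w) is 1 for μ = ν and 0 otherwise. -/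
theorem aeval_kostkaFoulkes_eq_sum {F : Type*} [Field F] {t : F}
    (ht : ∀ m : ℕ, 0 < m → t ^ m ≠ 1) (nu lam : YoungDiagram) :
    Polynomial.aeval t (kostkaFoulkes nu lam) =
      ∑ w : Equiv.Perm (Fin (nu.transpose.colLen 0)),
        (((Equiv.Perm.sign w : ℤˣ) : ℤ) : F) *
          psi'Sum t lam.transpose (shifted nu.transpose w) := by
  classical
  simp only [psi'Sum_transpose ht, Finset.mul_sum]
  rw [Finset.sum_comm]
  have key : ∀ mu : Part lam.card,
      ∑ w : Equiv.Perm (Fin (nu.transpose.colLen 0)), (((Equiv.Perm.sign w : ℤˣ) : ℤ) : F) *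
        (Polynomial.aeval t (kostkaFoulkes mu.1 lam) *
          (kostka mu.1.transpose (shifted nu.transpose w) : F)) =
      if mu.1 = nu then Polynomial.aeval t (kostkaFoulkes mu.1 lam) else 0 := by
    intro mu
    have h := congrArg (Int.cast : ℤ → F) (sum_sign_mul_kostka mu.1.transpose nu.transpose)
    push_cast at h
    simp only [YoungDiagram.transpose_eq_iff] at h
    simp only [mul_left_comm _ (Polynomial.aeval t (kostkaFoulkes mu.1 lam))]
    rw [← Finset.mul_sum, h]
    simp
  simp only [key]
  by_cases hc : nu.card = lam.card
  · rw [Finset.sum_eq_single (⟨nu, hc⟩ : Part lam.card)]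
    · simp
    · intro mu _ hne
      exact if_neg fun h => hne (Subtype.ext h)
    · simp
  · rw [kostkaFoulkes, dif_neg hc, map_zero]
    refine (Finset.sum_eq_zero fun mu _ => if_neg fun h => hc ?_).symm
    rw [← h, mu.2]

end

end CylMac

theorem mainTheorem8 {F : Type*} [Field F] (t z : F) (ht : ∀ m : ℕ, 0 < m → t ^ m ≠ 1)
    (k n : ℕ) [NeZero n] (lam : YoungDiagram) (hlam : lam ∈ alcove k n)
    (d : ℕ) (hd : d + mult lam n = k) :
    (∀ N : ℕ, 1 ≤ N → N < n →
      cylMacP' t k n N lam d (rectangle n k) = macP' t N (removeParts n lam).transpose) ∧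
    (∀ nu ∈ redAlcove k n,
      (matElt lam (gPrimeProd t z n nu.transpose) (rectangle n k) =
          z ^ d * ∑ mu : Part (removeParts n lam).card,
            Polynomial.aeval t (kostkaFoulkes mu.1 (removeParts n lam)) *
              (kostka mu.1.transpose
                (fun i : Fin (nu.transpose.colLen 0) => (nu.transpose.rowLen i : ℤ)) : F) ∧
        (∑ mu : Part (removeParts n lam).card,
            Polynomial.aeval t (kostkaFoulkes mu.1 (removeParts n lam)) *
              (kostka mu.1.transpose
                (fun i : Fin (nu.transpose.colLen 0) => (nu.transpose.rowLen i : ℤ)) : F)) =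
          psi'Sum t (removeParts n lam).transpose
            (fun i : Fin (nu.transpose.colLen 0) => (nu.transpose.rowLen i : ℤ))) ∧
      (matElt lam (SPrime t z n nu.transpose) (rectangle n k) =
          z ^ d * Polynomial.aeval t (kostkaFoulkes nu (removeParts n lam)) ∧
        Polynomial.aeval t (kostkaFoulkes nu (removeParts n lam)) =
          ∑ w : Equiv.Perm (Fin (nu.transpose.colLen 0)),
            (((Equiv.Perm.sign w : ℤˣ) : ℤ) : F) *
              psi'Sum t (removeParts n lam).transpose (shifted nu.transpose w))) := by
  refine ⟨fun N _ _ => cylMacP'_rectangle ht hlam hd N, fun nu hnu => ?_⟩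
  -- The number of operators is the length ν_1 of ν', and ν_1 < n is what keeps the chains of
  -- partitions below n rows.
  have hN : nu.transpose.colLen 0 < n := by
    rw [YoungDiagram.colLen_transpose]; exact hnu.2
  have hP := psi'Sum_transpose ht (removeParts n lam)
    (fun i : Fin (nu.transpose.colLen 0) => (nu.transpose.rowLen i : ℤ))
  have hK := aeval_kostkaFoulkes_eq_sum ht nu (removeParts n lam)
  refine ⟨⟨?_, hP.symm⟩, ?_, hK⟩
  · rw [matElt_gPrimeProd ht z hlam hd hN, hP]
  · rw [matElt_SPrime ht z hlam hd hN, hK]
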